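/- Let $\Omega_1=B_{r_1}(\mathbf x_1)$ and $\Omega_2=B_{r_2}(\mathbf x_2)$ be two open disks in $\mathbb R^2$ whose intersection is non-empty and neither of which is contained in the other. Let $\mathrm L^2(\partial\Omega_j)$ be the complex Hilbert space of square-integrable functions on $\partial\Omega_j$ with respect to the one-dimensional Hausdorff measure $\mathscr H^1$. For $\{i,j\}=\{1,2\}$ let $\gamma_j:\mathrm L^2(\partial\Omega_i)\to\mathrm L^2(\partial\Omega_j)$ be the Dirichlet-to-Dirichlet map: $\gamma_j g$ is the restriction to $\partial\Omega_j\cap\Omega_i$, extended by zero to the rest of $\partial\Omega_j$, of the Poisson integral $$\mathrm P_i[g](\mathbf x)=\frac1{2\pi}\int_{\partial\Omega_i}\frac{r_i^2-|\mathbf x-\mathbf x_i|^2}{r_i|\mathbf x-\mathbf y|^2}\,g(\mathbf y)\,\mathrm d\mathscr H^1(\mathbf y),\qquad \mathbf x\in\Omega_i .$$ Let $\mathcal S^*=\{z\in\mathbb C:|\mathrm{Im}\,z|<1/2\}$, and let $\mathbb H^2(\mathcal S^*)$ be the space of holomorphic functions $h$ on $\mathcal S^*$ with $\sup_{|y|<1/2}\int_{\mathbb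 R}|h_y(x)|^2\,\mathrm dx<\infty$, where $h_y(x)=h(x+\mathrm iy)$. For $\sigma\in(0,2\pi)$ let $\mathbb H^2_\sigma$ be this space with the norm $$\|h\|_\sigma^2=\frac1{2\pi}\int_{\mathbb R}\frac{|h_{1/2}(x)|^2+|h_{-1/2}(x)|^2}2-\cos(\sigma)\,|h_0(x)|^2\,\mathrm dx ,$$ where the boundary values $h_{\pm1/2}\in\mathrm L^2(\mathbb R)$ are the weak $\mathrm L^2(\mathbb R)$-limits of $h_y$ as $y\to\pm1/2$ inside $(-1/2,1/2)$; products $\mathbb H^2_\sigma\times\mathbb H^2_{\sigma+\pi}$ carry the norm $(\|f\|_\sigma^2+\|g\|_{\sigma+\pi}^2)^{1/2}$. For $\theta\in(0,\pi)$ let $\mathscr P_\theta(\tau)=\frac1{2\pi}\frac{\sin\theta}{\cosh\tau-\cos\theta}$ be the Poisson kernel of the strip $\mathbb R\times(0,\pi)$ and $\widehat{\mathscr P}_\theta(z)=\int_{\mathbb R}e^{-\mathrm iz\tau}\mathscr P_\theta(\tau)\,\mathrm d\tau$, $z\in\mathcal S^*$, its Fourier transform. **Theorem.** The maps $\gamma_1,\gamma_2$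 are well-defined bounded linear operators, and there exist $\sigma_1,\sigma_2\in(0,\pi)$ with $\sigma_1<\sigma_2$ such that, with $\theta=\sigma_2-\sigma_1$, the following holds. 1. For $\varphi\in\{\theta,\pi-\theta\}$ and $z\in\mathcal S^*\setminus\{0\}$, $\ \widehat{\mathscr P}_\varphi(z)=\dfrac{\sinh((\pi-\varphi)z)}{\sinh(\pi z)}$. 2. All functions in $\mathbb H^2(\mathcal S^*)$ have the boundary values above, and there exist unitary maps (norm-preserving linear bijections) $U_j:\mathrm L^2(\partial\Omega_j)\to\mathbb H^2_{\sigma_j}\times\mathbb H^2_{\sigma_j+\pi}$, $j=1,2$, such that $$U_2\gamma_1^*U_1^{-1}=T_1,\qquad U_1\gamma_2^*U_2^{-1}=T_2,\qquad U_1(\gamma_1\gamma_2)^*U_1^{-1}=T_{21},$$ where $$T_1:\mathbb H^2_{\sigma_1}\times\mathbb H^2_{\sigma_1+\pi}\to\mathbb H^2_{\sigma_2}\times\mathbb H^2_{\sigma_2+\pi},\quad T_1(f,g)=\bigl(\widehat{\mathscr P}_{\pi-\theta}\,g,\ \widehat{\mathscr P}_{\theta}\,g\bigr),$$ $$T_2:\mathbb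 H^2_{\sigma_2}\times\mathbb H^2_{\sigma_2+\pi}\to\mathbb H^2_{\sigma_1}\times\mathbb H^2_{\sigma_1+\pi},\quad T_2(f,g)=\bigl(\widehat{\mathscr P}_{\theta}\,f,\ \widehat{\mathscr P}_{\pi-\theta}\,f\bigr),$$ $$T_{21}:\mathbb H^2_{\sigma_1}\times\mathbb H^2_{\sigma_1+\pi}\to\mathbb H^2_{\sigma_1}\times\mathbb H^2_{\sigma_1+\pi},\quad T_{21}(f,g)=\bigl(\widehat{\mathscr P}_{\theta}\widehat{\mathscr P}_{\pi-\theta}\,g,\ \widehat{\mathscr P}_{\pi-\theta}^{\,2}\,g\bigr).$$ -/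

import Mathlib

open MeasureTheory Set Filter Topology

noncomputable section

/-- The Euclidean plane. -/
abbrev Plane : Type := EuclideanSpace ℝ (Fin 2)

/-- Arc length (one-dimensional Hausdorff measure) on the circle with center `c` and radius `r`. -/
abbrev circleMeasure (c : Plane) (r : ℝ) : Measure Plane :=
  (μH[1] : Measure Plane).restrict (Metric.sphere c r)

/-- The complex Hilbert space of square-integrable functions on the circle. -/
abbrev L2Circle (c : Plane) (r : ℝ) : Type := Lp ℂ 2 (circleMeasure c r)

/-- The Poisson integral of `g` in the disk with center `c` and radius `r`. -/
def diskPoisson (c : Plane) (r : ℝ) (g : Plane → ℂ) (x : Plane) : ℂ :=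
  (1 / (2 * Real.pi) : ℝ) •
    ∫ y, ((r ^ 2 - ‖x - c‖ ^ 2) / (r * ‖x - y‖ ^ 2)) • g y ∂(circleMeasure c r)

/-- `γ` is the Dirichlet-to-Dirichlet map from the boundary of the disk `B_r(c)` to the boundary of
the disk `B_s(d)`: `γ g` is the Poisson integral of `g` on the part of the second circle inside
`B_r(c)`, extended by zero to the rest of that circle. -/
def IsDtD (c : Plane) (r : ℝ) (d : Plane) (s : ℝ) (γ : L2Circle c r →L[ℂ] L2Circle d s) : Prop :=
  ∀ g : L2Circle c r,
    (γ g : Plane → ℂ) =ᵐ[circleMeasure d s] (Metric.ball c r).indicator (diskPoisson c r g)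

/-- The Poisson kernel on the strip `ℝ × (0, π)`. -/
def stripPoisson (θ : ℝ) (τ : ℝ) : ℝ :=
  1 / (2 * Real.pi) * (Real.sin θ / (Real.cosh τ - Real.cos θ))

/-- The Fourier transform of the Poisson kernel, at complex frequencies. -/
def stripPoissonHat (θ : ℝ) (z : ℂ) : ℂ :=
  ∫ τ : ℝ, Complex.exp (-Complex.I * z * (τ : ℂ)) * (stripPoisson θ τ : ℂ)

/-- The dual strip `ℝ × (-1/2, 1/2)`. -/
def dualStrip : Set ℂ := {z | -(1 / 2) < z.im ∧ z.im < 1 / 2}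

/-- The restriction `h_y(x) = h(x + iy)`. -/
def hSlice (h : ℂ → ℂ) (y : ℝ) (x : ℝ) : ℂ := h ((x : ℂ) + (y : ℂ) * Complex.I)

/-- The Hardy space of the dual strip. A function on the strip is represented by its extension by
zero to the plane, so that equality of elements is equality on the strip. -/
def hardySpace : Submodule ℂ (ℂ → ℂ) where
  carrier := {h | DifferentiableOn ℂ h dualStrip ∧ (∀ z, z ∉ dualStrip → h z = 0) ∧
    ∃ C : NNReal, ∀ y ∈ Ioo (-(1 / 2) : ℝ) (1 / 2), ∫⁻ x : ℝ, ‖hSlice h y x‖ₑ ^ 2 ≤ C}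
  zero_mem' := by
    refine ⟨differentiableOn_const 0, fun _ _ => rfl, 0, fun y _ => ?_⟩
    simp [hSlice]
  add_mem' := by
    rintro f g ⟨hf, hf0, C, hC⟩ ⟨hg, hg0, D, hD⟩
    refine ⟨hf.add hg, fun z hz => by simp [hf0 z hz, hg0 z hz], 2 * C + 2 * D, fun y hy => ?_⟩
    have hcont : Continuous fun x : ℝ => hSlice f y x := by
      have hline : Continuous fun x : ℝ => (x : ℂ) + (y : ℂ) * Complex.I := by fun_prop
      exact hf.continuousOn.comp_continuous hline fun x => by simpa [dualStrip] using hy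
    have hmeas : Measurable fun x : ℝ => 2 * ‖hSlice f y x‖ₑ ^ 2 := by
      have := hcont.measurable
      fun_prop
    have hpt : ∀ a b : ℂ, ‖a + b‖ₑ ^ 2 ≤ 2 * ‖a‖ₑ ^ 2 + 2 * ‖b‖ₑ ^ 2 := by
      intro a b
      have h1 : ‖a + b‖₊ ^ 2 ≤ 2 * ‖a‖₊ ^ 2 + 2 * ‖b‖₊ ^ 2 := by
        rw [← NNReal.coe_le_coe]
        push_cast
        nlinarith [norm_add_le a b, norm_nonneg (a + b), norm_nonneg a, norm_nonneg b,
          sq_nonneg (‖a‖ - ‖b‖)]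
      simp only [enorm_eq_nnnorm]
      exact_mod_cast h1
    calc ∫⁻ x : ℝ, ‖hSlice (f + g) y x‖ₑ ^ 2
        ≤ ∫⁻ x : ℝ, (2 * ‖hSlice f y x‖ₑ ^ 2 + 2 * ‖hSlice g y x‖ₑ ^ 2) :=
          lintegral_mono fun x => hpt _ _
      _ = 2 * (∫⁻ x : ℝ, ‖hSlice f y x‖ₑ ^ 2) + 2 * ∫⁻ x : ℝ, ‖hSlice g y x‖ₑ ^ 2 := by
          rw [lintegral_add_left hmeas, lintegral_const_mul' _ _ (by simp),
            lintegral_const_mul' _ _ (by simp)]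
      _ ≤ ((2 * C + 2 * D : NNReal) : ENNReal) := by
          push_cast
          gcongr
          · exact hC y hy
          · exact hD y hy
  smul_mem' := by
    rintro c f ⟨hf, hf0, C, hC⟩
    refine ⟨hf.const_smul c, fun z hz => by simp [hf0 z hz], ‖c‖₊ ^ 2 * C, fun y hy => ?_⟩
    have hpt : ∀ x : ℝ, ‖hSlice (c • f) y x‖ₑ ^ 2 = ‖c‖ₑ ^ 2 * ‖hSlice f y x‖ₑ ^ 2 := by
      intro x
      simp [hSlice, enorm_mul, mul_pow]
    simp only [hpt]
    rw [lintegral_const_mul' _ _ (by simp)]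
    push_cast
    rw [enorm_eq_nnnorm]
    gcongr
    exact hC y hy

/-- `b` is the weak `L²(ℝ)`-limit of the slices `h_y` as `y` tends to its limit along `l`. -/
def IsWeakSliceLimit (h : ℂ → ℂ) (l : Filter ℝ) (b : Lp ℂ 2 (volume : Measure ℝ)) : Prop :=
  ∀ φ : Lp ℂ 2 (volume : Measure ℝ),
    Tendsto (fun y : ℝ => ∫ x : ℝ, hSlice h y x * (starRingEnd ℂ) (φ x)) l
      (𝓝 (∫ x : ℝ, b x * (starRingEnd ℂ) (φ x)))

/-- `h` has boundary values `h_{1/2}`, `h_{-1/2}` in `L²(ℝ)`, and `N` is its squared `σ`-norm. -/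
def HasHardyNormSq (σ : ℝ) (h : ℂ → ℂ) (N : ℝ) : Prop :=
  ∃ bp bm : Lp ℂ 2 (volume : Measure ℝ),
    IsWeakSliceLimit h (𝓝[<] (1 / 2)) bp ∧ IsWeakSliceLimit h (𝓝[>] (-(1 / 2))) bm ∧
    N = 1 / (2 * Real.pi) *
      ∫ x : ℝ, ((‖bp x‖ ^ 2 + ‖bm x‖ ^ 2) / 2 - Real.cos σ * ‖hSlice h 0 x‖ ^ 2)

/-- The linear bijection `U` onto the product of two copies of the Hardy space is unitary when the
first copy carries the `σ`-norm and the second one the `(σ + π)`-norm. -/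
def IsUnitaryOntoHardy (σ : ℝ) {c : Plane} {r : ℝ}
    (U : L2Circle c r ≃ₗ[ℂ] (hardySpace × hardySpace)) : Prop :=
  ∀ u : L2Circle c r, ∃ M N : ℝ,
    HasHardyNormSq σ (U u).1 M ∧ HasHardyNormSq (σ + Real.pi) (U u).2 N ∧ ‖u‖ ^ 2 = M + N

/-- The pair of functions underlying an element of the product of two Hardy spaces. -/
def hardyPair (p : hardySpace × hardySpace) : (ℂ → ℂ) × (ℂ → ℂ) := (p.1, p.2)

/-- `T₁(f, g) = (P̂_{π-θ} g, P̂_θ g)`. -/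
def multT1 (θ : ℝ) (p : (ℂ → ℂ) × (ℂ → ℂ)) : (ℂ → ℂ) × (ℂ → ℂ) :=
  (stripPoissonHat (Real.pi - θ) * p.2, stripPoissonHat θ * p.2)

/-- `T₂(f, g) = (P̂_θ f, P̂_{π-θ} f)`. -/
def multT2 (θ : ℝ) (p : (ℂ → ℂ) × (ℂ → ℂ)) : (ℂ → ℂ) × (ℂ → ℂ) :=
  (stripPoissonHat θ * p.1, stripPoissonHat (Real.pi - θ) * p.1)

/-- `T₂₁(f, g) = (P̂_θ P̂_{π-θ} g, P̂_{π-θ}² g)`. -/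
def multT21 (θ : ℝ) (p : (ℂ → ℂ) × (ℂ → ℂ)) : (ℂ → ℂ) × (ℂ → ℂ) :=
  (stripPoissonHat θ * stripPoissonHat (Real.pi - θ) * p.2,
    stripPoissonHat (Real.pi - θ) ^ 2 * p.2)

end

open scoped FourierTransform SchwartzMap ContDiff ComplexConjugate

/-! The two circles meet in two points. In bipolar coordinates $(\sigma,t)$ with these points as
foci, circle $j$ without the foci is the union of the curves of angles $\sigma_j$ and
$\sigma_j+\pi$, each parametrized by $t\in\mathbb R$ with speed $a/(\cosh t-\cos\sigma)$
(`exists_bipolar_coordinates`, `isArcPair_bipolarPoint`). Multiplying by the square root of the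
speed turns $\mathrm L^2(\partial\Omega_j)$ into two copies of $\mathrm L^2(\mathbb R)$. By
conformal invariance the Poisson kernel of the disk, times arc length, becomes the convolution
kernel $\mathscr P_\varphi(t-s)$, where $\varphi$ is the angle between the two arcs
(`arcWeight_sq_mul_poisson`).

Write $w_\sigma=\sqrt{\cosh t-\cos\sigma}$. In these coordinates each Dirichlet-to-Dirichlet map has
kernel $w_\alpha(t)^{-1}\mathscr P_\varphi(t-s)\,w_\sigma(s)$ from an arc $\sigma$ to the arc
$\alpha$ inside the other disk. The adjoint has the transposed kernel. After the substitution
$F=f/w$ the weights cancel and the adjoint is plain convolution with $\mathscr P_\varphi$, which the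
Fourier transform turns into multiplication by $\widehat{\mathscr P}_\varphi$ (`exists_isDtD`,
`hardyMap_op_bipolarKernel`). Only the coordinate of the arc inside the other disk enters, hence the
shape of $T_1$ and $T_2$; and $T_{21}=T_2T_1$ because the adjoint reverses products.

The norm is explained by $\|f\|^2=\int(\cosh t-\cos\sigma)|F|^2$ and $\cosh t=(e^t+e^{-t})/2$:
multiplying $F$ by $e^{yt}$ shifts its transform to height $y$, so Plancherel at $y=\pm1/2$ and
$y=0$ gives $\|\cdot\|_\sigma$ (`ExpMemLp.hasHardyNormSq`). Since $w_\sigma$ is comparable to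
$e^{|t|/2}$, surjectivity is the Paley–Wiener theorem for the strip
(`exists_eq_indicator_fourierLaplace`). The formula for $\widehat{\mathscr P}_\varphi$ comes from
moving the contour from $\mathbb R$ to $\mathbb R+\mathrm i\pi$ (`stripPoissonHat_add`). -/

/-! ### Contour shifts and the Fourier transform of the strip Poisson kernel. -/

/-- A holomorphic function on a closed horizontal strip whose slices are uniformly bounded in `L¹`
has the same integral over both boundary lines. -/
theorem integral_horizontal_lines_eq {f : ℂ → ℂ} {a b : ℝ} (hab : a ≤ b)
    (hf : DifferentiableOn ℂ f {z | a ≤ z.im ∧ z.im ≤ b}) {C : ENNReal} (hC : C ≠ ⊤)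
    (hb : ∀ y ∈ Icc a b, ∫⁻ x : ℝ, ‖f (x + y * Complex.I)‖ₑ ≤ C) :
    ∫ x : ℝ, f (x + a * Complex.I) = ∫ x : ℝ, f (x + b * Complex.I) := by
  -- Clamping the height to $[a,b]$ makes the integrand continuous on the whole plane, so that
  -- Tonelli applies without measurability side conditions on the strip.
  have hcl : ∀ y : ℝ, a ≤ max a (min b y) ∧ max a (min b y) ≤ b :=
    fun y => ⟨le_max_left _ _, max_le hab (min_le_left _ _)⟩
  have hcl' : ∀ y ∈ Icc a b, max a (min b y) = y := fun y hy => by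
    rw [min_eq_right hy.2, max_eq_right hy.1]
  have hg : Continuous fun p : ℝ × ℝ => f (p.1 + (max a (min b p.2) : ℝ) * Complex.I) := by
    refine hf.continuousOn.comp_continuous (by fun_prop) fun p => ?_
    simpa using hcl p.2
  have hline : ∀ y ∈ Icc a b, Continuous fun x : ℝ => f (x + y * Complex.I) := fun y hy => by
    have := hg.comp (Continuous.prodMk_left (y : ℝ) : Continuous fun x : ℝ => (x, y))
    simpa [Function.comp_def, hcl' y hy] using this
  have hint : ∀ y ∈ Icc a b, Integrable fun x : ℝ => f (x + y * Complex.I) := fun y hy =>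
    ⟨(hline y hy).aestronglyMeasurable, (hb y hy).trans_lt hC.lt_top⟩
  set V : ℝ → ENNReal := fun R => ∫⁻ y in Icc a b, ‖f (R + y * Complex.I)‖ₑ with hV
  have hVm : Measurable V ∧ ∫⁻ R, V R < ⊤ := by
    have e : V = fun R : ℝ => ∫⁻ y in Icc a b, ‖f (R + (max a (min b y) : ℝ) * Complex.I)‖ₑ := by
      funext R
      refine setLIntegral_congr_fun measurableSet_Icc fun y hy => ?_
      simp only [hcl' y hy]
    have hm : Measurable fun p : ℝ × ℝ =>
        ‖f (p.1 + (max a (min b p.2) : ℝ) * Complex.I)‖ₑ := hg.measurable.enorm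
    refine ⟨by rw [e]; exact hm.lintegral_prod_right', ?_⟩
    rw [e, lintegral_lintegral_swap hm.aemeasurable]
    calc _ ≤ ∫⁻ y in Icc a b, C := by
          refine setLIntegral_mono measurable_const fun y hy => ?_
          simpa only [hcl' y hy] using hb y hy
      _ < ⊤ := by
          rw [setLIntegral_const]
          exact ENNReal.mul_lt_top hC.lt_top (by simp)
  obtain ⟨hVm, hVf⟩ := hVm
  have hDb : ∀ R : ℝ, 0 ≤ R → ‖(∫ x in (-R)..R, f (x + a * Complex.I)) -
      ∫ x in (-R)..R, f (x + b * Complex.I)‖ₑ ≤ V R + V (-R) := by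
    intro R hR
    have key := Complex.integral_boundary_rect_eq_zero_of_differentiableOn f
      ⟨-R, a⟩ ⟨R, b⟩ (hf.mono fun z hz => by
        have := hz.2
        simp only [mem_preimage] at this
        rwa [uIcc_of_le hab] at this)
    simp only at key
    have hvert : ∀ R : ℝ, ‖Complex.I • ∫ y in a..b, f (R + y * Complex.I)‖ₑ ≤ V R := fun R => by
      rw [enorm_smul, intervalIntegral.integral_of_le hab, ← integral_Icc_eq_integral_Ioc,
        ← ofReal_norm Complex.I, Complex.norm_I, ENNReal.ofReal_one, one_mul]
      exact enorm_integral_le_lintegral_enorm _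
    have : (∫ x in (-R)..R, f (x + a * Complex.I)) - ∫ x in (-R)..R, f (x + b * Complex.I) =
        Complex.I • (∫ y in a..b, f ((-R : ℝ) + y * Complex.I)) -
        Complex.I • ∫ y in a..b, f (R + y * Complex.I) := by
      linear_combination key
    rw [this, add_comm]
    exact (enorm_sub_le).trans (add_le_add (hvert _) (hvert _))
  -- The truncated integrals differ by at most $V(R)+V(-R)$, which is integrable in $R$. If the
  -- limits differed by $L\ne0$, this sum would exceed $\|L\|/2$ on a whole ray. No pointwise decay
  -- of $f$ is needed.
  by_contra hne
  set L := (∫ x : ℝ, f (x + a * Complex.I)) - ∫ x : ℝ, f (x + b * Complex.I) with hL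
  have hL0 : 0 < ‖L‖ := norm_pos_iff.2 (sub_ne_zero.2 hne)
  have hlim : Tendsto (fun R : ℝ => (∫ x in (-R)..R, f (x + a * Complex.I)) -
      ∫ x in (-R)..R, f (x + b * Complex.I)) atTop (𝓝 L) :=
    (intervalIntegral_tendsto_integral (hint a ⟨le_rfl, hab⟩) tendsto_neg_atTop_atBot
      tendsto_id).sub (intervalIntegral_tendsto_integral (hint b ⟨hab, le_rfl⟩)
      tendsto_neg_atTop_atBot tendsto_id)
  have hev := (hlim.norm.eventually (lt_mem_nhds (half_lt_self hL0))).and (eventually_ge_atTop 0)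
  obtain ⟨R₀, hR₀⟩ := eventually_atTop.1 hev
  have hbig : ∫⁻ _ in Ici R₀, ENNReal.ofReal (‖L‖ / 2) ≤ ∫⁻ R, (V R + V (-R)) := by
    refine (setLIntegral_mono' measurableSet_Ici fun R hR => ?_).trans
      (setLIntegral_le_lintegral _ _)
    refine le_trans ?_ (hDb R (hR₀ R hR).2)
    rw [← ofReal_norm]
    exact ENNReal.ofReal_le_ofReal (hR₀ R hR).1.le
  rw [setLIntegral_const, Real.volume_Ici, ENNReal.mul_top (by simpa using hL0),
    lintegral_add_left hVm, (Measure.measurePreserving_neg (volume : Measure ℝ)).lintegral_comp hVm]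
    at hbig
  exact absurd hbig (by simpa using (ENNReal.add_lt_top.2 ⟨hVf, hVf⟩).ne)

theorem integrable_exp_neg_mul_abs {c : ℝ} (hc : 0 < c) :
    Integrable fun x : ℝ => Real.exp (-(c * |x|)) := by
  rw [← integrableOn_univ, ← Iic_union_Ioi (a := (0 : ℝ))]
  refine IntegrableOn.union ?_ ?_
  · refine (integrableOn_exp_mul_Iic hc 0).congr_fun (fun x hx => ?_) measurableSet_Iic
    simp only [abs_of_nonpos (mem_Iic.1 hx)]
    ring_nf
  · refine (exp_neg_integrableOn_Ioi 0 hc).congr_fun (fun x hx => ?_) measurableSet_Ioi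
    simp only [abs_of_pos (mem_Ioi.1 hx)]
    ring_nf

theorem abs_cos_lt_one {σ : ℝ} (hσ : Real.sin σ ≠ 0) : |Real.cos σ| < 1 := by
  rw [← sq_lt_one_iff_abs_lt_one]
  have := Real.sin_sq_add_cos_sq σ
  have := pow_pos (abs_pos.2 hσ) 2
  rw [sq_abs] at this
  linarith

theorem exp_abs_le_two_mul_cosh (t : ℝ) : Real.exp |t| ≤ 2 * Real.cosh t := by
  rw [Real.cosh_eq]
  linarith [Real.exp_abs_le t]

/-- Since $\cosh t\ge1$, one has $\cosh t-|\cos\sigma|\ge(1-|\cos\sigma|)\cosh t$. Together with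
`cosh_sub_cos_le_exp_abs` this makes the bipolar density comparable to $e^{|t|}$ whenever
$\sin\sigma\ne0$. -/
theorem exp_abs_le_cosh_sub_cos {σ : ℝ} (t : ℝ) :
    (1 - |Real.cos σ|) / 2 * Real.exp |t| ≤ Real.cosh t - Real.cos σ := by
  have h1 := exp_abs_le_two_mul_cosh t
  have h2 := Real.one_le_cosh t
  have h3 := Real.abs_cos_le_one σ
  have h4 := le_abs_self (Real.cos σ)
  nlinarith [abs_nonneg (Real.cos σ)]

theorem cosh_sub_cos_le_exp_abs (σ t : ℝ) : Real.cosh t - Real.cos σ ≤ 2 * Real.exp |t| := by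
  have h1 : Real.cosh t ≤ Real.exp |t| := by
    rw [Real.cosh_eq]
    linarith [Real.exp_le_exp.2 (le_abs_self t), Real.exp_le_exp.2 (neg_le_abs t)]
  linarith [Real.neg_one_le_cos σ, Real.one_le_exp (abs_nonneg t)]

theorem cosh_sub_cos_pos {σ : ℝ} (hσ : Real.sin σ ≠ 0) (t : ℝ) : 0 < Real.cosh t - Real.cos σ :=
  lt_of_lt_of_le (mul_pos (by linarith [abs_cos_lt_one hσ]) (Real.exp_pos _))
    (exp_abs_le_cosh_sub_cos t)

theorem inv_cosh_sub_cos_le {σ : ℝ} (hσ : Real.sin σ ≠ 0) (t : ℝ) :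
    (Real.cosh t - Real.cos σ)⁻¹ ≤ ((1 - |Real.cos σ|) / 2)⁻¹ * Real.exp (-|t|) := by
  have h := abs_cos_lt_one hσ
  rw [Real.exp_neg, ← mul_inv]
  exact inv_anti₀ (mul_pos (by linarith) (Real.exp_pos _)) (exp_abs_le_cosh_sub_cos t)

theorem norm_exp_neg_I_mul (z : ℂ) (τ : ℝ) :
    ‖Complex.exp (-Complex.I * z * τ)‖ = Real.exp (z.im * τ) := by
  rw [Complex.norm_exp]
  simp

theorem integrable_exp_mul_inv_cosh_sub_cos {σ : ℝ} (hσ : Real.sin σ ≠ 0) {z : ℂ}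
    (hz : |z.im| < 1) :
    Integrable fun τ : ℝ =>
      Complex.exp (-Complex.I * z * τ) * ((Real.cosh τ - Real.cos σ)⁻¹ : ℝ) := by
  have hpos := cosh_sub_cos_pos hσ
  refine Integrable.mono' ((integrable_exp_neg_mul_abs (sub_pos.2 hz)).const_mul
    ((1 - |Real.cos σ|) / 2)⁻¹) ?_ (Eventually.of_forall fun t => ?_)
  · refine Continuous.aestronglyMeasurable ?_
    have : Continuous fun τ : ℝ => (Real.cosh τ - Real.cos σ)⁻¹ :=
      Continuous.inv₀ (by fun_prop) fun t => (hpos t).ne'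
    fun_prop
  · rw [norm_mul, norm_exp_neg_I_mul, Complex.norm_real, Real.norm_of_nonneg
      (inv_nonneg.2 (hpos t).le)]
    have h1 : Real.exp (z.im * t) ≤ Real.exp (|z.im| * |t|) := by
      rw [← abs_mul]
      exact Real.exp_le_exp.2 (le_abs_self _)
    refine (mul_le_mul h1 (inv_cosh_sub_cos_le hσ t) (inv_nonneg.2 (hpos t).le)
      (Real.exp_pos _).le).trans (le_of_eq ?_)
    rw [mul_left_comm, ← Real.exp_add]
    ring_nf

/-- The total mass of the Poisson kernel of the strip, up to normalization. -/
theorem integral_inv_cosh_sub_cos {θ : ℝ} (hθ : θ ∈ Ioo 0 Real.pi) :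
    ∫ τ : ℝ, (Real.cosh τ - Real.cos θ)⁻¹ = 2 * (Real.pi - θ) / Real.sin θ := by
  have hs := Real.sin_pos_of_mem_Ioo hθ
  have hsc := Real.sin_sq_add_cos_sq θ
  have hI : Integrable fun τ : ℝ => (Real.cosh τ - Real.cos θ)⁻¹ := by
    have := integrable_exp_mul_inv_cosh_sub_cos hs.ne' (z := 0) (by simp)
    refine this.norm.congr (Eventually.of_forall fun τ => ?_)
    simp only [norm_mul, norm_exp_neg_I_mul, Complex.zero_im, zero_mul, Real.exp_zero, one_mul,
      Complex.norm_real]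
    exact Real.norm_of_nonneg (inv_nonneg.2 (cosh_sub_cos_pos hs.ne' τ).le)
  have hderiv : ∀ τ : ℝ, HasDerivAt (fun τ => 2 / Real.sin θ *
      Real.arctan ((Real.exp τ - Real.cos θ) / Real.sin θ)) ((Real.cosh τ - Real.cos θ)⁻¹) τ := by
    intro τ
    have h := ((((Real.hasDerivAt_exp τ).sub_const (Real.cos θ)).div_const
      (Real.sin θ)).arctan).const_mul (2 / Real.sin θ)
    refine h.congr_deriv ?_
    have hp := cosh_sub_cos_pos hs.ne' τ
    rw [Real.cosh_eq, Real.exp_neg] at hp ⊢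
    have he := Real.exp_pos τ
    have h2 : 0 < Real.sin θ ^ 2 + (Real.exp τ - Real.cos θ) ^ 2 := by positivity
    field_simp at hp ⊢
    have h3 : 0 < Real.exp τ ^ 2 + 1 - Real.exp τ * 2 * Real.cos θ := by
      have : Real.exp τ ^ 2 + 1 - Real.exp τ * 2 * Real.cos θ =
        Real.sin θ ^ 2 + (Real.exp τ - Real.cos θ) ^ 2 := by nlinarith
      rw [this]; exact h2
    have h4 : Real.exp τ ^ 2 + 1 - Real.exp τ * 2 * Real.cos θ =
        Real.sin θ ^ 2 + (Real.exp τ - Real.cos θ) ^ 2 := by nlinarith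
    rw [h4, div_self h2.ne']
  have hpi : Real.arctan (-(Real.cos θ / Real.sin θ)) = θ - Real.pi / 2 := by
    have : Real.tan (θ - Real.pi / 2) = -(Real.cos θ / Real.sin θ) := by
      rw [Real.tan_eq_sin_div_cos, Real.sin_sub_pi_div_two, Real.cos_sub_pi_div_two, neg_div]
    rw [← this]
    exact Real.arctan_tan (by linarith [hθ.1]) (by linarith [hθ.2])
  have hbot : Tendsto (fun τ => 2 / Real.sin θ *
      Real.arctan ((Real.exp τ - Real.cos θ) / Real.sin θ)) atBot
      (𝓝 (2 / Real.sin θ * (θ - Real.pi / 2))) := by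
    rw [← hpi]
    refine ((Real.continuous_arctan.tendsto _).comp ?_).const_mul _
    have := (Real.tendsto_exp_atBot.sub_const (Real.cos θ)).div_const (Real.sin θ)
    simpa [neg_div] using this
  have htop : Tendsto (fun τ => 2 / Real.sin θ *
      Real.arctan ((Real.exp τ - Real.cos θ) / Real.sin θ)) atTop
      (𝓝 (2 / Real.sin θ * (Real.pi / 2))) := by
    refine ((Real.tendsto_arctan_atTop.mono_right nhdsWithin_le_nhds).comp ?_).const_mul _
    exact (tendsto_atTop_add_const_right _ _ Real.tendsto_exp_atTop).atTop_div_const hs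
  rw [integral_of_hasDerivAt_of_tendsto hderiv hI hbot htop]
  ring

theorem stripPoissonHat_eq (θ : ℝ) (z : ℂ) : stripPoissonHat θ z =
    (Real.sin θ / (2 * Real.pi) : ℝ) * ∫ τ : ℝ,
      Complex.exp (-Complex.I * z * τ) * ((Real.cosh τ - Real.cos θ)⁻¹ : ℝ) := by
  rw [stripPoissonHat, ← integral_const_mul]
  congr 1
  funext τ
  rw [stripPoisson]
  push_cast
  ring

/-- This isolates the single pole of the Poisson kernel in the strip $0\le\mathrm{Im}\,w\le\pi$. The
imaginary part of $\cosh w$ is $\sinh x\sin y$; if $\sin y=0$ then $|\cosh x\cos y|\ge1$,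
contradicting $|\cos\theta|<1$, so $x=0$ and injectivity of the cosine on $[0,\pi]$ decides $y$. -/
theorem cosh_eq_cos_iff {θ : ℝ} (hθ : θ ∈ Ioo 0 Real.pi) {w : ℂ} (h0 : 0 ≤ w.im)
    (hpi : w.im ≤ Real.pi) (h : Complex.cosh w = Real.cos θ) : w = θ * Complex.I := by
  have hcosh : Complex.cosh w = (Real.cosh w.re * Real.cos w.im : ℝ) +
      (Real.sinh w.re * Real.sin w.im : ℝ) * Complex.I := by
    conv_lhs => rw [← Complex.re_add_im w, Complex.cosh_add, Complex.cosh_mul_I,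
      Complex.sinh_mul_I]
    push_cast
    ring
  rw [hcosh] at h
  have hre := congrArg Complex.re h
  have him := congrArg Complex.im h
  simp only [Complex.add_re, Complex.add_im, Complex.ofReal_re, Complex.ofReal_im, Complex.mul_re,
    Complex.mul_im, Complex.I_re, Complex.I_im, mul_zero, mul_one, zero_add, sub_zero, add_zero,
    mul_eq_zero, Real.sinh_eq_zero] at hre him
  have hab := abs_cos_lt_one (Real.sin_pos_of_mem_Ioo hθ).ne'
  have hx : w.re = 0 := by
    rcases him with h | h
    · exact h
    · exfalso
      have h1 : |Real.cos w.im| = 1 := by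
        have := Real.sin_sq_add_cos_sq w.im
        rw [h] at this
        rw [← Real.sqrt_sq_eq_abs, show Real.cos w.im ^ 2 = 1 by linarith, Real.sqrt_one]
      rw [← hre, abs_mul, h1, mul_one, abs_of_pos (Real.cosh_pos _)] at hab
      linarith [Real.one_le_cosh w.re]
  have hy : w.im = θ := by
    rw [hx, Real.cosh_zero, one_mul] at hre
    exact Real.injOn_cos ⟨h0, hpi⟩ ⟨hθ.1.le, hθ.2.le⟩ hre
  apply Complex.ext <;> simp [hx, hy]

theorem sinh_abs_re_le_norm_cosh (w : ℂ) : Real.sinh |w.re| ≤ ‖Complex.cosh w‖ := by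
  have h : ∀ x y : ℝ, |Real.exp x - Real.exp y| / 2 = |(Real.exp x - Real.exp y) / 2| := by
    intro x y; rw [abs_div]; norm_num
  have h1 : Real.sinh |w.re| = |Real.sinh w.re| := (Real.abs_sinh _).symm
  rw [h1, Real.sinh_eq, ← h, Complex.cosh, norm_div]
  have h2 := abs_norm_sub_norm_le (Complex.exp w) (-Complex.exp (-w))
  rw [norm_neg, Complex.norm_exp, Complex.norm_exp, sub_neg_eq_add, Complex.neg_re] at h2
  simpa using div_le_div_of_nonneg_right h2 (by norm_num : (0 : ℝ) ≤ 2)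

theorem exp_abs_le_norm_cosh_sub {c : ℝ} (hc : |c| ≤ 1) {w : ℂ} (hw : 2 ≤ |w.re|) :
    Real.exp |w.re| / 4 ≤ ‖Complex.cosh w - c‖ := by
  have h1 := sinh_abs_re_le_norm_cosh w
  have h2 := norm_sub_norm_le (Complex.cosh w) c
  rw [Complex.norm_real, Real.norm_eq_abs] at h2
  rw [Real.sinh_eq] at h1
  have h3 : Real.exp (-|w.re|) ≤ 1 := Real.exp_le_one_iff.2 (by linarith)
  have h4 : (2.7 : ℝ) ^ 2 ≤ Real.exp |w.re| := by
    refine le_trans ?_ (Real.exp_le_exp.2 hw)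
    have : Real.exp 2 = Real.exp 1 ^ 2 := by rw [← Real.exp_nat_mul]; norm_num
    rw [this]
    have := Real.exp_one_gt_d9
    gcongr
    linarith
  have h5 : Real.exp (-|w.re|) * Real.exp |w.re| = 1 := by rw [← Real.exp_add]; simp
  nlinarith

/-- Compactness handles $|\mathrm{Re}\,w|\le2$ and the exponential bound the rest; one integrable
majorant then serves all slices, as `integral_horizontal_lines_eq` requires. -/
theorem lintegral_slices_le_of_exp_bound {f : ℂ → ℂ} {a b : ℝ}
    (hf : DifferentiableOn ℂ f {z | a ≤ z.im ∧ z.im ≤ b}) {A : ℝ}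
    (hA : ∀ w : ℂ, a ≤ w.im → w.im ≤ b → 2 ≤ |w.re| → ‖f w‖ ≤ A * Real.exp (-(1 / 2 * |w.re|))) :
    ∃ C : ENNReal, C ≠ ⊤ ∧ ∀ y ∈ Icc a b, ∫⁻ x : ℝ, ‖f (x + y * Complex.I)‖ₑ ≤ C := by
  have hK : IsCompact (Icc (-2 : ℝ) 2 ×ℂ Icc a b) := isCompact_Icc.reProdIm isCompact_Icc
  obtain ⟨M, hM⟩ := hK.exists_bound_of_continuousOn
    (hf.continuousOn.mono fun z hz => hz.2)
  have hint := (integrable_exp_neg_mul_abs (c := 1 / 2) (by norm_num)).const_mul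
    (max A (M * Real.exp 1))
  refine ⟨∫⁻ x : ℝ, ‖max A (M * Real.exp 1) * Real.exp (-(1 / 2 * |x|))‖ₑ, hint.2.ne,
    fun y hy => lintegral_mono fun x => ?_⟩
  rw [← ofReal_norm, ← ofReal_norm]
  refine ENNReal.ofReal_le_ofReal (le_trans ?_ (le_abs_self _))
  have he := Real.exp_pos (-(1 / 2 * |x|))
  by_cases hx : 2 ≤ |x|
  · refine (hA (x + y * Complex.I) (by simpa using hy.1) (by simpa using hy.2)
      (by simpa using hx)).trans ?_
    simp only [Complex.add_re, Complex.ofReal_re, Complex.mul_re, Complex.ofReal_im, Complex.I_re,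
      Complex.I_im, mul_zero, zero_mul, sub_zero, add_zero]
    gcongr
    exact le_max_left _ _
  · have h1 := hM (x + y * Complex.I) ⟨by simpa using abs_le.1 (not_le.1 hx).le, by simpa using hy⟩
    have hM0 : 0 ≤ M := (norm_nonneg _).trans h1
    calc _ ≤ M * 1 := by simpa using h1
      _ ≤ M * (Real.exp 1 * Real.exp (-(1 / 2 * |x|))) := by
          gcongr
          rw [← Real.exp_add]
          exact Real.one_le_exp (by linarith [not_le.1 hx])
      _ = (M * Real.exp 1) * Real.exp (-(1 / 2 * |x|)) := by ring
      _ ≤ _ := by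
          gcongr
          exact le_max_right _ _

theorem abs_im_lt_of_mem_dualStrip {z : ℂ} (hz : z ∈ dualStrip) : |z.im| < 1 / 2 :=
  abs_lt.2 hz

/-- Shifting the contour across the pole of the Poisson kernel at `iθ`. -/
theorem stripPoissonHat_add {θ : ℝ} (hθ : θ ∈ Ioo 0 Real.pi) {z : ℂ} (hz : z ∈ dualStrip) :
    stripPoissonHat θ z + Complex.exp (Real.pi * z) * stripPoissonHat (Real.pi - θ) z =
      Complex.exp (θ * z) := by
  have hs := Real.sin_pos_of_mem_Ioo hθ
  have hs' : Real.sin (Real.pi - θ) ≠ 0 := by rw [Real.sin_pi_sub]; exact hs.ne'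
  have hzi := abs_im_lt_of_mem_dualStrip hz
  -- Subtracting the constant $e^{\theta z}$ makes the numerator vanish at the pole $\mathrm
  -- i\theta$. The quotient of the two `dslope`s then continues $n/d$ holomorphically across it, so
  -- Cauchy's theorem replaces the residue theorem.
  set n : ℂ → ℂ := fun w => Complex.exp (-Complex.I * z * w) - Complex.exp (θ * z) with hn
  set d : ℂ → ℂ := fun w => Complex.cosh w - Real.cos θ with hd
  set p : ℂ := θ * Complex.I with hp
  have hn0 : n p = 0 := by
    have : -Complex.I * z * p = θ * z := by
      rw [hp]; linear_combination -(z * θ) * Complex.I_mul_I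
    simp only [hn, this, sub_self]
  have hd0 : d p = 0 := by
    simp only [hd, hp, Complex.cosh_mul_I, Complex.ofReal_cos, sub_self]
  have hnd : Differentiable ℂ n := by fun_prop
  have hdd : Differentiable ℂ d := by fun_prop
  have hdn : DifferentiableOn ℂ (dslope n p) univ :=
    (Complex.differentiableOn_dslope univ_mem).2 hnd.differentiableOn
  have hddn : DifferentiableOn ℂ (dslope d p) univ :=
    (Complex.differentiableOn_dslope univ_mem).2 hdd.differentiableOn
  have hne : ∀ w : ℂ, 0 ≤ w.im → w.im ≤ Real.pi → dslope d p w ≠ 0 := by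
    intro w h0 h1
    by_cases hw : w = p
    · rw [hw, dslope_same]
      have : HasDerivAt d (Complex.sinh p) p := (Complex.hasDerivAt_cosh p).sub_const _
      rw [this.deriv, hp, Complex.sinh_mul_I, ← Complex.ofReal_sin]
      exact mul_ne_zero (Complex.ofReal_ne_zero.2 hs.ne') Complex.I_ne_zero
    · rw [dslope_of_ne _ hw, slope_def_field, hd0, sub_zero]
      refine div_ne_zero (fun h => hw (cosh_eq_cos_iff hθ h0 h1 (sub_eq_zero.1 h)))
        (sub_ne_zero.2 hw)
  set f : ℂ → ℂ := fun w => dslope n p w / dslope d p w with hf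
  have hfq : ∀ w, w ≠ p → f w = n w / d w := by
    intro w hw
    simp only [hf, dslope_of_ne _ hw, slope_def_field, hn0, hd0, sub_zero]
    exact div_div_div_cancel_right₀ (sub_ne_zero.2 hw) _ _
  have hfd : DifferentiableOn ℂ f {w | 0 ≤ w.im ∧ w.im ≤ Real.pi} :=
    (hdn.mono (subset_univ _)).div (hddn.mono (subset_univ _)) fun w hw => hne w hw.1 hw.2
  have hpre : p.re = 0 := by simp [hp]
  obtain ⟨C, hC, hbound⟩ := lintegral_slices_le_of_exp_bound hfd
    (A := 4 * (Real.exp (Real.pi * |z.re|) + ‖Complex.exp (θ * z)‖)) (by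
    intro w h0 h1 h2
    rw [hfq w (by rintro rfl; rw [hpre, abs_zero] at h2; linarith), norm_div]
    have hden := exp_abs_le_norm_cosh_sub (Real.abs_cos_le_one θ) h2
    have hnum : ‖n w‖ ≤ (Real.exp (Real.pi * |z.re|) + ‖Complex.exp (θ * z)‖) *
        Real.exp (1 / 2 * |w.re|) := by
      refine (norm_sub_le _ _).trans ?_
      rw [add_mul]
      gcongr
      · rw [Complex.norm_exp, ← Real.exp_add]
        refine Real.exp_le_exp.2 ?_
        have e : (-Complex.I * z * w).re = z.re * w.im + z.im * w.re := by simp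
        rw [e]
        have i1 : z.re * w.im ≤ |z.re| * Real.pi :=
          mul_le_mul (le_abs_self _) h1 h0 (abs_nonneg _)
        have i2 : z.im * w.re ≤ 1 / 2 * |w.re| := by
          refine (le_abs_self _).trans ?_
          rw [abs_mul]
          gcongr
        linarith
      · exact le_mul_of_one_le_right (norm_nonneg _) (Real.one_le_exp (by positivity))
    rw [div_le_iff₀ (lt_of_lt_of_le (by positivity) hden)]
    calc ‖n w‖ ≤ _ := hnum
      _ = 4 * (Real.exp (Real.pi * |z.re|) + ‖Complex.exp (θ * z)‖) *
          Real.exp (-(1 / 2 * |w.re|)) * (Real.exp |w.re| / 4) := by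
        have : Real.exp |w.re| = Real.exp (1 / 2 * |w.re|) * Real.exp (1 / 2 * |w.re|) := by
          rw [← Real.exp_add]; ring_nf
        rw [this, Real.exp_neg]
        field_simp
      _ ≤ _ := by gcongr)
  have key := integral_horizontal_lines_eq Real.pi_pos.le hfd hC hbound
  have hI := fun {σ : ℝ} (hσ : Real.sin σ ≠ 0) =>
    integrable_exp_mul_inv_cosh_sub_cos hσ (z := z) (by linarith)
  have hI0 : ∀ {σ : ℝ}, Real.sin σ ≠ 0 →
      Integrable fun τ : ℝ => (((Real.cosh τ - Real.cos σ)⁻¹ : ℝ) : ℂ) := fun hσ => by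
    simpa using integrable_exp_mul_inv_cosh_sub_cos hσ (z := 0) (by simp)
  -- The subtracted constant contributes the total masses $2(\pi-\theta)/\sin\theta$ on the lower
  -- line and $2\theta/\sin\theta$ on the upper one. Their sum $2\pi/\sin\theta$ plays the role of
  -- the residue.
  have hv0 : ∫ τ : ℝ, (((Real.cosh τ - Real.cos θ)⁻¹ : ℝ) : ℂ) =
      ((2 * (Real.pi - θ) / Real.sin θ : ℝ) : ℂ) := by
    rw [integral_complex_ofReal, integral_inv_cosh_sub_cos hθ]
  have hv1 : ∫ τ : ℝ, (((Real.cosh τ - Real.cos (Real.pi - θ))⁻¹ : ℝ) : ℂ) =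
      ((2 * θ / Real.sin θ : ℝ) : ℂ) := by
    rw [integral_complex_ofReal, integral_inv_cosh_sub_cos ⟨by linarith [hθ.2], by linarith [hθ.1]⟩,
      Real.sin_pi_sub, sub_sub_cancel]
  have hbot : ∫ x : ℝ, f (x + (0 : ℝ) * Complex.I) =
      (∫ τ : ℝ, Complex.exp (-Complex.I * z * τ) * ((Real.cosh τ - Real.cos θ)⁻¹ : ℝ)) -
        Complex.exp (θ * z) * ((2 * (Real.pi - θ) / Real.sin θ : ℝ) : ℂ) := by
    rw [← hv0, ← integral_const_mul, ← integral_sub (hI hs.ne') ((hI0 hs.ne').const_mul _)]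
    congr 1
    funext x
    rw [hfq _ (by
      intro h
      have := congrArg Complex.im h
      simp [hp] at this
      exact hθ.1.ne this)]
    simp only [hn, hd, Complex.ofReal_zero, zero_mul, add_zero]
    push_cast
    ring
  have htop : ∫ x : ℝ, f (x + Real.pi * Complex.I) =
      Complex.exp (θ * z) * ((2 * θ / Real.sin θ : ℝ) : ℂ) - Complex.exp (Real.pi * z) *
      (∫ τ : ℝ, Complex.exp (-Complex.I * z * τ) *
        ((Real.cosh τ - Real.cos (Real.pi - θ))⁻¹ : ℝ)) := by
    rw [← hv1, ← integral_const_mul, ← integral_const_mul,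
      ← integral_sub ((hI0 hs').const_mul _) ((hI hs').const_mul _)]
    congr 1
    funext x
    rw [hfq _ (by
      intro h
      have := congrArg Complex.im h
      simp [hp] at this
      exact hθ.2.ne' this)]
    have e1 : Complex.cosh (x + Real.pi * Complex.I) = -Complex.cosh x := by
      rw [Complex.cosh_add, Complex.cosh_mul_I, Complex.sinh_mul_I]; simp
    have e2 : Complex.exp (-Complex.I * z * (x + Real.pi * Complex.I)) =
        Complex.exp (Real.pi * z) * Complex.exp (-Complex.I * z * x) := by
      rw [← Complex.exp_add]
      congr 1
      linear_combination -(z * Real.pi) * Complex.I_mul_I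
    simp only [hn, hd, e1, e2, Real.cos_pi_sub]
    push_cast
    rw [show -Complex.cosh (x : ℂ) - Complex.cos θ = -(Complex.cosh x - -Complex.cos θ) by ring,
      div_neg]
    ring
  rw [hbot, htop] at key
  rw [stripPoissonHat_eq, stripPoissonHat_eq, Real.sin_pi_sub]
  have hsc : (Real.sin θ : ℂ) ≠ 0 := Complex.ofReal_ne_zero.2 hs.ne'
  have hpc : (Real.pi : ℂ) ≠ 0 := Complex.ofReal_ne_zero.2 Real.pi_ne_zero
  generalize (∫ τ : ℝ, Complex.exp (-Complex.I * z * τ) *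
    ((Real.cosh τ - Real.cos θ)⁻¹ : ℝ)) = A at key ⊢
  generalize (∫ τ : ℝ, Complex.exp (-Complex.I * z * τ) *
    ((Real.cosh τ - Real.cos (Real.pi - θ))⁻¹ : ℝ)) = B at key ⊢
  generalize Real.sin θ = s at hsc key ⊢
  push_cast at key ⊢
  field_simp at key ⊢
  linear_combination key

/-- The shift relation for $\theta$ and for $\pi-\theta$ is a linear system for the two transforms,
with determinant $1-e^{2\pi z}$. In the strip this vanishes only at $z=0$. -/
theorem stripPoissonHat_formula {θ : ℝ} (hθ : θ ∈ Ioo 0 Real.pi) {z : ℂ} (hz : z ∈ dualStrip)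
    (hz0 : z ≠ 0) : stripPoissonHat θ z =
      Complex.sinh (((Real.pi - θ : ℝ) : ℂ) * z) / Complex.sinh ((Real.pi : ℂ) * z) := by
  have h1 := stripPoissonHat_add hθ hz
  have h2 := stripPoissonHat_add (θ := Real.pi - θ) ⟨by linarith [hθ.2], by linarith [hθ.1]⟩ hz
  rw [sub_sub_cancel] at h2
  have hne : Complex.sinh (Real.pi * z) ≠ 0 := by
    intro h
    have : Complex.exp (Real.pi * z) = Complex.exp (-(Real.pi * z)) := by
      rw [Complex.sinh] at h
      exact sub_eq_zero.1 ((div_eq_zero_iff.1 h).resolve_right two_ne_zero)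
    obtain ⟨k, hk⟩ := Complex.exp_eq_exp_iff_exists_int.1 this
    have hzk : z = k * Complex.I := by
      have hpc : (Real.pi : ℂ) ≠ 0 := Complex.ofReal_ne_zero.2 Real.pi_ne_zero
      refine mul_left_cancel₀ (mul_ne_zero two_ne_zero hpc) ?_
      linear_combination hk
    have him : z.im = k := by rw [hzk]; simp
    have := abs_im_lt_of_mem_dualStrip hz
    rw [him] at this
    have hk0 : k = 0 := by
      have : |(k : ℝ)| < 1 := by linarith
      rw [← Int.cast_abs] at this
      exact Int.abs_lt_one_iff.1 (by exact_mod_cast this)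
    exact hz0 (by rw [hzk, hk0]; simp)
  rw [eq_div_iff hne]
  rw [Complex.sinh, Complex.sinh]
  have e1 : Complex.exp (((Real.pi - θ : ℝ) : ℂ) * z) =
      Complex.exp (Real.pi * z) * Complex.exp (-(θ * z)) := by
    rw [← Complex.exp_add]; push_cast; ring_nf
  have e2 : Complex.exp (-(((Real.pi - θ : ℝ) : ℂ) * z)) =
      Complex.exp (-(Real.pi * z)) * Complex.exp (θ * z) := by
    rw [← Complex.exp_add]; push_cast; ring_nf
  have e3 : Complex.exp (Real.pi * z) * Complex.exp (-(Real.pi * z)) = 1 := by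
    rw [← Complex.exp_add]; simp
  rw [e1] at h2
  rw [e1, e2]
  linear_combination (1 / 2) * h2 - (1 / 2) * Complex.exp (-(Real.pi * z)) * h1 +
    (1 / 2) * stripPoissonHat (Real.pi - θ) z * e3

/-! ### The $\mathrm L^2$ Fourier transform and rescaling by $2\pi$. -/

/-- The `L²` inverse Fourier transform, tested against a Schwartz function. -/
theorem integral_smul_fourierInv (g : Lp ℂ 2 (volume : Measure ℝ)) (φ : 𝓢(ℝ, ℂ)) :
    ∫ t, φ t • (𝓕⁻ g : Lp ℂ 2 (volume : Measure ℝ)) t = ∫ ξ, (𝓕⁻ φ) ξ • g ξ := by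
  have h := congrArg (fun T : 𝓢'(ℝ, ℂ) => T φ) (Lp.fourierInv_toTemperedDistribution_eq g)
  simp only [TemperedDistribution.fourierInv_apply, Lp.toTemperedDistribution_apply] at h
  exact h.symm

theorem integral_smul_fourier (g : Lp ℂ 2 (volume : Measure ℝ)) (φ : 𝓢(ℝ, ℂ)) :
    ∫ t, φ t • (𝓕 g : Lp ℂ 2 (volume : Measure ℝ)) t = ∫ ξ, (𝓕 φ) ξ • g ξ := by
  have h := congrArg (fun T : 𝓢'(ℝ, ℂ) => T φ) (Lp.fourier_toTemperedDistribution_eq g)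
  simp only [TemperedDistribution.fourier_apply, Lp.toTemperedDistribution_apply] at h
  exact h.symm

/-- On `L¹ ∩ L²` the `L²` Fourier transform is given by the Fourier integral. -/
theorem coeFn_fourier_toLp {f : ℝ → ℂ} (hf : Integrable f) (hf2 : MemLp f 2) :
    (𝓕 (hf2.toLp f) : Lp ℂ 2 (volume : Measure ℝ)) =ᵐ[volume] 𝓕 f := by
  have hcont : Continuous (𝓕 f) := VectorFourier.fourierIntegral_continuous
    Real.continuous_fourierChar continuous_inner hf
  refine ae_eq_of_integral_contDiff_smul_eq ((Lp.memLp _).locallyIntegrable (by norm_num))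
    hcont.locallyIntegrable fun g hg hgc => ?_
  have hg₁ : HasCompactSupport (Complex.ofRealCLM ∘ g) := hgc.comp_left rfl
  have hg₂ : ContDiff ℝ ∞ (Complex.ofRealCLM ∘ g) := by fun_prop
  have h := integral_smul_fourier (hf2.toLp f) (hg₁.toSchwartzMap hg₂)
  have h2 := VectorFourier.integral_fourierIntegral_smul_eq_flip (L := innerₗ ℝ)
      Real.continuous_fourierChar continuous_inner
      ((hg₁.toSchwartzMap hg₂).integrable (μ := volume)) hf
  calc ∫ x, g x • (𝓕 (hf2.toLp f) : Lp ℂ 2 (volume : Measure ℝ)) x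
      = ∫ ξ, (𝓕 (hg₁.toSchwartzMap hg₂)) ξ • (hf2.toLp f) ξ := by
        rw [← h]; simp
    _ = ∫ ξ, (𝓕 (hg₁.toSchwartzMap hg₂)) ξ • f ξ :=
        integral_congr_ae (hf2.coeFn_toLp.mono fun x hx => by simp only [hx])
    _ = _ := by
        rw [SchwartzMap.fourier_coe]
        refine h2.trans ?_
        simp [Real.fourier_eq, VectorFourier.fourierIntegral]

theorem quasiMeasurePreserving_const_mul {c : ℝ} (hc : c ≠ 0) :
    Measure.QuasiMeasurePreserving (fun x : ℝ => c * x) volume volume :=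
  ⟨measurable_const_mul c, by
    rw [Real.map_volume_mul_left hc]
    exact Measure.smul_absolutelyContinuous⟩

theorem memLp_two_comp_const_mul {f : ℝ → ℂ} (hf : MemLp f 2) {c : ℝ} (hc : c ≠ 0) :
    MemLp (fun x => f (c * x)) 2 := by
  refine (memLp_two_iff_integrable_sq_norm
    (hf.1.comp_quasiMeasurePreserving (quasiMeasurePreserving_const_mul hc))).2 ?_
  exact ((memLp_two_iff_integrable_sq_norm hf.1).1 hf).comp_mul_left' hc

theorem integral_comp_two_pi_mul {E : Type*} [NormedAddCommGroup E] [NormedSpace ℝ E] (f : ℝ → E) :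
    ∫ x, f x = (2 * Real.pi) • ∫ ξ, f (2 * Real.pi * ξ) := by
  rw [Measure.integral_comp_mul_left, smul_smul, abs_of_pos (by positivity),
    mul_inv_cancel₀ (by positivity), one_smul]

/-! ### Fourier–Laplace transforms of exponentially weighted functions. -/

/-- The two-sided Laplace transform of `F` on vertical lines, that is, the Fourier transform at
complex frequencies. -/
noncomputable def fourierLaplace (F : ℝ → ℂ) (z : ℂ) : ℂ :=
  ∫ t : ℝ, Complex.exp (-Complex.I * z * t) * F t

/-- `F` is square-integrable against the weight `exp |t|`. -/
def ExpMemLp (F : ℝ → ℂ) : Prop := MemLp (fun t => (Real.exp (|t| / 2) : ℂ) * F t) 2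

section

variable {F : ℝ → ℂ}

theorem ExpMemLp.aestronglyMeasurable (hF : ExpMemLp F) : AEStronglyMeasurable F volume := by
  have h := (show Continuous fun t : ℝ => (Real.exp (-(|t| / 2)) : ℂ) by
    fun_prop).aestronglyMeasurable.mul hF.1
  refine h.congr (Eventually.of_forall fun t => ?_)
  simp only [Pi.mul_apply]
  rw [← mul_assoc, ← Complex.ofReal_mul, ← Real.exp_add]
  simp

theorem ExpMemLp.memLp_exp_mul (hF : ExpMemLp F) {y : ℝ} (hy : |y| ≤ 1 / 2) :
    MemLp (fun t => (Real.exp (y * t) : ℂ) * F t) 2 := by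
  refine MemLp.mono hF ((Continuous.aestronglyMeasurable (by fun_prop)).mul
    hF.aestronglyMeasurable) (Eventually.of_forall fun t => ?_)
  simp only [norm_mul, Complex.norm_real, Real.norm_eq_abs, Real.abs_exp]
  gcongr
  calc y * t ≤ |y| * |t| := by rw [← abs_mul]; exact le_abs_self _
    _ ≤ 1 / 2 * |t| := by gcongr
    _ = |t| / 2 := by ring

theorem memLp_exp_neg_mul_abs {c : ℝ} (hc : 0 < c) :
    MemLp (fun t : ℝ => (Real.exp (-(c * |t|)) : ℂ)) 2 := by
  rw [memLp_two_iff_integrable_sq_norm (Continuous.aestronglyMeasurable (by fun_prop))]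
  convert integrable_exp_neg_mul_abs (c := 2 * c) (by positivity) using 2 with t
  rw [Complex.norm_real, Real.norm_eq_abs, Real.abs_exp, ← Real.exp_nat_mul]
  congr 1
  push_cast
  ring

/-- Cauchy–Schwarz: $e^{c|t|}F$ is the product of $e^{-(1/2-c)|t|}$ and $e^{|t|/2}F$, both
square-integrable. -/
theorem ExpMemLp.integrable_exp_abs_mul (hF : ExpMemLp F) {c : ℝ} (hc : c < 1 / 2) :
    Integrable fun t => (Real.exp (c * |t|) : ℂ) * F t := by
  have h := (memLp_exp_neg_mul_abs (c := 1 / 2 - c) (by linarith)).integrable_mul hF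
  refine h.congr (Eventually.of_forall fun t => ?_)
  simp only [Pi.mul_apply]
  rw [← mul_assoc, ← Complex.ofReal_mul, ← Real.exp_add]
  ring_nf

theorem exp_mul_le_exp_mul_abs {y c : ℝ} (hy : |y| ≤ c) (t : ℝ) :
    Real.exp (y * t) ≤ Real.exp (c * |t|) := by
  refine Real.exp_le_exp.2 ?_
  calc y * t ≤ |y| * |t| := by rw [← abs_mul]; exact le_abs_self _
    _ ≤ c * |t| := by gcongr

theorem ExpMemLp.integrable_fourierLaplace (hF : ExpMemLp F) {z : ℂ} (hz : |z.im| < 1 / 2) :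
    Integrable fun t : ℝ => Complex.exp (-Complex.I * z * t) * F t := by
  refine Integrable.mono (hF.integrable_exp_abs_mul hz)
    ((Continuous.aestronglyMeasurable (by fun_prop)).mul hF.aestronglyMeasurable)
    (Eventually.of_forall fun t => ?_)
  rw [norm_mul, norm_mul, norm_exp_neg_I_mul, Complex.norm_real, Real.norm_eq_abs, Real.abs_exp]
  exact mul_le_mul_of_nonneg_right (exp_mul_le_exp_mul_abs le_rfl t) (norm_nonneg _)

theorem isOpen_dualStrip : IsOpen dualStrip :=
  (isOpen_lt continuous_const Complex.continuous_im).inter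
    (isOpen_lt Complex.continuous_im continuous_const)

theorem convex_dualStrip : Convex ℝ dualStrip :=
  (convex_halfSpace_im_gt _).inter (convex_halfSpace_im_lt _)

theorem ExpMemLp.differentiableOn_fourierLaplace (hF : ExpMemLp F) :
    DifferentiableOn ℂ (fourierLaplace F) dualStrip := by
  intro z₀ hz₀
  have h₀ := abs_im_lt_of_mem_dualStrip hz₀
  -- Here $c$ bounds $|\mathrm{Im}\,z|$ near $z_0$, and the gap $c'-c$ absorbs the factor $|t|$
  -- produced by differentiation.
  obtain ⟨c, hc0, hc1⟩ := exists_between h₀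
  obtain ⟨c', hc'0, hc'1⟩ := exists_between hc1
  set s : Set ℂ := {z | |z.im| < c}
  have hs : s ∈ 𝓝 z₀ :=
    (isOpen_lt (by fun_prop) continuous_const).mem_nhds (by simpa [s] using hc0)
  have hδ : 0 < c' - c := sub_pos.2 hc'0
  have hbound : Integrable fun t : ℝ =>
      (c' - c)⁻¹ * ‖(Real.exp (c' * |t|) : ℂ) * F t‖ :=
    (hF.integrable_exp_abs_mul hc'1).norm.const_mul _
  have key := hasDerivAt_integral_of_dominated_loc_of_deriv_le (μ := volume) (𝕜 := ℂ)
    (F := fun z (t : ℝ) => Complex.exp (-Complex.I * z * t) * F t)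
    (F' := fun z (t : ℝ) => (-Complex.I * t * Complex.exp (-Complex.I * z * t)) * F t)
    (x₀ := z₀) (s := s) hs
    (Eventually.of_forall fun z => (Continuous.aestronglyMeasurable (by fun_prop)).mul
      hF.aestronglyMeasurable)
    (hF.integrable_fourierLaplace h₀)
    ((Continuous.aestronglyMeasurable (by fun_prop)).mul hF.aestronglyMeasurable)
    (Eventually.of_forall fun t z hz => ?_) hbound
    (Eventually.of_forall fun t z _ => ?_)
  · exact key.2.differentiableAt.differentiableWithinAt
  · rw [norm_mul, norm_mul, norm_mul, norm_exp_neg_I_mul, norm_neg, Complex.norm_I, one_mul,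
      norm_mul, Complex.norm_real, Complex.norm_real, Real.norm_eq_abs, Real.norm_eq_abs,
      Real.abs_exp, ← mul_assoc]
    refine mul_le_mul_of_nonneg_right ?_ (norm_nonneg _)
    have h1 : |t| ≤ (c' - c)⁻¹ * Real.exp ((c' - c) * |t|) := by
      rw [← div_eq_inv_mul, le_div_iff₀ hδ]
      linarith [Real.add_one_le_exp ((c' - c) * |t|)]
    calc |t| * Real.exp (z.im * t)
        ≤ ((c' - c)⁻¹ * Real.exp ((c' - c) * |t|)) * Real.exp (c * |t|) :=
          mul_le_mul h1 (exp_mul_le_exp_mul_abs (le_of_lt hz) t) (Real.exp_pos _).le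
            (by positivity)
      _ = _ := by rw [mul_assoc, ← Real.exp_add]; ring_nf
  · have h1 : HasDerivAt (fun z : ℂ => -Complex.I * z * t) (-Complex.I * t) z := by
      have := ((hasDerivAt_id z).const_mul (-Complex.I)).mul_const (t : ℂ)
      simpa using this
    have h2 := (h1.cexp).mul_const (F t)
    exact h2.congr_deriv (by ring)

/-- Since $e^{-\mathrm i(x+\mathrm iy)t}=e^{yt}e^{-\mathrm ixt}$, moving to height $y$ amounts to
weighting by $e^{yt}$. The argument $2\pi\xi$ converts angular frequency to the convention
$e^{-2\pi\mathrm it\xi}$ of `𝓕`. -/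
theorem hSlice_fourierLaplace (F : ℝ → ℂ) (y ξ : ℝ) :
    hSlice (fourierLaplace F) y (2 * Real.pi * ξ) =
      𝓕 (fun t : ℝ => (Real.exp (y * t) : ℂ) * F t) ξ := by
  rw [Real.fourier_real_eq_integral_exp_smul, hSlice, fourierLaplace]
  congr 1
  funext t
  rw [smul_eq_mul, ← mul_assoc, Complex.ofReal_exp, ← Complex.exp_add]
  congr 2
  push_cast
  linear_combination -(y * t) * Complex.I_mul_I

theorem norm_sq_eq_integral {α : Type*} {m : MeasurableSpace α} {μ : Measure α} (f : Lp ℂ 2 μ) :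
    ‖f‖ ^ 2 = ∫ x, ‖f x‖ ^ 2 ∂μ := by
  have h : (inner ℂ f f : ℂ) = ((∫ x, ‖f x‖ ^ 2 ∂μ : ℝ) : ℂ) := by
    rw [L2.inner_def, ← integral_complex_ofReal]
    refine integral_congr_ae (Eventually.of_forall fun x => ?_)
    simp only [inner_self_eq_norm_sq_to_K]
    norm_cast
  rw [inner_self_eq_norm_sq_to_K] at h
  refine Complex.ofReal_injective (Eq.trans ?_ h)
  push_cast
  rfl

theorem lintegral_enorm_sq_eq {α : Type*} {m : MeasurableSpace α} {μ : Measure α} {f : α → ℂ}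
    (hf : MemLp f 2 μ) : ∫⁻ x, ‖f x‖ₑ ^ 2 ∂μ = ENNReal.ofReal (∫ x, ‖f x‖ ^ 2 ∂μ) := by
  rw [ofReal_integral_eq_lintegral_ofReal ((memLp_two_iff_integrable_sq_norm hf.1).1 hf)
    (Eventually.of_forall fun x => by positivity)]
  refine lintegral_congr fun x => ?_
  rw [ENNReal.ofReal_pow (norm_nonneg _), ofReal_norm]

theorem integral_norm_sq_fourier_toLp {G : ℝ → ℂ} (hG : MemLp G 2) :
    ∫ ξ, ‖(𝓕 (hG.toLp G) : Lp ℂ 2 (volume : Measure ℝ)) ξ‖ ^ 2 = ∫ t, ‖G t‖ ^ 2 := by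
  rw [← norm_sq_eq_integral, Lp.norm_fourier_eq, norm_sq_eq_integral]
  exact integral_congr_ae (hG.coeFn_toLp.mono fun x hx => by simp only [hx])

theorem ExpMemLp.integrable_exp_mul (hF : ExpMemLp F) {y : ℝ} (hy : |y| < 1 / 2) :
    Integrable fun t => (Real.exp (y * t) : ℂ) * F t := by
  have := hF.integrable_fourierLaplace (z := y * Complex.I) (by simpa using hy)
  refine this.congr (Eventually.of_forall fun t => ?_)
  simp only [Complex.ofReal_exp]
  congr 2
  push_cast
  linear_combination -(y * t) * Complex.I_mul_I

theorem ExpMemLp.hSlice_ae_eq (hF : ExpMemLp F) {y : ℝ} (hy : |y| < 1 / 2) :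
    (fun ξ => hSlice (fourierLaplace F) y (2 * Real.pi * ξ)) =ᵐ[volume]
      (𝓕 ((hF.memLp_exp_mul hy.le).toLp _) : Lp ℂ 2 (volume : Measure ℝ)) := by
  refine EventuallyEq.trans (Eventually.of_forall fun ξ => hSlice_fourierLaplace F y ξ)
    (coeFn_fourier_toLp (hF.integrable_exp_mul hy) (hF.memLp_exp_mul hy.le)).symm

theorem ExpMemLp.memLp_hSlice (hF : ExpMemLp F) {y : ℝ} (hy : |y| < 1 / 2) :
    MemLp (hSlice (fourierLaplace F) y) 2 := by
  have h := (memLp_congr_ae (hF.hSlice_ae_eq hy)).2 (Lp.memLp _)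
  have h2 := memLp_two_comp_const_mul h (c := (2 * Real.pi)⁻¹) (by positivity)
  convert h2 using 2 with x
  rw [mul_inv_cancel_left₀ (by positivity)]

theorem ExpMemLp.integral_norm_sq_hSlice (hF : ExpMemLp F) {y : ℝ} (hy : |y| < 1 / 2) :
    ∫ x, ‖hSlice (fourierLaplace F) y x‖ ^ 2 =
      2 * Real.pi * ∫ t, ‖(Real.exp (y * t) : ℂ) * F t‖ ^ 2 := by
  rw [integral_comp_two_pi_mul, smul_eq_mul, ← integral_norm_sq_fourier_toLp
    (hF.memLp_exp_mul hy.le)]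
  congr 1
  exact integral_congr_ae ((hF.hSlice_ae_eq hy).mono fun x hx => by simp only [hx])

theorem ExpMemLp.integral_norm_sq_hSlice_le (hF : ExpMemLp F) {y : ℝ} (hy : |y| < 1 / 2) :
    ∫ x, ‖hSlice (fourierLaplace F) y x‖ ^ 2 ≤
      2 * Real.pi * ∫ t, ‖(Real.exp (|t| / 2) : ℂ) * F t‖ ^ 2 := by
  rw [hF.integral_norm_sq_hSlice hy]
  have h1 := hF.memLp_exp_mul hy.le
  refine mul_le_mul_of_nonneg_left (integral_mono
    ((memLp_two_iff_integrable_sq_norm h1.1).1 h1)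
    ((memLp_two_iff_integrable_sq_norm hF.1).1 hF) fun t => ?_) (by positivity)
  simp only [norm_mul, Complex.norm_real, Real.norm_eq_abs, Real.abs_exp]
  gcongr
  have := exp_mul_le_exp_mul_abs hy.le t
  rw [Real.exp_le_exp] at this
  linarith

theorem indicator_fourierLaplace_mem (hF : ExpMemLp F) :
    dualStrip.indicator (fourierLaplace F) ∈ hardySpace := by
  refine ⟨hF.differentiableOn_fourierLaplace.congr fun z hz => indicator_of_mem hz _,
    fun z hz => indicator_of_notMem hz _,
    (2 * Real.pi * ∫ t, ‖(Real.exp (|t| / 2) : ℂ) * F t‖ ^ 2).toNNReal, fun y hy => ?_⟩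
  have hy' : |y| < 1 / 2 := abs_lt.2 hy
  have e : hSlice (dualStrip.indicator (fourierLaplace F)) y = hSlice (fourierLaplace F) y := by
    funext x
    exact indicator_of_mem (by simpa [dualStrip] using hy) _
  rw [e, lintegral_enorm_sq_eq (hF.memLp_hSlice hy')]
  exact ENNReal.ofReal_le_ofReal (hF.integral_norm_sq_hSlice_le hy')

end

theorem integral_half_add_sub_const_mul {a b c : ℝ → ℝ} (ha : Integrable a) (hb : Integrable b)
    (hc : Integrable c) (k : ℝ) :
    ∫ x, ((a x + b x) / 2 - k * c x) = ((∫ x, a x) + ∫ x, b x) / 2 - k * ∫ x, c x := by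
  have hab : Integrable fun x => (a x + b x) / 2 := (ha.add hb).div_const 2
  rw [integral_sub hab (hc.const_mul _), integral_div, integral_add ha hb, integral_const_mul]

section

variable {F : ℝ → ℂ}

theorem hSlice_indicator {y : ℝ} (hy : |y| < 1 / 2) (h : ℂ → ℂ) :
    hSlice (dualStrip.indicator h) y = hSlice h y := by
  funext x
  exact indicator_of_mem (by simpa [dualStrip] using abs_lt.1 hy) _

/-- Weak pairing of a slice, transported to the Fourier side. -/
theorem ExpMemLp.integral_mul_conj_eq (hF : ExpMemLp F) {y : ℝ} (hy : |y| ≤ 1 / 2) {g : ℝ → ℂ}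
    (hg : (fun ξ => g (2 * Real.pi * ξ)) =ᵐ[volume]
      (𝓕 ((hF.memLp_exp_mul hy).toLp _) : Lp ℂ 2 (volume : Measure ℝ)))
    {φ : ℝ → ℂ} (hφ : MemLp (fun ξ => φ (2 * Real.pi * ξ)) 2) :
    ∫ x, g x * conj (φ x) = (2 * Real.pi) • ∫ t, ((Real.exp (y * t) : ℂ) * F t) *
      conj ((𝓕⁻ (hφ.toLp _) : Lp ℂ 2 (volume : Measure ℝ)) t) := by
  rw [integral_comp_two_pi_mul]
  congr 1
  have h := Lp.inner_fourier_eq (𝓕⁻ (hφ.toLp _) : Lp ℂ 2 (volume : Measure ℝ))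
    ((hF.memLp_exp_mul hy).toLp _)
  rw [FourierTransform.fourier_fourierInv_eq, L2.inner_def, L2.inner_def] at h
  calc _ = ∫ ξ, inner ℂ (hφ.toLp _ ξ)
        ((𝓕 ((hF.memLp_exp_mul hy).toLp _) : Lp ℂ 2 (volume : Measure ℝ)) ξ) := by
        refine integral_congr_ae ?_
        filter_upwards [hg, hφ.coeFn_toLp] with ξ h1 h2
        simp only [h1, h2, RCLike.inner_apply]
    _ = _ := by
        rw [h]
        refine integral_congr_ae ?_
        filter_upwards [(hF.memLp_exp_mul hy).coeFn_toLp] with t h1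
        simp only [h1, RCLike.inner_apply]

/-- The slices of a Fourier-Laplace transform converge weakly up to the boundary of the strip. -/
theorem ExpMemLp.exists_isWeakSliceLimit (hF : ExpMemLp F) {y₀ : ℝ} (hy₀ : |y₀| ≤ 1 / 2)
    {l : Filter ℝ} [l.IsCountablyGenerated] (hl : l ≤ 𝓝 y₀) (hl' : ∀ᶠ y in l, |y| < 1 / 2) :
    ∃ b : Lp ℂ 2 (volume : Measure ℝ),
      IsWeakSliceLimit (dualStrip.indicator (fourierLaplace F)) l b ∧
      ∫ x, ‖b x‖ ^ 2 = 2 * Real.pi * ∫ t, ‖(Real.exp (y₀ * t) : ℂ) * F t‖ ^ 2 := by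
  -- The boundary value is the rescaled transform of $e^{y_0t}F$, which is still in $\mathrm L^2$
  -- when $|y_0|=1/2$, although it need not be integrable there.
  have hm := memLp_two_comp_const_mul (Lp.memLp (𝓕 ((hF.memLp_exp_mul hy₀).toLp _) :
    Lp ℂ 2 (volume : Measure ℝ))) (c := (2 * Real.pi)⁻¹) (by positivity)
  have hb : (fun ξ => hm.toLp _ (2 * Real.pi * ξ)) =ᵐ[volume]
      (𝓕 ((hF.memLp_exp_mul hy₀).toLp _) : Lp ℂ 2 (volume : Measure ℝ)) := by
    have h := (quasiMeasurePreserving_const_mul (c := 2 * Real.pi) (by positivity)).ae_eq_comp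
      hm.coeFn_toLp
    refine h.trans (Eventually.of_forall fun ξ => ?_)
    simp only [Function.comp_apply]
    rw [inv_mul_cancel_left₀ (by positivity)]
  refine ⟨hm.toLp _, fun φ => ?_, ?_⟩
  · have hφ := memLp_two_comp_const_mul (Lp.memLp φ) (c := 2 * Real.pi) (by positivity)
    rw [hF.integral_mul_conj_eq hy₀ hb hφ]
    set ψ : Lp ℂ 2 (volume : Measure ℝ) := 𝓕⁻ (hφ.toLp _) with hψ
    have hψm : MemLp (fun t => conj (ψ t)) 2 := (Lp.memLp ψ).star
    have key : Tendsto (fun y : ℝ => ∫ t, ((Real.exp (y * t) : ℂ) * F t) * conj (ψ t)) l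
        (𝓝 (∫ t, ((Real.exp (y₀ * t) : ℂ) * F t) * conj (ψ t))) := by
      refine tendsto_integral_filter_of_dominated_convergence
        (fun t => ‖(Real.exp (|t| / 2) : ℂ) * F t * conj (ψ t)‖)
        (Eventually.of_forall fun y => ((Continuous.aestronglyMeasurable (by fun_prop)).mul
          hF.aestronglyMeasurable).mul hψm.1) ?_ (hF.integrable_mul hψm).norm
        (Eventually.of_forall fun t => ?_)
      · filter_upwards [hl'] with y hy
        refine Eventually.of_forall fun t => ?_
        simp only [norm_mul, Complex.norm_real, Real.norm_eq_abs, Real.abs_exp]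
        gcongr
        have := exp_mul_le_exp_mul_abs hy.le t
        rw [Real.exp_le_exp] at this
        linarith
      · refine Tendsto.mul_const _ (Tendsto.mul_const _ ?_)
        have : Continuous fun y : ℝ => (Real.exp (y * t) : ℂ) := by fun_prop
        exact (this.tendsto y₀).mono_left hl
    refine (key.const_smul (2 * Real.pi)).congr' ?_
    filter_upwards [hl'] with y hy
    rw [hSlice_indicator hy]
    exact (hF.integral_mul_conj_eq hy.le (hF.hSlice_ae_eq hy) hφ).symm
  · rw [integral_comp_two_pi_mul, smul_eq_mul, ← integral_norm_sq_fourier_toLp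
      (hF.memLp_exp_mul hy₀)]
    congr 1
    exact integral_congr_ae (hb.mono fun x hx => by simp only [hx])

/-- Plancherel at heights $\pm1/2$ and $0$ turns the three terms of the norm into $e^{t}$, $e^{-t}$
and $1$ times $|F|^2$; the half-sum of the exponentials is $\cosh t$. -/
theorem ExpMemLp.hasHardyNormSq (hF : ExpMemLp F) (σ : ℝ) :
    HasHardyNormSq σ (dualStrip.indicator (fourierLaplace F))
      (∫ t, (Real.cosh t - Real.cos σ) * ‖F t‖ ^ 2) := by
  obtain ⟨bp, hbp, hbp'⟩ := hF.exists_isWeakSliceLimit (y₀ := 1 / 2) (l := 𝓝[<] (1 / 2))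
    (by norm_num [abs_of_pos]) nhdsWithin_le_nhds (by
      filter_upwards [Ioo_mem_nhdsLT (show (-(1 / 2) : ℝ) < 1 / 2 by norm_num)] with y hy
      exact abs_lt.2 hy)
  obtain ⟨bm, hbm, hbm'⟩ := hF.exists_isWeakSliceLimit (y₀ := -(1 / 2)) (l := 𝓝[>] (-(1 / 2)))
    (by norm_num [abs_of_pos]) nhdsWithin_le_nhds (by
      filter_upwards [Ioo_mem_nhdsGT (show (-(1 / 2) : ℝ) < 1 / 2 by norm_num)] with y hy
      exact abs_lt.2 hy)
  refine ⟨bp, bm, hbp, hbm, ?_⟩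
  have h0 : |(0 : ℝ)| < 1 / 2 := by norm_num
  have hz := hF.integral_norm_sq_hSlice h0
  have hsq : ∀ {f : ℝ → ℂ}, MemLp f 2 → Integrable fun x => ‖f x‖ ^ 2 := fun hf =>
    (memLp_two_iff_integrable_sq_norm hf.1).1 hf
  have hip := hsq (Lp.memLp bp)
  have him := hsq (Lp.memLp bm)
  have hi0 := hsq (hF.memLp_hSlice h0)
  have hFp := hsq (hF.memLp_exp_mul (y := 1 / 2) (by norm_num [abs_of_pos]))
  have hFm := hsq (hF.memLp_exp_mul (y := -(1 / 2)) (by norm_num [abs_of_pos]))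
  have hF0 := hsq (hF.memLp_exp_mul (y := 0) (by norm_num))
  rw [hSlice_indicator h0, integral_half_add_sub_const_mul hip him hi0, hbp', hbm', hz]
  have e : ∀ t, (Real.cosh t - Real.cos σ) * ‖F t‖ ^ 2 =
      (‖(Real.exp (1 / 2 * t) : ℂ) * F t‖ ^ 2 + ‖(Real.exp (-(1 / 2) * t) : ℂ) * F t‖ ^ 2) / 2 -
        Real.cos σ * ‖(Real.exp (0 * t) : ℂ) * F t‖ ^ 2 := by
    intro t
    simp only [norm_mul, Complex.norm_real, Real.norm_eq_abs, Real.abs_exp, mul_pow,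
      ← Real.exp_nat_mul, Real.cosh_eq]
    push_cast
    rw [show 2 * (1 / 2 * t) = t by ring, show 2 * (-(1 / 2) * t) = -t by ring,
      show 2 * (0 * t) = 0 by ring, Real.exp_zero]
    ring
  simp only [e]
  rw [integral_half_add_sub_const_mul hFp hFm hF0]
  field_simp

end

/-! ### The Paley–Wiener theorem for the strip. -/

theorem exists_schwartz_mul_exp {ψ : ℝ → ℝ} (hψ : ContDiff ℝ ∞ ψ) (hψc : HasCompactSupport ψ)
    (y : ℝ) : ∃ Φ : 𝓢(ℝ, ℂ), ∀ t, Φ t = (ψ t : ℂ) * (Real.exp (-(y * t)) : ℂ) := by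
  have h1 : ContDiff ℝ ∞ fun t => ψ t * Real.exp (-(y * t)) := by fun_prop
  have h2 : HasCompactSupport fun t => ψ t * Real.exp (-(y * t)) := hψc.mul_right
  have hg₁ : HasCompactSupport (Complex.ofRealCLM ∘ fun t => ψ t * Real.exp (-(y * t))) :=
    h2.comp_left rfl
  have hg₂ : ContDiff ℝ ∞ (Complex.ofRealCLM ∘ fun t => ψ t * Real.exp (-(y * t))) := by fun_prop
  exact ⟨hg₁.toSchwartzMap hg₂, fun t => by simp⟩

section

variable {h : ℂ → ℂ}

theorem continuous_hSlice (hh : h ∈ hardySpace) {y : ℝ} (hy : |y| < 1 / 2) :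
    Continuous (hSlice h y) :=
  hh.1.continuousOn.comp_continuous (by fun_prop) fun x => by simpa [dualStrip] using abs_lt.1 hy

theorem exists_bound_hSlice (hh : h ∈ hardySpace) : ∃ C : ℝ, 0 ≤ C ∧ ∀ y : ℝ, |y| < 1 / 2 →
    MemLp (hSlice h y) 2 ∧ ∫⁻ x, ‖hSlice h y x‖ₑ ^ 2 ≤ ENNReal.ofReal C := by
  obtain ⟨C, hC⟩ := hh.2.2
  refine ⟨C, C.2, fun y hy => ⟨⟨(continuous_hSlice hh hy).aestronglyMeasurable, ?_⟩, ?_⟩⟩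
  · rw [eLpNorm_lt_top_iff_lintegral_rpow_enorm_lt_top (by norm_num) (by norm_num)]
    have := (hC y (abs_lt.1 hy)).trans_lt ENNReal.coe_lt_top
    simpa using this
  · rw [ENNReal.ofReal_coe_nnreal]
    exact hC y (abs_lt.1 hy)

theorem lintegral_enorm_mul_le {f : ℝ → ℂ} (hf : AEStronglyMeasurable f volume)
    (g : ℝ → ℂ) :
    ∫⁻ x, ‖f x * g x‖ₑ ≤ (∫⁻ x, ‖f x‖ₑ ^ 2) + ∫⁻ x, ‖g x‖ₑ ^ 2 := by
  have hf' : AEMeasurable fun x => ‖f x‖ₑ ^ 2 := hf.enorm.pow_const 2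
  rw [← lintegral_add_left' hf']
  refine lintegral_mono fun x => ?_
  simp only [enorm_mul]
  rcases le_total ‖f x‖ₑ ‖g x‖ₑ with hle | hle
  · exact (mul_le_mul_left hle _).trans (by rw [← sq]; exact le_add_self)
  · exact (mul_le_mul_right hle _).trans (by rw [← sq]; exact le_self_add)

/-- Products of two functions of Hardy type have the same integral over all horizontal lines. -/
theorem integral_hSlice_mul_eq (hh : h ∈ hardySpace) {k : ℂ → ℂ} (hk : k ∈ hardySpace) {a b : ℝ}
    (ha : |a| < 1 / 2) (hb : |b| < 1 / 2) :
    ∫ x, hSlice k a x * hSlice h a x = ∫ x, hSlice k b x * hSlice h b x := by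
  wlog hab : a ≤ b generalizing a b
  · exact (this hb ha (le_of_not_ge hab)).symm
  obtain ⟨C, -, hC⟩ := exists_bound_hSlice hh
  obtain ⟨D, -, hD⟩ := exists_bound_hSlice hk
  have hd : DifferentiableOn ℂ (fun z => k z * h z) dualStrip := hk.1.mul hh.1
  refine integral_horizontal_lines_eq (f := fun z => k z * h z) hab (hd.mono fun z hz =>
    ⟨(abs_lt.1 ha).1.trans_le hz.1, hz.2.trans_lt (abs_lt.1 hb).2⟩)
    (C := ENNReal.ofReal D + ENNReal.ofReal C) (by simp) fun y hy => ?_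
  have hy' : |y| < 1 / 2 := abs_lt.2 ⟨(abs_lt.1 ha).1.trans_le hy.1, hy.2.trans_lt (abs_lt.1 hb).2⟩
  exact (lintegral_enorm_mul_le (hD y hy').1.1 _).trans
    (add_le_add (hD y hy').2 (hC y hy').2)

theorem memLp_hSlice_two_pi (hh : h ∈ hardySpace) {y : ℝ} (hy : |y| < 1 / 2) :
    MemLp (fun ξ => hSlice h y (2 * Real.pi * ξ)) 2 := by
  obtain ⟨C, -, hC⟩ := exists_bound_hSlice hh
  exact memLp_two_comp_const_mul (hC y hy).1 (by positivity)

/-- The inverse Fourier transform of a slice of a Hardy function. -/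
noncomputable def sliceFourierInv (hh : h ∈ hardySpace) {y : ℝ} (hy : |y| < 1 / 2) :
    Lp ℂ 2 (volume : Measure ℝ) :=
  𝓕⁻ ((memLp_hSlice_two_pi hh hy).toLp _)

theorem fourier_sliceFourierInv (hh : h ∈ hardySpace) {y : ℝ} (hy : |y| < 1 / 2) :
    𝓕 (sliceFourierInv hh hy) = (memLp_hSlice_two_pi hh hy).toLp _ :=
  FourierTransform.fourier_fourierInv_eq _

/-- The weight $e^{-yt}$, moved onto the test function, becomes a shift of its transform to the same
height $y$. The pairing is thus a horizontal integral of a product of two Hardy functions. The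
reflection $\psi(-t)$ appears because `𝓕⁻` is `𝓕` of the reflected function. -/
theorem integral_smul_sliceFourierInv (hh : h ∈ hardySpace) {y : ℝ} (hy : |y| < 1 / 2)
    {ψ : ℝ → ℝ} (hψ : ContDiff ℝ ∞ ψ) (hψc : HasCompactSupport ψ) :
    ∫ t, ψ t • ((Real.exp (-(y * t)) : ℂ) * sliceFourierInv hh hy t) =
      (2 * Real.pi)⁻¹ • ∫ x, hSlice (dualStrip.indicator
        (fourierLaplace fun t => (ψ (-t) : ℂ))) y x * hSlice h y x := by
  obtain ⟨Φ, hΦ⟩ := exists_schwartz_mul_exp hψ hψc y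
  have key : ∫ t, Φ t • sliceFourierInv hh hy t =
      ∫ ξ, (𝓕⁻ Φ) ξ • (memLp_hSlice_two_pi hh hy).toLp _ ξ :=
    integral_smul_fourierInv _ Φ
  rw [integral_comp_two_pi_mul (fun x => hSlice _ y x * hSlice h y x),
    inv_smul_smul₀ (by positivity)]
  calc _ = ∫ t, Φ t • sliceFourierInv hh hy t := by
        refine integral_congr_ae (Eventually.of_forall fun t => ?_)
        simp only [hΦ, smul_eq_mul, Complex.real_smul]
        ring
    _ = _ := key
    _ = _ := by
        refine integral_congr_ae ?_
        filter_upwards [(memLp_hSlice_two_pi hh hy).coeFn_toLp] with ξ h1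
        rw [h1, smul_eq_mul, hSlice_indicator hy, hSlice_fourierLaplace,
          SchwartzMap.fourierInv_coe, Real.fourierInv_eq_fourier_comp_neg]
        congr 1
        refine congrArg (fun f : ℝ → ℂ => 𝓕 f ξ) (funext fun t => ?_)
        simp only [hΦ, mul_neg, neg_neg]
        ring

/-- By contour independence of the pairings (`integral_hSlice_mul_eq`), $e^{-yt}$ times the inverse
transform of $h_y$ is a single function for all $y$. It is the $F$ of which $h$ will be the
Fourier–Laplace transform. -/
theorem sliceFourierInv_ae_eq (hh : h ∈ hardySpace) {y : ℝ} (hy : |y| < 1 / 2) :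
    (fun t => (Real.exp (-(y * t)) : ℂ) * sliceFourierInv hh hy t) =ᵐ[volume]
      sliceFourierInv hh (y := 0) (by norm_num) := by
  have hl : ∀ f : Lp ℂ 2 (volume : Measure ℝ), LocallyIntegrable f volume := fun f =>
    (Lp.memLp f).locallyIntegrable (by norm_num)
  refine ae_eq_of_integral_contDiff_smul_eq ?_ (hl _) fun ψ hψ hψc => ?_
  · exact (hl (sliceFourierInv hh hy)).continuous_smul
      (g := fun t : ℝ => (Real.exp (-(y * t)) : ℂ)) (by fun_prop)
  · have hF : ExpMemLp fun t => (ψ (-t) : ℂ) := by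
      have hc : HasCompactSupport fun t : ℝ => (ψ (-t) : ℂ) :=
        (hψc.comp_homeomorph (Homeomorph.neg ℝ)).comp_left (g := fun x : ℝ => (x : ℂ)) rfl
      have hψ' := hψ.continuous
      exact Continuous.memLp_of_hasCompactSupport (by fun_prop) (HasCompactSupport.mul_left hc)
    rw [integral_smul_sliceFourierInv hh hy hψ hψc,
      integral_hSlice_mul_eq hh (indicator_fourierLaplace_mem hF) hy (b := 0) (by norm_num),
      ← integral_smul_sliceFourierInv hh (by norm_num) hψ hψc]
    simp

theorem lintegral_sliceFourierInv (hh : h ∈ hardySpace) : ∃ C : ℝ, ∀ y : ℝ, |y| < 1 / 2 →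
    ∫⁻ t, ‖(Real.exp (y * t) : ℂ) * sliceFourierInv hh (y := 0) (by norm_num) t‖ₑ ^ 2 ≤
      ENNReal.ofReal C := by
  obtain ⟨C, hC0, hC⟩ := exists_bound_hSlice hh
  refine ⟨(2 * Real.pi)⁻¹ * C, fun y hy => ?_⟩
  have h1 : (fun t => (Real.exp (y * t) : ℂ) * sliceFourierInv hh (y := 0) (by norm_num) t)
      =ᵐ[volume] sliceFourierInv hh hy := by
    filter_upwards [sliceFourierInv_ae_eq hh hy] with t ht
    rw [← ht, ← mul_assoc, ← Complex.ofReal_mul, ← Real.exp_add]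
    simp
  have h5 : ∫⁻ t, ‖(Real.exp (y * t) : ℂ) * sliceFourierInv hh (y := 0) (by norm_num) t‖ₑ ^ 2 =
      ∫⁻ t, ‖sliceFourierInv hh hy t‖ₑ ^ 2 :=
    lintegral_congr_ae (h1.mono fun t ht => congrArg (fun z : ℂ => ‖z‖ₑ ^ 2) ht)
  rw [h5, lintegral_enorm_sq_eq (Lp.memLp _)]
  refine ENNReal.ofReal_le_ofReal ?_
  rw [← norm_sq_eq_integral]
  have h2 : ‖sliceFourierInv hh hy‖ = ‖(memLp_hSlice_two_pi hh hy).toLp _‖ := by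
    rw [← Lp.norm_fourier_eq, fourier_sliceFourierInv]
  have h3 := integral_comp_two_pi_mul fun x => ‖hSlice h y x‖ ^ 2
  have h4 : ∫ x, ‖hSlice h y x‖ ^ 2 ≤ C := by
    have := (hC y hy).2
    rwa [lintegral_enorm_sq_eq (hC y hy).1, ENNReal.ofReal_le_ofReal_iff hC0] at this
  rw [h2, norm_sq_eq_integral, le_inv_mul_iff₀ (by positivity),
    integral_congr_ae ((memLp_hSlice_two_pi hh hy).coeFn_toLp.mono fun x hx =>
      congrArg (fun z : ℂ => ‖z‖ ^ 2) hx), ← smul_eq_mul, ← h3]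
  exact h4

/-- The bounds on $e^{yt}F$ are uniform for $|y|<1/2$, so Fatou's lemma extends them to $y=\pm1/2$;
then $e^{|t|}\le e^{t}+e^{-t}$. -/
theorem expMemLp_sliceFourierInv (hh : h ∈ hardySpace) :
    ExpMemLp (sliceFourierInv hh (y := 0) (by norm_num)) := by
  obtain ⟨C, hC⟩ := lintegral_sliceFourierInv hh
  set F : ℝ → ℂ := ((sliceFourierInv hh (y := 0) (by norm_num) : Lp ℂ 2 (volume : Measure ℝ)) :
    ℝ → ℂ)
  have hFm : AEStronglyMeasurable F volume := (Lp.memLp _).1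
  set y : ℕ → ℝ := fun n => 1 / 2 - 1 / ((n : ℝ) + 3)
  have hy : ∀ n, |y n| < 1 / 2 := fun n => by
    have h1 : 0 < 1 / ((n : ℝ) + 3) := by positivity
    have h2 : 1 / ((n : ℝ) + 3) < 1 := by
      rw [div_lt_one (by positivity)]
      linarith [n.cast_nonneg (α := ℝ)]
    exact abs_lt.2 ⟨by simp only [y]; linarith, by simp only [y]; linarith⟩
  have hy_lim : Tendsto y atTop (𝓝 (1 / 2)) := by
    have : Tendsto (fun n : ℕ => 1 / ((n : ℝ) + 3)) atTop (𝓝 0) :=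
      tendsto_const_nhds.div_atTop (tendsto_atTop_add_const_right _ _ tendsto_natCast_atTop_atTop)
    have h2 := this.const_sub (1 / 2)
    rwa [sub_zero] at h2
  have hmeas : ∀ c : ℝ, AEMeasurable fun t => ‖(Real.exp (c * t) : ℂ) * F t‖ₑ ^ 2 := fun c =>
    (((show Continuous fun t : ℝ => (Real.exp (c * t) : ℂ) by
      fun_prop).aestronglyMeasurable.mul hFm).enorm).pow_const 2
  refine ⟨(Continuous.aestronglyMeasurable (by fun_prop)).mul hFm, ?_⟩
  rw [eLpNorm_lt_top_iff_lintegral_rpow_enorm_lt_top (by norm_num) (by norm_num)]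
  simp only [ENNReal.toReal_ofNat, ENNReal.rpow_ofNat]
  have hhalf : ∀ s : ℝ, |s| = 1 → ∫⁻ t, ‖(Real.exp (s * (1 / 2) * t) : ℂ) * F t‖ₑ ^ 2 ≤
      ENNReal.ofReal C := by
    intro s hs
    have hlim : ∀ t, Tendsto (fun n => ‖(Real.exp (s * y n * t) : ℂ) * F t‖ₑ ^ 2) atTop
        (𝓝 (‖(Real.exp (s * (1 / 2) * t) : ℂ) * F t‖ₑ ^ 2)) := fun t => by
      have hc : Continuous fun x : ℝ => ‖(Real.exp (s * x * t) : ℂ) * F t‖ₑ ^ 2 :=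
        (ENNReal.continuous_pow 2).comp (continuous_enorm.comp (by fun_prop))
      exact (hc.tendsto _).comp hy_lim
    calc _ = ∫⁻ t, liminf (fun n => ‖(Real.exp (s * y n * t) : ℂ) * F t‖ₑ ^ 2) atTop :=
          lintegral_congr fun t => (hlim t).liminf_eq.symm
      _ ≤ liminf (fun n => ∫⁻ t, ‖(Real.exp (s * y n * t) : ℂ) * F t‖ₑ ^ 2) atTop :=
          lintegral_liminf_le' fun n => hmeas _
      _ ≤ ENNReal.ofReal C := by
          refine liminf_le_of_le (by isBoundedDefault) fun b hb => ?_
          obtain ⟨n, hn⟩ := hb.exists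
          exact hn.trans (hC _ (by rw [abs_mul, hs, one_mul]; exact hy n))
  calc _ ≤ ∫⁻ t, (‖(Real.exp (1 * (1 / 2) * t) : ℂ) * F t‖ₑ ^ 2 +
        ‖(Real.exp (-1 * (1 / 2) * t) : ℂ) * F t‖ₑ ^ 2) := by
        refine lintegral_mono fun t => ?_
        rcases le_total 0 t with ht | ht
        · rw [abs_of_nonneg ht, show 1 * (1 / 2) * t = t / 2 by ring]
          exact le_self_add
        · rw [abs_of_nonpos ht, show -1 * (1 / 2) * t = -t / 2 by ring]
          exact le_add_self
    _ ≤ ENNReal.ofReal C + ENNReal.ofReal C := by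
        rw [lintegral_add_left' (hmeas _)]
        exact add_le_add (hhalf 1 (by simp)) (hhalf (-1) (by simp))
    _ < ⊤ := by simp

/-- Paley-Wiener theorem for the strip: every Hardy function is a Fourier-Laplace transform. -/
theorem exists_eq_indicator_fourierLaplace (hh : h ∈ hardySpace) :
    ∃ F, ExpMemLp F ∧ h = dualStrip.indicator (fourierLaplace F) := by
  have h0 : |(0 : ℝ)| < 1 / 2 := by norm_num
  have hF := expMemLp_sliceFourierInv hh
  refine ⟨_, hF, ?_⟩
  set F : ℝ → ℂ := ((sliceFourierInv hh h0 : Lp ℂ 2 (volume : Measure ℝ)) : ℝ → ℂ)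
  have hae : (fun ξ => hSlice (fourierLaplace F) 0 (2 * Real.pi * ξ)) =ᵐ[volume]
      fun ξ => hSlice h 0 (2 * Real.pi * ξ) := by
    refine (hF.hSlice_ae_eq h0).trans ?_
    have e : (hF.memLp_exp_mul h0.le).toLp _ = sliceFourierInv hh h0 := by
      refine Lp.ext ?_
      refine (MemLp.coeFn_toLp _).trans (Eventually.of_forall fun t => ?_)
      simp [F]
    rw [e, fourier_sliceFourierInv]
    exact MemLp.coeFn_toLp _
  have hmem := indicator_fourierLaplace_mem hF
  have hcont : Continuous (hSlice (fourierLaplace F) 0) := by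
    have := continuous_hSlice hmem h0
    rwa [hSlice_indicator h0] at this
  have heq : ∀ x, hSlice (fourierLaplace F) 0 x = hSlice h 0 x := by
    have := (Continuous.ae_eq_iff_eq volume (hcont.comp (continuous_const_mul (2 * Real.pi)))
      ((continuous_hSlice hh h0).comp (continuous_const_mul (2 * Real.pi)))).1 hae
    intro x
    have h2 := congrFun this ((2 * Real.pi)⁻¹ * x)
    simp only [Function.comp_apply] at h2
    rwa [mul_inv_cancel_left₀ (by positivity)] at h2
  -- Both functions are holomorphic on the connected strip and agree on the real axis; the points
  -- $1/(n+1)$ accumulate at $0$, so the identity theorem applies.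
  have hEq : EqOn h (fourierLaplace F) dualStrip := by
    refine AnalyticOnNhd.eqOn_of_preconnected_of_frequently_eq
      (hh.1.analyticOnNhd isOpen_dualStrip)
      (hF.differentiableOn_fourierLaplace.analyticOnNhd isOpen_dualStrip)
      convex_dualStrip.isPreconnected (z₀ := 0) (by simp [dualStrip]) ?_
    have hlim : Tendsto (fun n : ℕ => ((1 / ((n : ℝ) + 1) : ℝ) : ℂ)) atTop (𝓝[≠] 0) := by
      refine tendsto_nhdsWithin_iff.2 ⟨?_, Eventually.of_forall fun n => ?_⟩
      · have := (Complex.continuous_ofReal.tendsto 0).comp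
          (tendsto_one_div_add_atTop_nhds_zero_nat (𝕜 := ℝ))
        rwa [Complex.ofReal_zero] at this
      · simp only [mem_compl_iff, mem_singleton_iff, Complex.ofReal_eq_zero]
        positivity
    refine hlim.frequently (Frequently.of_forall fun n => ?_)
    have := heq (1 / ((n : ℝ) + 1))
    simpa [hSlice] using this.symm
  funext z
  by_cases hz : z ∈ dualStrip
  · rw [indicator_of_mem hz, hEq hz]
  · rw [indicator_of_notMem hz, hh.2.1 z hz]

end

/-! ### Identification of $\mathrm L^2(\mathbb R)$ with the normed Hardy space. -/

/-- The square root of the bipolar density `cosh t - cos σ`. -/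
noncomputable def bipolarWeight (σ t : ℝ) : ℝ := √(Real.cosh t - Real.cos σ)

theorem continuous_bipolarWeight (σ : ℝ) : Continuous (bipolarWeight σ) := by
  unfold bipolarWeight
  fun_prop

theorem bipolarWeight_pos {σ : ℝ} (hσ : Real.sin σ ≠ 0) (t : ℝ) : 0 < bipolarWeight σ t :=
  Real.sqrt_pos.2 (cosh_sub_cos_pos hσ t)

theorem bipolarWeight_sq {σ : ℝ} (hσ : Real.sin σ ≠ 0) (t : ℝ) :
    bipolarWeight σ t ^ 2 = Real.cosh t - Real.cos σ :=
  Real.sq_sqrt (cosh_sub_cos_pos hσ t).le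

theorem continuous_inv_bipolarWeight {σ : ℝ} (hσ : Real.sin σ ≠ 0) :
    Continuous fun t => (bipolarWeight σ t)⁻¹ :=
  (continuous_bipolarWeight σ).inv₀ fun t => (bipolarWeight_pos hσ t).ne'

theorem bipolarWeight_le (σ t : ℝ) : bipolarWeight σ t ≤ 2 * Real.exp (|t| / 2) := by
  refine (Real.sqrt_le_left (by positivity)).2 ?_
  rw [mul_pow, ← Real.exp_nat_mul]
  refine (cosh_sub_cos_le_exp_abs σ t).trans ?_
  rw [show ((2 : ℕ) : ℝ) * (|t| / 2) = |t| by push_cast; ring]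
  linarith [Real.exp_pos |t|]

theorem exists_exp_le_bipolarWeight {σ : ℝ} (hσ : Real.sin σ ≠ 0) :
    ∃ C : ℝ, 0 < C ∧ ∀ t, Real.exp (|t| / 2) * (bipolarWeight σ t)⁻¹ ≤ C := by
  have hc : 0 < (1 - |Real.cos σ|) / 2 := by linarith [abs_cos_lt_one hσ]
  refine ⟨(√((1 - |Real.cos σ|) / 2))⁻¹, by positivity, fun t => ?_⟩
  rw [← div_eq_mul_inv, div_le_iff₀ (bipolarWeight_pos hσ t), ← div_eq_inv_mul,
    le_div_iff₀ (Real.sqrt_pos.2 hc)]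
  refine Real.le_sqrt_of_sq_le ?_
  rw [mul_pow, Real.sq_sqrt hc.le, ← Real.exp_nat_mul,
    show ((2 : ℕ) : ℝ) * (|t| / 2) = |t| by push_cast; ring, mul_comm]
  exact exp_abs_le_cosh_sub_cos t

theorem expMemLp_inv_bipolarWeight_mul {σ : ℝ} (hσ : Real.sin σ ≠ 0) {f : ℝ → ℂ}
    (hf : MemLp f 2) : ExpMemLp fun t => ((bipolarWeight σ t)⁻¹ : ℝ) * f t := by
  obtain ⟨C, hC, hb⟩ := exists_exp_le_bipolarWeight hσ
  have hw := continuous_inv_bipolarWeight hσ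
  refine MemLp.of_le_mul (c := C) hf ?_ (Eventually.of_forall fun t => ?_)
  · exact (Continuous.aestronglyMeasurable (by fun_prop)).mul
      ((Complex.continuous_ofReal.comp hw).aestronglyMeasurable.mul hf.1)
  · have := inv_nonneg.2 (bipolarWeight_pos hσ t).le
    rw [← mul_assoc, norm_mul, norm_mul, Complex.norm_real, Complex.norm_real, Real.norm_eq_abs,
      Real.norm_eq_abs, Real.abs_exp, abs_of_nonneg this]
    exact mul_le_mul_of_nonneg_right (hb t) (norm_nonneg _)

theorem fourierLaplace_congr {F G : ℝ → ℂ} (h : F =ᵐ[volume] G) :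
    fourierLaplace F = fourierLaplace G := by
  funext z
  exact integral_congr_ae (h.mono fun t ht => by simp only [ht])

/-- The Fourier-Laplace transform of `f / √(cosh t - cos σ)`, as a map into the Hardy space. -/
noncomputable def hardyMap {σ : ℝ} (hσ : Real.sin σ ≠ 0) :
    Lp ℂ 2 (volume : Measure ℝ) →ₗ[ℂ] hardySpace where
  toFun f := ⟨_, indicator_fourierLaplace_mem (expMemLp_inv_bipolarWeight_mul hσ (Lp.memLp f))⟩
  map_add' f g := by
    refine Subtype.ext (funext fun z => ?_)
    by_cases hz : z ∈ dualStrip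
    · simp only [Submodule.coe_add, Pi.add_apply, indicator_of_mem hz, fourierLaplace]
      have hi := fun f : Lp ℂ 2 (volume : Measure ℝ) =>
        (expMemLp_inv_bipolarWeight_mul hσ (Lp.memLp f)).integrable_fourierLaplace
        (abs_im_lt_of_mem_dualStrip hz)
      rw [← integral_add (hi f) (hi g)]
      refine integral_congr_ae ?_
      filter_upwards [Lp.coeFn_add f g] with t ht
      rw [ht, Pi.add_apply]
      ring
    · simp only [Submodule.coe_add, Pi.add_apply, indicator_of_notMem hz, add_zero]
  map_smul' c f := by
    refine Subtype.ext (funext fun z => ?_)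
    by_cases hz : z ∈ dualStrip
    · simp only [SetLike.val_smul, Pi.smul_apply, indicator_of_mem hz, fourierLaplace,
        RingHom.id_apply]
      rw [← integral_smul]
      refine integral_congr_ae ?_
      filter_upwards [Lp.coeFn_smul c f] with t ht
      rw [ht, Pi.smul_apply, smul_eq_mul, smul_eq_mul]
      ring
    · simp only [SetLike.val_smul, Pi.smul_apply, indicator_of_notMem hz, smul_zero,
        RingHom.id_apply]

theorem coe_hardyMap {σ : ℝ} (hσ : Real.sin σ ≠ 0) (f : Lp ℂ 2 (volume : Measure ℝ)) :
    (hardyMap hσ f : ℂ → ℂ) = dualStrip.indicator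
      (fourierLaplace fun t => ((bipolarWeight σ t)⁻¹ : ℝ) * f t) := rfl

theorem hasHardyNormSq_hardyMap {σ : ℝ} (hσ : Real.sin σ ≠ 0)
    (f : Lp ℂ 2 (volume : Measure ℝ)) :
    HasHardyNormSq σ (hardyMap hσ f) (‖f‖ ^ 2) := by
  have h := (expMemLp_inv_bipolarWeight_mul hσ (Lp.memLp f)).hasHardyNormSq σ
  rw [coe_hardyMap, norm_sq_eq_integral]
  convert h using 3 with t
  have hp := bipolarWeight_pos hσ t
  rw [norm_mul, Complex.norm_real, Real.norm_of_nonneg (by positivity), mul_pow, inv_pow,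
    bipolarWeight_sq hσ, mul_inv_cancel_left₀ (cosh_sub_cos_pos hσ t).ne']

theorem ExpMemLp.ae_eq_zero {F : ℝ → ℂ} (hF : ExpMemLp F)
    (h : dualStrip.indicator (fourierLaplace F) = 0) : F =ᵐ[volume] 0 := by
  have h0 : |(0 : ℝ)| < 1 / 2 := by norm_num
  have h1 := hF.integral_norm_sq_hSlice h0
  rw [← hSlice_indicator h0, h] at h1
  have h2 : ∫ t, ‖(Real.exp (0 * t) : ℂ) * F t‖ ^ 2 = 0 := by
    have : (2 * Real.pi) ≠ 0 := by positivity
    refine (mul_eq_zero.1 (h1.symm.trans ?_)).resolve_left this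
    simp [hSlice]
  have hm := hF.memLp_exp_mul h0.le
  rw [integral_eq_zero_iff_of_nonneg (fun t => by positivity)
    ((memLp_two_iff_integrable_sq_norm hm.1).1 hm)] at h2
  filter_upwards [h2] with t ht
  simpa using ht

/-- Injectivity is Plancherel on the real axis. For surjectivity, Paley–Wiener provides $F$, and
$w_\sigma F$ is square-integrable because $w_\sigma\le2e^{|t|/2}$. -/
theorem hardyMap_bijective {σ : ℝ} (hσ : Real.sin σ ≠ 0) : Function.Bijective (hardyMap hσ) := by
  refine ⟨(injective_iff_map_eq_zero _).2 fun f hf => ?_, fun h => ?_⟩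
  · have h1 := (expMemLp_inv_bipolarWeight_mul hσ (Lp.memLp f)).ae_eq_zero
      (congrArg Subtype.val hf)
    refine (Lp.eq_zero_iff_ae_eq_zero).2 ?_
    filter_upwards [h1] with t ht
    simpa [(bipolarWeight_pos hσ t).ne'] using ht
  · obtain ⟨F, hF, hh⟩ := exists_eq_indicator_fourierLaplace h.2
    have hm : MemLp (fun t => (bipolarWeight σ t : ℂ) * F t) 2 := by
      refine MemLp.of_le_mul (c := 2) hF ((Complex.continuous_ofReal.comp
        (continuous_bipolarWeight σ)).aestronglyMeasurable.mul hF.aestronglyMeasurable)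
        (Eventually.of_forall fun t => ?_)
      rw [norm_mul, norm_mul, Complex.norm_real, Complex.norm_real, Real.norm_eq_abs,
        Real.norm_eq_abs, Real.abs_exp, abs_of_pos (bipolarWeight_pos hσ t), ← mul_assoc]
      exact mul_le_mul_of_nonneg_right (bipolarWeight_le σ t) (norm_nonneg _)
    refine ⟨hm.toLp _, Subtype.ext ?_⟩
    rw [coe_hardyMap, hh]
    congr 1
    refine fourierLaplace_congr ?_
    filter_upwards [hm.coeFn_toLp] with t ht
    rw [ht, ← mul_assoc, ← Complex.ofReal_mul, inv_mul_cancel₀ (bipolarWeight_pos hσ t).ne',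
      Complex.ofReal_one, one_mul]

/-- The Fourier-Laplace transform as a linear bijection onto the Hardy space. -/
noncomputable def hardyEquiv {σ : ℝ} (hσ : Real.sin σ ≠ 0) :
    Lp ℂ 2 (volume : Measure ℝ) ≃ₗ[ℂ] hardySpace :=
  LinearEquiv.ofBijective (hardyMap hσ) (hardyMap_bijective hσ)

/-! ### Integral operators with exponentially bounded kernels. -/

/-- The square root of the exponential majorant `exp (-|r| / 2)`. -/
noncomputable def expMajorant (r : ℝ) : ENNReal := ENNReal.ofReal (Real.exp (-(1 / 4 * |r|)))

theorem measurable_expMajorant : Measurable expMajorant := by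
  unfold expMajorant
  fun_prop

theorem expMajorant_sq (r : ℝ) :
    expMajorant r ^ 2 = ENNReal.ofReal (Real.exp (-(1 / 2 * |r|))) := by
  rw [expMajorant, ← ENNReal.ofReal_pow (Real.exp_pos _).le, ← Real.exp_nat_mul]
  congr 2
  push_cast
  ring

theorem lintegral_expMajorant_sq_lt_top : ∫⁻ r, expMajorant r ^ 2 < ⊤ := by
  have h := (integrable_exp_neg_mul_abs (c := 1 / 2) (by norm_num)).2
  simp only [expMajorant_sq]
  refine lt_of_eq_of_lt (lintegral_congr fun r => ?_) h
  rw [← ofReal_norm, Real.norm_eq_abs, Real.abs_exp]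

/-- Cauchy–Schwarz with the kernel split as $E\cdot E$: one factor stands alone and the other stays
with $f$. This is the reason for working with a square root of the majorant. -/
theorem lintegral_expMajorant_mul_sq_le (t : ℝ) {f : ℝ → ℂ} (hf : AEStronglyMeasurable f volume) :
    (∫⁻ s, expMajorant (t - s) ^ 2 * ‖f s‖ₑ) ^ 2 ≤
      (∫⁻ r, expMajorant r ^ 2) * ∫⁻ s, expMajorant (t - s) ^ 2 * ‖f s‖ₑ ^ 2 := by
  have hE : Measurable fun s => expMajorant (t - s) :=
    measurable_expMajorant.comp (measurable_const.sub measurable_id)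
  have h := ENNReal.lintegral_mul_le_Lp_mul_Lq volume (Real.HolderConjugate.two_two)
    hE.aemeasurable (hE.aemeasurable.mul hf.enorm)
  have e1 : ∫⁻ s, expMajorant (t - s) ^ 2 = ∫⁻ r, expMajorant r ^ 2 :=
    lintegral_sub_left_eq_self (fun r => expMajorant r ^ 2) t
  have h2 := pow_le_pow_left' h 2
  simp only [Pi.mul_apply, ENNReal.rpow_ofNat, mul_pow] at h2
  simp only [← mul_assoc, ← sq] at h2
  refine h2.trans (le_of_eq ?_)
  rw [e1, ← ENNReal.rpow_natCast, ← ENNReal.rpow_natCast, ← ENNReal.rpow_mul, ← ENNReal.rpow_mul]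
  norm_num

/-- Schur's test for a kernel with an exponential convolution majorant. -/
theorem lintegral_lintegral_expMajorant_le {f : ℝ → ℂ} (hf : AEStronglyMeasurable f volume) :
    ∫⁻ t, (∫⁻ s, expMajorant (t - s) ^ 2 * ‖f s‖ₑ) ^ 2 ≤
      (∫⁻ r, expMajorant r ^ 2) ^ 2 * ∫⁻ s, ‖f s‖ₑ ^ 2 := by
  set M := ∫⁻ r, expMajorant r ^ 2 with hM
  have hM' : M ≠ ⊤ := lintegral_expMajorant_sq_lt_top.ne
  have hm : Measurable fun p : ℝ × ℝ => expMajorant (p.1 - p.2) ^ 2 :=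
    (measurable_expMajorant.comp (measurable_fst.sub measurable_snd)).pow_const 2
  have hprod : AEMeasurable (fun p : ℝ × ℝ => expMajorant (p.1 - p.2) ^ 2 * ‖f p.2‖ₑ ^ 2)
      (volume.prod volume) := hm.aemeasurable.mul (hf.comp_snd.enorm.pow_const 2)
  calc _ ≤ ∫⁻ t, M * ∫⁻ s, expMajorant (t - s) ^ 2 * ‖f s‖ₑ ^ 2 :=
        lintegral_mono fun t => lintegral_expMajorant_mul_sq_le t hf
    _ = M * ∫⁻ t, ∫⁻ s, expMajorant (t - s) ^ 2 * ‖f s‖ₑ ^ 2 := lintegral_const_mul' _ _ hM'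
    _ = M * ∫⁻ s, ∫⁻ t, expMajorant (t - s) ^ 2 * ‖f s‖ₑ ^ 2 := by
        rw [lintegral_lintegral_swap hprod]
    _ = M * ∫⁻ s, M * ‖f s‖ₑ ^ 2 := by
        congr 1
        refine lintegral_congr fun s => ?_
        rw [lintegral_mul_const' _ _ (by simp [enorm_ne_top]),
          lintegral_sub_right_eq_self (fun r => expMajorant r ^ 2) s]
    _ = _ := by rw [lintegral_const_mul' _ _ hM', ← mul_assoc, sq]

/-- A measurable kernel on the line with an exponential convolution majorant. -/
structure ExpKernel (k : ℝ → ℝ → ℝ) : Prop where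
  measurable : Measurable fun p : ℝ × ℝ => k p.1 p.2
  bound : ∃ A : ℝ, ∀ t s, |k t s| ≤ A * Real.exp (-(1 / 2 * |t - s|))

section

variable {k : ℝ → ℝ → ℝ}

theorem ExpKernel.swap (hk : ExpKernel k) : ExpKernel fun s t => k t s := by
  refine ⟨hk.measurable.comp measurable_swap, ?_⟩
  obtain ⟨A, hA⟩ := hk.bound
  exact ⟨A, fun t s => by rw [abs_sub_comm]; exact hA s t⟩

theorem ExpKernel.exists_enorm_le (hk : ExpKernel k) : ∃ A : ENNReal, A ≠ ⊤ ∧ ∀ (t : ℝ) (s : ℝ)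
    (z : ℂ), ‖(k t s : ℂ) * z‖ₑ ≤ A * (expMajorant (t - s) ^ 2 * ‖z‖ₑ) := by
  obtain ⟨A, hA⟩ := hk.bound
  refine ⟨ENNReal.ofReal A, ENNReal.ofReal_ne_top, fun t s z => ?_⟩
  rw [enorm_mul, ← mul_assoc, expMajorant_sq, ← ENNReal.ofReal_mul' (Real.exp_pos _).le]
  gcongr
  rw [← ofReal_norm, Complex.norm_real, Real.norm_eq_abs]
  exact ENNReal.ofReal_le_ofReal (hA t s)

theorem ExpKernel.integrable (hk : ExpKernel k) {f : ℝ → ℂ} (hf : MemLp f 2) (t : ℝ) :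
    Integrable fun s => (k t s : ℂ) * f s := by
  obtain ⟨A, hA⟩ := hk.bound
  have hE : MemLp (fun s : ℝ => (A : ℂ) * (Real.exp (-(1 / 2 * |t - s|)) : ℂ)) 2 :=
    (((memLp_exp_neg_mul_abs (c := 1 / 2) (by norm_num)).comp_measurePreserving
      (Measure.measurePreserving_sub_left volume t))).const_mul _
  refine MemLp.integrable_mul (p := 2) (q := 2) (MemLp.mono hE ?_ (Eventually.of_forall
    fun s => ?_)) hf
  · exact (Complex.measurable_ofReal.comp
      (hk.measurable.comp measurable_prodMk_left)).aestronglyMeasurable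
  · rw [← Complex.ofReal_mul, Complex.norm_real, Complex.norm_real]
    exact (hA t s).trans (le_abs_self _)

theorem ExpKernel.aestronglyMeasurable_prod (hk : ExpKernel k) {f : ℝ → ℂ}
    (hf : AEStronglyMeasurable f volume) :
    AEStronglyMeasurable (fun p : ℝ × ℝ => (k p.1 p.2 : ℂ) * f p.2) (volume.prod volume) :=
  (Complex.measurable_ofReal.comp hk.measurable).aestronglyMeasurable.mul hf.comp_snd

theorem ExpKernel.exists_lintegral_le (hk : ExpKernel k) : ∃ C : ENNReal, C ≠ ⊤ ∧
    ∀ f : ℝ → ℂ, AEStronglyMeasurable f volume →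
      ∫⁻ t, (∫⁻ s, ‖(k t s : ℂ) * f s‖ₑ) ^ 2 ≤ C * ∫⁻ s, ‖f s‖ₑ ^ 2 := by
  obtain ⟨A, hA, hb⟩ := hk.exists_enorm_le
  refine ⟨A ^ 2 * (∫⁻ r, expMajorant r ^ 2) ^ 2, ENNReal.mul_ne_top (ENNReal.pow_ne_top hA)
    (ENNReal.pow_ne_top lintegral_expMajorant_sq_lt_top.ne), fun f hf => ?_⟩
  calc _ ≤ ∫⁻ t, (A * ∫⁻ s, expMajorant (t - s) ^ 2 * ‖f s‖ₑ) ^ 2 := by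
        refine lintegral_mono fun t => pow_le_pow_left' ?_ 2
        rw [← lintegral_const_mul' _ _ hA]
        exact lintegral_mono fun s => hb t s _
    _ = A ^ 2 * ∫⁻ t, (∫⁻ s, expMajorant (t - s) ^ 2 * ‖f s‖ₑ) ^ 2 := by
        simp only [mul_pow]
        rw [lintegral_const_mul' _ _ (ENNReal.pow_ne_top hA)]
    _ ≤ _ := by
        rw [mul_assoc]
        gcongr
        exact lintegral_lintegral_expMajorant_le hf

theorem ExpKernel.memLp (hk : ExpKernel k) {f : ℝ → ℂ} (hf : MemLp f 2) :
    MemLp (fun t => ∫ s, (k t s : ℂ) * f s) 2 := by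
  obtain ⟨C, hC, hb⟩ := hk.exists_lintegral_le
  refine ⟨(hk.aestronglyMeasurable_prod hf.1).integral_prod_right', ?_⟩
  rw [eLpNorm_lt_top_iff_lintegral_rpow_enorm_lt_top (by norm_num) (by norm_num)]
  simp only [ENNReal.toReal_ofNat, ENNReal.rpow_ofNat]
  refine lt_of_le_of_lt (lintegral_mono fun t => pow_le_pow_left'
    (enorm_integral_le_lintegral_enorm _) 2) ((hb f hf.1).trans_lt ?_)
  rw [lintegral_enorm_sq_eq hf]
  exact ENNReal.mul_lt_top hC.lt_top ENNReal.ofReal_lt_top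

/-- The bounded operator on `L²(ℝ)` with kernel `k`. -/
noncomputable def ExpKernel.op (hk : ExpKernel k) :
    Lp ℂ 2 (volume : Measure ℝ) →L[ℂ] Lp ℂ 2 (volume : Measure ℝ) :=
  LinearMap.mkContinuousOfExistsBound
    { toFun := fun f => (hk.memLp (Lp.memLp f)).toLp _
      map_add' := fun f g => by
        rw [← MemLp.toLp_add]
        refine MemLp.toLp_congr _ _ (Eventually.of_forall fun t => ?_)
        simp only [Pi.add_apply]
        rw [← integral_add (hk.integrable (Lp.memLp f) t) (hk.integrable (Lp.memLp g) t)]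
        refine integral_congr_ae ?_
        filter_upwards [Lp.coeFn_add f g] with s hs
        rw [hs, Pi.add_apply]
        ring
      map_smul' := fun c f => by
        rw [RingHom.id_apply, ← MemLp.toLp_const_smul]
        refine MemLp.toLp_congr _ _ (Eventually.of_forall fun t => ?_)
        simp only [Pi.smul_apply]
        rw [← integral_smul]
        refine integral_congr_ae ?_
        filter_upwards [Lp.coeFn_smul c f] with s hs
        rw [hs, Pi.smul_apply, smul_eq_mul, smul_eq_mul]
        ring } (by
    obtain ⟨C, hC, hb⟩ := hk.exists_lintegral_le
    refine ⟨√C.toReal, fun f => ?_⟩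
    refine le_of_sq_le_sq ?_ (by positivity)
    rw [mul_pow, Real.sq_sqrt ENNReal.toReal_nonneg, norm_sq_eq_integral, norm_sq_eq_integral]
    have h1 := hk.memLp (Lp.memLp f)
    have h2 : ∫⁻ t, ‖∫ s, (k t s : ℂ) * f s‖ₑ ^ 2 ≤ C * ∫⁻ s, ‖f s‖ₑ ^ 2 :=
      (lintegral_mono fun t => pow_le_pow_left' (enorm_integral_le_lintegral_enorm _) 2).trans
        (hb f (Lp.memLp f).1)
    rw [lintegral_enorm_sq_eq h1, lintegral_enorm_sq_eq (Lp.memLp f), ← ENNReal.ofReal_toReal hC,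
      ← ENNReal.ofReal_mul ENNReal.toReal_nonneg,
      ENNReal.ofReal_le_ofReal_iff (mul_nonneg ENNReal.toReal_nonneg
        (integral_nonneg fun s => by positivity))] at h2
    refine le_trans (le_of_eq ?_) h2
    exact integral_congr_ae (h1.coeFn_toLp.mono fun t ht => congrArg (fun z : ℂ => ‖z‖ ^ 2) ht))

theorem ExpKernel.coeFn_op (hk : ExpKernel k) (f : Lp ℂ 2 (volume : Measure ℝ)) :
    hk.op f =ᵐ[volume] fun t => ∫ s, (k t s : ℂ) * f s :=
  (hk.memLp (Lp.memLp f)).coeFn_toLp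

/-- The kernel is real, so Fubini gives the transpose. Absolute integrability follows from
$|ab|\le|a|^2+|b|^2$ with $a=g(t)$ and $b=\int|k(t,s)f(s)|\,\mathrm ds$, the latter being
square-integrable by Schur's test. -/
theorem ExpKernel.inner_op (hk : ExpKernel k) (f g : Lp ℂ 2 (volume : Measure ℝ)) :
    inner ℂ (hk.op f) g = (inner ℂ f (hk.swap.op g) : ℂ) := by
  rw [L2.inner_def, L2.inner_def]
  have hf := Lp.memLp f
  have hg := Lp.memLp g
  have hm : AEStronglyMeasurable (fun p : ℝ × ℝ => g p.1 * conj ((k p.1 p.2 : ℂ) * f p.2))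
      (volume.prod volume) :=
    hg.1.comp_fst.mul (Complex.continuous_conj.comp_aestronglyMeasurable
      (hk.aestronglyMeasurable_prod hf.1))
  have hint : Integrable (fun p : ℝ × ℝ => g p.1 * conj ((k p.1 p.2 : ℂ) * f p.2))
      (volume.prod volume) := by
    refine ⟨hm, ?_⟩
    obtain ⟨C, hC, hb⟩ := hk.exists_lintegral_le
    have hms : AEStronglyMeasurable (fun t => ((∫ s, ‖(k t s : ℂ) * f s‖ : ℝ) : ℂ)) volume :=
      Complex.continuous_ofReal.comp_aestronglyMeasurable
        (hk.aestronglyMeasurable_prod hf.1).norm.integral_prod_right'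
    have e : ∀ t, ∫⁻ s, ‖g t * conj ((k t s : ℂ) * f s)‖ₑ =
        ‖g t * ((∫ s, ‖(k t s : ℂ) * f s‖ : ℝ) : ℂ)‖ₑ := fun t => by
      simp only [enorm_mul, RCLike.enorm_conj]
      rw [lintegral_const_mul' _ _ enorm_ne_top]
      congr 1
      simp only [← enorm_mul]
      rw [← ofReal_norm, Complex.norm_real, Real.norm_of_nonneg
        (integral_nonneg fun s => norm_nonneg _), ofReal_integral_norm_eq_lintegral_enorm
        (hk.integrable hf t)]
    have hle : ∫⁻ t, ‖((∫ s, ‖(k t s : ℂ) * f s‖ : ℝ) : ℂ)‖ₑ ^ 2 ≤ C * ∫⁻ s, ‖f s‖ₑ ^ 2 := by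
      refine le_trans (le_of_eq (lintegral_congr fun t => ?_)) (hb f hf.1)
      rw [← ofReal_norm, Complex.norm_real, Real.norm_of_nonneg
        (integral_nonneg fun s => norm_nonneg _), ofReal_integral_norm_eq_lintegral_enorm
        (hk.integrable hf t)]
    rw [HasFiniteIntegral, lintegral_prod _ hm.enorm]
    simp only [e]
    refine (lintegral_enorm_mul_le hg.1 _).trans_lt (ENNReal.add_lt_top.2 ⟨?_, hle.trans_lt ?_⟩)
    · rw [lintegral_enorm_sq_eq hg]; exact ENNReal.ofReal_lt_top
    · rw [lintegral_enorm_sq_eq hf]; exact ENNReal.mul_lt_top hC.lt_top ENNReal.ofReal_lt_top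
  calc _ = ∫ t, ∫ s, g t * conj ((k t s : ℂ) * f s) := by
        refine integral_congr_ae ?_
        filter_upwards [hk.coeFn_op f] with t ht
        rw [ht, RCLike.inner_apply, integral_const_mul, integral_conj]
    _ = ∫ s, ∫ t, g t * conj ((k t s : ℂ) * f s) := integral_integral_swap hint
    _ = _ := by
        refine integral_congr_ae ?_
        filter_upwards [hk.swap.coeFn_op g] with s hs
        rw [hs, RCLike.inner_apply, ← integral_mul_const]
        refine integral_congr_ae (Eventually.of_forall fun t => ?_)
        simp only [map_mul, Complex.conj_ofReal]
        ring

end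

/-! ### The strip Poisson operator in weighted coordinates. -/

theorem stripPoisson_nonneg {θ : ℝ} (hθ : θ ∈ Ioo 0 Real.pi) (t : ℝ) : 0 ≤ stripPoisson θ t := by
  have h1 := Real.sin_pos_of_mem_Ioo hθ
  have h2 := cosh_sub_cos_pos h1.ne' t
  unfold stripPoisson
  positivity

theorem stripPoisson_neg (θ t : ℝ) : stripPoisson θ (-t) = stripPoisson θ t := by
  unfold stripPoisson
  rw [Real.cosh_neg]

theorem continuous_stripPoisson {θ : ℝ} (hθ : θ ∈ Ioo 0 Real.pi) : Continuous (stripPoisson θ) := by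
  unfold stripPoisson
  refine continuous_const.mul (continuous_const.div (by fun_prop) fun t => ?_)
  exact (cosh_sub_cos_pos (Real.sin_pos_of_mem_Ioo hθ).ne' t).ne'

theorem exists_stripPoisson_le {θ : ℝ} (hθ : θ ∈ Ioo 0 Real.pi) :
    ∃ C : ℝ, ∀ t, stripPoisson θ t ≤ C * Real.exp (-|t|) := by
  have h1 := Real.sin_pos_of_mem_Ioo hθ
  refine ⟨1 / (2 * Real.pi) * (Real.sin θ * ((1 - |Real.cos θ|) / 2)⁻¹), fun t => ?_⟩
  unfold stripPoisson
  rw [mul_assoc, mul_assoc, div_eq_mul_inv (Real.sin θ)]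
  gcongr
  exact inv_cosh_sub_cos_le h1.ne' t

/-- The Poisson kernel of the strip in weighted coordinates. -/
noncomputable def bipolarKernel (φ α σ : ℝ) (t s : ℝ) : ℝ :=
  (bipolarWeight α t)⁻¹ * stripPoisson φ (t - s) * bipolarWeight σ s

/-- The ratio of weights costs at most a constant times $e^{(|s|-|t|)/2}\le e^{|t-s|/2}$, while the
Poisson kernel decays like $e^{-|t-s|}$; half of the decay survives. -/
theorem expKernel_bipolarKernel {φ α : ℝ} (hφ : φ ∈ Ioo 0 Real.pi) (hα : Real.sin α ≠ 0)
    {σ : ℝ} (hσ : Real.sin σ ≠ 0) : ExpKernel (bipolarKernel φ α σ) := by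
  obtain ⟨B, hB⟩ := exists_stripPoisson_le hφ
  obtain ⟨C, hC0, hC⟩ := exists_exp_le_bipolarWeight hα
  refine ⟨Continuous.measurable ?_, C * B * 2, fun t s => ?_⟩
  · unfold bipolarKernel
    exact (((continuous_inv_bipolarWeight hα).comp continuous_fst).mul
      ((continuous_stripPoisson hφ).comp (continuous_fst.sub continuous_snd))).mul
      ((continuous_bipolarWeight σ).comp continuous_snd)
  · have h1 := bipolarWeight_pos hα t
    have h2 := bipolarWeight_pos hσ s
    have h3 := stripPoisson_nonneg hφ (t - s)
    unfold bipolarKernel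
    rw [abs_of_nonneg (by positivity)]
    have h4 : (bipolarWeight α t)⁻¹ ≤ C * Real.exp (-(|t| / 2)) := by
      rw [Real.exp_neg, ← div_eq_mul_inv, le_div_iff₀ (Real.exp_pos _), mul_comm]
      exact hC t
    calc (bipolarWeight α t)⁻¹ * stripPoisson φ (t - s) * bipolarWeight σ s
        ≤ (C * Real.exp (-(|t| / 2))) * (B * Real.exp (-|t - s|)) * (2 * Real.exp (|s| / 2)) := by
          have h5 := hB (t - s)
          have h6 : 0 ≤ C * Real.exp (-(|t| / 2)) := by positivity
          exact mul_le_mul (mul_le_mul h4 h5 h3 h6) (bipolarWeight_le σ s) h2.le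
            (mul_nonneg h6 (h3.trans h5))
      _ = C * B * 2 * Real.exp (-(|t| / 2) + -|t - s| + |s| / 2) := by
          rw [Real.exp_add, Real.exp_add]; ring
      _ ≤ C * B * 2 * Real.exp (-(1 / 2 * |t - s|)) := by
          have hB0 : 0 ≤ B := by
            have := (stripPoisson_nonneg hφ 0).trans (hB 0)
            simpa using this
          gcongr
          have := abs_sub_abs_le_abs_sub s t
          rw [abs_sub_comm] at this
          linarith

theorem integrable_exp_mul_stripPoisson {θ : ℝ} (hθ : θ ∈ Ioo 0 Real.pi) {z : ℂ}
    (hz : z ∈ dualStrip) :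
    Integrable fun τ : ℝ => Complex.exp (-Complex.I * z * τ) * (stripPoisson θ τ : ℂ) := by
  have h := (integrable_exp_mul_inv_cosh_sub_cos (Real.sin_pos_of_mem_Ioo hθ).ne' (z := z)
    (by linarith [abs_im_lt_of_mem_dualStrip hz])).const_mul
    ((1 / (2 * Real.pi) * Real.sin θ : ℝ) : ℂ)
  refine h.congr (Eventually.of_forall fun τ => ?_)
  simp only [stripPoisson]
  push_cast
  ring

/-- The exponential factors as $e^{-\mathrm izs}=e^{-\mathrm iz(s-t)}e^{-\mathrm izt}$, and both
weighted functions are integrable inside the strip, so the integral of their convolution is the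
product. Evenness of the kernel allows $t-s$ in place of $s-t$. -/
theorem fourierLaplace_stripPoisson_conv {θ : ℝ} (hθ : θ ∈ Ioo 0 Real.pi) {F : ℝ → ℂ}
    (hF : ExpMemLp F) {z : ℂ} (hz : z ∈ dualStrip) :
    fourierLaplace (fun s => ∫ t, (stripPoisson θ (t - s) : ℂ) * F t) z =
      stripPoissonHat θ z * fourierLaplace F z := by
  have h := integral_convolution (ContinuousLinearMap.mul ℂ ℂ) (μ := volume) (ν := volume)
    (integrable_exp_mul_stripPoisson hθ hz)
    (hF.integrable_fourierLaplace (abs_im_lt_of_mem_dualStrip hz))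
  simp only [convolution_mul_swap, ContinuousLinearMap.mul_apply'] at h
  refine Eq.trans ?_ h
  rw [fourierLaplace]
  congr 1
  funext s
  rw [← integral_const_mul]
  congr 1
  funext t
  rw [← stripPoisson_neg, neg_sub, show -Complex.I * z * (s : ℂ) =
    -Complex.I * z * ((s - t : ℝ) : ℂ) + -Complex.I * z * (t : ℂ) by push_cast; ring,
    Complex.exp_add]
  ring

/-- The transposed Poisson operator is multiplication by the transform of the Poisson kernel. -/
theorem hardyMap_op_bipolarKernel {φ α σ : ℝ} (hφ : φ ∈ Ioo 0 Real.pi) (hα : Real.sin α ≠ 0)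
    (hσ : Real.sin σ ≠ 0) (f : Lp ℂ 2 (volume : Measure ℝ)) :
    (hardyMap hσ ((expKernel_bipolarKernel hφ hα hσ).swap.op f) : ℂ → ℂ) =
      stripPoissonHat φ * (hardyMap hα f : ℂ → ℂ) := by
  funext z
  rw [Pi.mul_apply, coe_hardyMap, coe_hardyMap]
  by_cases hz : z ∈ dualStrip
  · rw [indicator_of_mem hz, indicator_of_mem hz, ← fourierLaplace_stripPoisson_conv hφ
      (expMemLp_inv_bipolarWeight_mul hα (Lp.memLp f)) hz]
    refine congrFun (fourierLaplace_congr ?_) z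
    filter_upwards [(expKernel_bipolarKernel hφ hα hσ).swap.coeFn_op f] with s hs
    rw [hs, ← integral_const_mul]
    congr 1
    funext t
    -- The transposed kernel carries $w_\sigma(s)$, which the normalization $1/w_\sigma(s)$ removes.
    -- What remains is the convolution of $\mathscr P_\varphi$ with $f/w_\alpha$.
    have h1 : (bipolarWeight σ s : ℂ) ≠ 0 :=
      Complex.ofReal_ne_zero.2 (bipolarWeight_pos hσ s).ne'
    simp only [bipolarKernel]
    push_cast
    field_simp
  · rw [indicator_of_notMem hz, indicator_of_notMem hz, mul_zero]

/-! ### Hausdorff measure on a parametrized curve. -/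

/-- A local comparison of two measures on the line is a global one. -/
theorem measure_le_of_forall_nhds {μ ν : Measure ℝ}
    (h : ∀ x, ∃ U ∈ 𝓝 x, ∀ E ⊆ U, MeasurableSet E → μ E ≤ ν E) : μ ≤ ν := by
  have h' : ∀ x, ∃ U, IsOpen U ∧ x ∈ U ∧ ∀ E ⊆ U, MeasurableSet E → μ E ≤ ν E := fun x => by
    obtain ⟨U, hU, hE⟩ := h x
    obtain ⟨V, hVU, hV, hx⟩ := mem_nhds_iff.1 hU
    exact ⟨V, hV, hx, fun E hEV => hE E (hEV.trans hVU)⟩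
  choose U hUo hxU hU using h'
  obtain ⟨s, hs, hcov⟩ := TopologicalSpace.countable_cover_nhds fun x => (hUo x).mem_nhds (hxU x)
  have hne : s.Nonempty := by
    by_contra hs
    rw [not_nonempty_iff_eq_empty] at hs
    rw [hs, biUnion_empty] at hcov
    exact empty_ne_univ hcov
  obtain ⟨x, rfl⟩ := hs.exists_eq_range hne
  rw [biUnion_range] at hcov
  refine Measure.le_iff.2 fun E hE => ?_
  have hdm : ∀ n, MeasurableSet (disjointed (fun n => U (x n)) n) :=
    fun n => MeasurableSet.disjointed (fun n => (hUo (x n)).measurableSet) n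
  have hEu : E = ⋃ n, E ∩ disjointed (fun n => U (x n)) n := by
    rw [← inter_iUnion, iUnion_disjointed, hcov, inter_univ]
  have hdisj : Pairwise (Function.onFun Disjoint fun n => E ∩ disjointed (fun n => U (x n)) n) :=
    fun i j hij => (disjoint_disjointed (fun n => U (x n)) hij).mono inter_subset_right
      inter_subset_right
  rw [hEu, measure_iUnion hdisj fun n => hE.inter (hdm n),
    measure_iUnion hdisj fun n => hE.inter (hdm n)]
  exact ENNReal.tsum_le_tsum fun n => hU (x n) _
    (inter_subset_right.trans (disjointed_subset _ _)) (hE.inter (hdm n))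

theorem measure_le_of_forall_one_lt {μ ν : Measure ℝ}
    (h : ∀ l : ℝ, 1 < l → μ ≤ ENNReal.ofReal (l * l) • ν) : μ ≤ ν := by
  refine Measure.le_iff.2 fun E _ => ?_
  by_cases hE : ν E = ⊤
  · rw [hE]; exact le_top
  have hc : Continuous fun l : ℝ => ENNReal.ofReal (l * l) * ν E :=
    ENNReal.continuous_mul_const hE |>.comp (ENNReal.continuous_ofReal.comp (by fun_prop))
  have hlim : Tendsto (fun l : ℝ => ENNReal.ofReal (l * l) * ν E) (𝓝[>] 1) (𝓝 (ν E)) := by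
    have := (hc.tendsto 1).mono_left (nhdsWithin_le_nhds (s := Ioi 1))
    simpa using this
  refine ge_of_tendsto hlim ?_
  filter_upwards [self_mem_nhdsWithin] with l hl
  have := h l hl E
  simpa using this

/-- The one-dimensional Hausdorff measure on an injective curve with metric speed `v`. -/
theorem restrict_hausdorffMeasure_range_eq_map {X : Type*} [MetricSpace X] [MeasurableSpace X]
    [BorelSpace X] {p : ℝ → X} {v : ℝ → ℝ} (hp : MeasurableEmbedding p) (hv : Continuous v)
    (hv0 : ∀ t, 0 < v t)
    (hd : ∀ t₀ m M : ℝ, 0 < m → m < v t₀ → v t₀ < M → ∃ U ∈ 𝓝 t₀, ∀ t ∈ U, ∀ s ∈ U,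
      m * |t - s| ≤ dist (p t) (p s) ∧ dist (p t) (p s) ≤ M * |t - s|) :
    (μH[1] : Measure X).restrict (range p) =
      Measure.map p (volume.withDensity fun t => ENNReal.ofReal (v t)) := by
  rw [← hp.map_comap]
  congr 1
  set ν : Measure ℝ := volume.withDensity fun t => ENNReal.ofReal (v t)
  have hloc : ∀ l : ℝ, 1 < l → ∀ t₀ : ℝ, ∃ U ∈ 𝓝 t₀, ∀ E ⊆ U, MeasurableSet E →
      μH[1] (p '' E) ≤ ENNReal.ofReal (l * l) * ν E ∧
      ν E ≤ ENNReal.ofReal (l * l) * μH[1] (p '' E) := by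
    intro l hl t₀
    have hl0 : 0 < l := by linarith
    set V := v t₀ with hV
    have hVpos : 0 < V := hv0 t₀
    -- On a small set both the metric distortion of $p$ and the speed $v$ lie between $V/l$ and
    -- $Vl$. Hence the Hausdorff measure and $\nu$ are each within these multiples of Lebesgue
    -- measure, and so within a factor $l^2$ of each other; afterwards $l\to1$.
    have hm : V / l < V := div_lt_self hVpos hl
    have hM : V < V * l := lt_mul_of_one_lt_right hVpos hl
    have hm0 : 0 < V / l := by positivity
    obtain ⟨U, hU, hUd⟩ := hd t₀ (V / l) (V * l) hm0 hm hM
    have hW : {t | V / l < v t ∧ v t < V * l} ∈ 𝓝 t₀ :=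
      ((isOpen_lt continuous_const hv).inter (isOpen_lt hv continuous_const)).mem_nhds ⟨hm, hM⟩
    refine ⟨_, inter_mem hU hW, fun E hE hEm => ?_⟩
    have hνE : ν E = ∫⁻ t in E, ENNReal.ofReal (v t) := withDensity_apply _ hEm
    have h1 : μH[1] (p '' E) ≤ ENNReal.ofReal (V * l) * volume E := by
      have hlip : LipschitzOnWith (V * l).toNNReal p E :=
        LipschitzOnWith.of_dist_le_mul fun t ht s hs => by
          rw [Real.coe_toNNReal _ (by positivity), Real.dist_eq]
          exact (hUd t (hE ht).1 s (hE hs).1).2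
      have := hlip.hausdorffMeasure_image_le (d := 1) zero_le_one
      rw [hausdorffMeasure_real, ENNReal.rpow_one] at this
      exact this
    have h2 : ENNReal.ofReal (V / l) * volume E ≤ μH[1] (p '' E) := by
      have hlip : LipschitzOnWith (V / l)⁻¹.toNNReal (Function.invFun p) (p '' E) := by
        refine LipschitzOnWith.of_dist_le_mul ?_
        rintro _ ⟨t, ht, rfl⟩ _ ⟨s, hs, rfl⟩
        rw [Function.leftInverse_invFun hp.injective, Function.leftInverse_invFun hp.injective,
          Real.coe_toNNReal _ (by positivity), Real.dist_eq, ← div_eq_inv_mul, le_div_iff₀ hm0,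
          mul_comm]
        exact (hUd t (hE ht).1 s (hE hs).1).1
      have h3 := hlip.hausdorffMeasure_image_le (d := 1) zero_le_one
      rw [← image_comp, (Function.leftInverse_invFun hp.injective).comp_eq_id, image_id,
        hausdorffMeasure_real, ENNReal.rpow_one] at h3
      calc _ ≤ ENNReal.ofReal (V / l) * (ENNReal.ofReal (V / l)⁻¹ * μH[1] (p '' E)) := by
            gcongr
            exact h3
        _ = _ := by
            rw [← mul_assoc, ← ENNReal.ofReal_mul hm0.le, mul_inv_cancel₀ hm0.ne',
              ENNReal.ofReal_one, one_mul]
    have h3 : ν E ≤ ENNReal.ofReal (V * l) * volume E := by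
      rw [hνE, ← setLIntegral_const]
      exact setLIntegral_mono measurable_const fun t ht => ENNReal.ofReal_le_ofReal (hE ht).2.2.le
    have h4 : ENNReal.ofReal (V / l) * volume E ≤ ν E := by
      rw [hνE, ← setLIntegral_const]
      exact setLIntegral_mono (by fun_prop) fun t ht => ENNReal.ofReal_le_ofReal (hE ht).2.1.le
    have hfac : ENNReal.ofReal (V * l) * volume E =
        ENNReal.ofReal (l * l) * (ENNReal.ofReal (V / l) * volume E) := by
      rw [← mul_assoc, ← ENNReal.ofReal_mul (by positivity)]
      congr 2
      field_simp
    rw [hfac] at h1 h3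
    exact ⟨h1.trans (by gcongr), h3.trans (by gcongr)⟩
  refine le_antisymm (measure_le_of_forall_one_lt fun l hl =>
    measure_le_of_forall_nhds fun t₀ => ?_)
    (measure_le_of_forall_one_lt fun l hl => measure_le_of_forall_nhds fun t₀ => ?_)
  · obtain ⟨U, hU, h⟩ := hloc l hl t₀
    refine ⟨U, hU, fun E hE hEm => ?_⟩
    rw [hp.comap_apply, Measure.smul_apply, smul_eq_mul]
    exact (h E hE hEm).1
  · obtain ⟨U, hU, h⟩ := hloc l hl t₀
    refine ⟨U, hU, fun E hE hEm => ?_⟩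
    rw [Measure.smul_apply, smul_eq_mul, hp.comap_apply]
    exact (h E hE hEm).2

/-- From $e^{x}(1-x)\le1$ and $e^{-x}\ge1-x$ the left side is at most $(1-(1-x)^2)/2\le x$. It
provides an explicit upper bound for $\sinh x/x$ near $0$. -/
theorem sinh_mul_one_sub_le {x : ℝ} (h0 : 0 ≤ x) (h1 : x < 1) : Real.sinh x * (1 - x) ≤ x := by
  have e1 : Real.exp x * (1 - x) ≤ 1 := by
    have := Real.add_one_le_exp (-x)
    have h2 : Real.exp x * Real.exp (-x) = 1 := by rw [← Real.exp_add]; simp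
    nlinarith [Real.exp_pos x]
  have e2 := Real.add_one_le_exp (-x)
  rw [Real.sinh_eq]
  nlinarith

/-- The conformal chord formula determines the metric speed of a curve. -/
theorem chord_bounds_of_dist_eq {X : Type*} [MetricSpace X] {p : ℝ → X} {v : ℝ → ℝ}
    (hv : Continuous v) (hv0 : ∀ t, 0 < v t)
    (hd : ∀ t s, dist (p t) (p s) ^ 2 = v t * v s * (2 * Real.sinh (|t - s| / 2)) ^ 2)
    (t₀ m M : ℝ) (hm0 : 0 < m) (hm : m < v t₀) (hM : v t₀ < M) :
    ∃ U ∈ 𝓝 t₀, ∀ t ∈ U, ∀ s ∈ U,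
      m * |t - s| ≤ dist (p t) (p s) ∧ dist (p t) (p s) ≤ M * |t - s| := by
  obtain ⟨M', hM'1, hM'2⟩ := exists_between hM
  have hM'0 : 0 < M' := (hv0 t₀).trans hM'1
  have hM0 : 0 < M := hM'0.trans hM'2
  -- With this radius, $r/2<1-M'/M$, so the factor $1/(1-r/2)$ lost in replacing $\sinh(r/2)$ by
  -- $r/2$ is at most $M/M'$, exactly the room between $M'$ and $M$.
  have hδ : 0 < 1 - M' / M := sub_pos.2 ((div_lt_one hM0).2 hM'2)
  refine ⟨_, inter_mem (Metric.ball_mem_nhds t₀ hδ)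
    (((isOpen_lt continuous_const hv).inter (isOpen_lt hv continuous_const)).mem_nhds ⟨hm, hM'1⟩),
    fun t ht s hs => ?_⟩
  have hvt : m < v t ∧ v t < M' := ht.2
  have hvs : m < v s ∧ v s < M' := hs.2
  set r := |t - s| with hr
  have hr0 : 0 ≤ r := abs_nonneg _
  have hr1 : r / 2 < 1 - M' / M := by
    have h1 : |t - t₀| < 1 - M' / M := ht.1
    have h2 : |s - t₀| < 1 - M' / M := hs.1
    have := abs_sub_le t t₀ s
    rw [abs_sub_comm t₀ s] at this
    linarith
  have hsinh : r / 2 ≤ Real.sinh (r / 2) := Real.self_le_sinh_iff.2 (by positivity)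
  have hsinh2 : M' * (2 * Real.sinh (r / 2)) ≤ M * r := by
    have h1 : r / 2 < 1 := hr1.trans (by linarith [div_pos hM'0 hM0])
    have h2 := sinh_mul_one_sub_le (by positivity) h1
    have h3 : M' / M ≤ 1 - r / 2 := by linarith
    have h4 : Real.sinh (r / 2) * (M' / M) ≤ r / 2 :=
      (mul_le_mul_of_nonneg_left h3 (by linarith)).trans h2
    rw [mul_div_assoc', div_le_iff₀ hM0] at h4
    linarith
  have hvv1 : m ^ 2 ≤ v t * v s := by rw [sq]; gcongr <;> linarith
  have hvv2 : v t * v s ≤ M' ^ 2 := by rw [sq]; gcongr <;> linarith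
  constructor
  · refine le_of_sq_le_sq ?_ dist_nonneg
    rw [hd, mul_pow]
    have := (mul_pos (hv0 t) (hv0 s)).le
    gcongr
    linarith
  · refine le_of_sq_le_sq ?_ (by positivity)
    rw [hd]
    calc _ ≤ M' ^ 2 * (2 * Real.sinh (r / 2)) ^ 2 := by gcongr
      _ = (M' * (2 * Real.sinh (r / 2))) ^ 2 := by ring
      _ ≤ (M * r) ^ 2 := by gcongr

/-! ### Square-integrable functions on a union of two arcs. -/

/-- A parametrized arc `p` whose speed is `w ^ 2`. -/
structure IsArc {X : Type*} [MeasurableSpace X] (p : ℝ → X) (w : ℝ → ℝ) : Prop where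
  emb : MeasurableEmbedding p
  cont : Continuous w
  pos : ∀ t, 0 < w t

/-- The arc length measure on a parametrized arc. -/
noncomputable def arcMeasure {X : Type*} [MeasurableSpace X] (p : ℝ → X) (w : ℝ → ℝ) : Measure X :=
  Measure.map p (volume.withDensity fun t => ENNReal.ofReal (w t ^ 2))

section

variable {X : Type*} [MeasurableSpace X] {p q : ℝ → X} {w w' : ℝ → ℝ} {μ : Measure X}

theorem IsArc.measurable_density (h : IsArc p w) : Measurable fun t => ENNReal.ofReal (w t ^ 2) :=
  (h.cont.pow 2).measurable.ennreal_ofReal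

theorem IsArc.lintegral_eq (h : IsArc p w) (g : X → ENNReal) :
    ∫⁻ x, g x ∂(arcMeasure p w) = ∫⁻ t, ENNReal.ofReal (w t ^ 2) * g (p t) := by
  rw [arcMeasure, h.emb.lintegral_map, lintegral_withDensity_eq_lintegral_mul_non_measurable _
    h.measurable_density (Eventually.of_forall fun t => ENNReal.ofReal_lt_top)]
  rfl

theorem IsArc.ae_iff (h : IsArc p w) {P : X → Prop} :
    (∀ᵐ x ∂(arcMeasure p w), P x) ↔ ∀ᵐ t, P (p t) := by
  rw [arcMeasure, h.emb.ae_map_iff, ae_withDensity_iff h.measurable_density]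
  refine eventually_congr (Eventually.of_forall fun t => ?_)
  have : ENNReal.ofReal (w t ^ 2) ≠ 0 := by
    rw [ne_eq, ENNReal.ofReal_eq_zero, not_le]
    exact pow_pos (h.pos t) 2
  simp [this]

theorem IsArc.integrable_iff (h : IsArc p w) {E : Type*} [NormedAddCommGroup E] [NormedSpace ℝ E]
    (g : X → E) : Integrable g (arcMeasure p w) ↔ Integrable fun t => w t ^ 2 • g (p t) := by
  rw [arcMeasure, h.emb.integrable_map_iff, integrable_withDensity_iff_integrable_smul'
    h.measurable_density (Eventually.of_forall fun t => ENNReal.ofReal_lt_top)]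
  simp only [ENNReal.toReal_ofReal (sq_nonneg _), Function.comp_apply]

theorem IsArc.integral_eq (h : IsArc p w) {E : Type*} [NormedAddCommGroup E] [NormedSpace ℝ E]
    (g : X → E) : ∫ x, g x ∂(arcMeasure p w) = ∫ t, w t ^ 2 • g (p t) := by
  rw [arcMeasure, h.emb.integral_map, integral_withDensity_eq_integral_toReal_smul
    h.measurable_density (Eventually.of_forall fun t => ENNReal.ofReal_lt_top)]
  simp only [ENNReal.toReal_ofReal (sq_nonneg _)]

theorem IsArc.quasiMeasurePreserving (h : IsArc p w) (hle : arcMeasure p w ≤ μ) :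
    Measure.QuasiMeasurePreserving p volume μ := by
  refine ⟨h.emb.measurable, ?_⟩
  refine Measure.AbsolutelyContinuous.trans ?_ (Measure.absolutelyContinuous_of_le hle)
  refine Measure.AbsolutelyContinuous.map ?_ h.emb.measurable
  refine withDensity_absolutelyContinuous' h.measurable_density.aemeasurable
    (Eventually.of_forall fun t => ?_)
  rw [ne_eq, ENNReal.ofReal_eq_zero, not_le]
  exact pow_pos (h.pos t) 2

theorem IsArc.lintegral_enorm_sq (h : IsArc p w) (u : X → ℂ) :
    ∫⁻ x, ‖u x‖ₑ ^ 2 ∂(arcMeasure p w) = ∫⁻ t, ‖(w t : ℂ) * u (p t)‖ₑ ^ 2 := by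
  rw [h.lintegral_eq]
  refine lintegral_congr fun t => ?_
  rw [enorm_mul, mul_pow, ENNReal.ofReal_pow (h.pos t).le, ← ofReal_norm (w t : ℂ),
    Complex.norm_real, Real.norm_of_nonneg (h.pos t).le]

theorem memLp_two_iff_lintegral {α : Type*} {m : MeasurableSpace α} {ν : Measure α} {f : α → ℂ} :
    MemLp f 2 ν ↔ AEStronglyMeasurable f ν ∧ ∫⁻ x, ‖f x‖ₑ ^ 2 ∂ν < ⊤ := by
  rw [MemLp, eLpNorm_lt_top_iff_lintegral_rpow_enorm_lt_top (by norm_num) (by norm_num)]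
  simp

theorem IsArc.memLp (h : IsArc p w) (hle : arcMeasure p w ≤ μ) {u : X → ℂ} (hu : MemLp u 2 μ) :
    MemLp (fun t => (w t : ℂ) * u (p t)) 2 := by
  have hu' := memLp_two_iff_lintegral.1 hu
  refine memLp_two_iff_lintegral.2
    ⟨(Complex.continuous_ofReal.comp h.cont).aestronglyMeasurable.mul
      (hu.1.comp_quasiMeasurePreserving (h.quasiMeasurePreserving hle)), ?_⟩
  rw [← h.lintegral_enorm_sq]
  exact (lintegral_mono' hle le_rfl).trans_lt hu'.2

/-- The coordinate of a square-integrable function along an arc. -/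
noncomputable def IsArc.coord (h : IsArc p w) (hle : arcMeasure p w ≤ μ) :
    Lp ℂ 2 μ →L[ℂ] Lp ℂ 2 (volume : Measure ℝ) :=
  LinearMap.mkContinuous
    { toFun := fun u => (h.memLp hle (Lp.memLp u)).toLp _
      map_add' := fun u v => by
        rw [← MemLp.toLp_add]
        refine MemLp.toLp_congr _ _ ?_
        filter_upwards [(h.quasiMeasurePreserving hle).ae (Lp.coeFn_add u v)] with t ht
        rw [ht, Pi.add_apply, Pi.add_apply]
        ring
      map_smul' := fun c u => by
        rw [RingHom.id_apply, ← MemLp.toLp_const_smul]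
        refine MemLp.toLp_congr _ _ ?_
        filter_upwards [(h.quasiMeasurePreserving hle).ae (Lp.coeFn_smul c u)] with t ht
        rw [ht, Pi.smul_apply, Pi.smul_apply, smul_eq_mul, smul_eq_mul]
        ring } 1 fun u => by
    rw [one_mul]
    refine le_of_sq_le_sq ?_ (norm_nonneg _)
    have h1 := h.memLp hle (Lp.memLp u)
    have h2 : ∫⁻ t, ‖(w t : ℂ) * u (p t)‖ₑ ^ 2 ≤ ∫⁻ x, ‖u x‖ₑ ^ 2 ∂μ := by
      rw [← h.lintegral_enorm_sq]
      exact lintegral_mono' hle le_rfl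
    rw [lintegral_enorm_sq_eq h1, lintegral_enorm_sq_eq (Lp.memLp u),
      ENNReal.ofReal_le_ofReal_iff (integral_nonneg fun x => by positivity)] at h2
    rw [norm_sq_eq_integral, norm_sq_eq_integral]
    refine le_trans (le_of_eq ?_) h2
    exact integral_congr_ae (h1.coeFn_toLp.mono fun t ht => congrArg (fun z : ℂ => ‖z‖ ^ 2) ht)

theorem IsArc.coeFn_coord (h : IsArc p w) (hle : arcMeasure p w ≤ μ) (u : Lp ℂ 2 μ) :
    h.coord hle u =ᵐ[volume] fun t => (w t : ℂ) * u (p t) :=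
  (h.memLp hle (Lp.memLp u)).coeFn_toLp

/-- A measure that is the sum of the arc length measures of two disjoint arcs. -/
structure IsArcPair (μ : Measure X) (p : ℝ → X) (w : ℝ → ℝ) (q : ℝ → X) (w' : ℝ → ℝ) : Prop where
  fst : IsArc p w
  snd : IsArc q w'
  eq_add : μ = arcMeasure p w + arcMeasure q w'
  ne : ∀ t s, p t ≠ q s

namespace IsArcPair

theorem swap (h : IsArcPair μ p w q w') : IsArcPair μ q w' p w :=
  ⟨h.snd, h.fst, by rw [add_comm, ← h.eq_add], fun t s => (h.ne s t).symm⟩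

theorem fst_le (h : IsArcPair μ p w q w') : arcMeasure p w ≤ μ := by
  rw [h.eq_add]
  exact Measure.le_add_right le_rfl

/-- The coordinate along the first arc. -/
noncomputable def coord (h : IsArcPair μ p w q w') :
    Lp ℂ 2 μ →L[ℂ] Lp ℂ 2 (volume : Measure ℝ) := h.fst.coord h.fst_le

theorem coeFn_coord (h : IsArcPair μ p w q w') (u : Lp ℂ 2 μ) :
    h.coord u =ᵐ[volume] fun t => (w t : ℂ) * u (p t) := h.fst.coeFn_coord h.fst_le u

theorem ae_iff (h : IsArcPair μ p w q w') {P : X → Prop} :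
    (∀ᵐ x ∂μ, P x) ↔ (∀ᵐ t, P (p t)) ∧ ∀ᵐ t, P (q t) := by
  rw [h.eq_add, ae_add_measure_iff, h.fst.ae_iff, h.snd.ae_iff]

/-- The density $w^2$ gives one factor $w$ to each coordinate, and the measure is the sum of the two
arc measures; the coordinates therefore split $\mathrm L^2(\mu)$ isometrically. -/
theorem inner_eq (h : IsArcPair μ p w q w') (u v : Lp ℂ 2 μ) :
    inner ℂ u v =
      (inner ℂ (h.coord u) (h.coord v) + inner ℂ (h.swap.coord u) (h.swap.coord v) : ℂ) := by
  have key : ∀ {p : ℝ → X} {w : ℝ → ℝ} {q : ℝ → X} {w' : ℝ → ℝ} (h : IsArcPair μ p w q w'),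
      Integrable (fun x => (inner ℂ (u x) (v x) : ℂ)) (arcMeasure p w) ∧
      (inner ℂ (h.coord u) (h.coord v) : ℂ) = ∫ x, inner ℂ (u x) (v x) ∂(arcMeasure p w) := by
    intro p w q w' h
    refine ⟨(L2.integrable_inner u v).mono_measure h.fst_le, ?_⟩
    rw [L2.inner_def, h.fst.integral_eq]
    refine integral_congr_ae ?_
    filter_upwards [h.coeFn_coord u, h.coeFn_coord v] with t h1 h2
    rw [h1, h2]
    simp only [RCLike.inner_apply, map_mul, Complex.conj_ofReal, Complex.real_smul]
    push_cast
    ring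
  rw [(key h).2, (key h.swap).2, L2.inner_def, ← integral_add_measure (key h).1 (key h.swap).1,
    ← h.eq_add]

theorem exists_coord_eq (h : IsArcPair μ p w q w') (f : Lp ℂ 2 (volume : Measure ℝ)) :
    ∃ u : Lp ℂ 2 μ, h.coord u = f ∧ h.swap.coord u = 0 := by
  set u₀ : X → ℂ := Function.extend p (fun t => f t / w t) 0 with hu₀
  have hup : ∀ t, u₀ (p t) = f t / w t := fun t => h.fst.emb.injective.extend_apply _ _ t
  have huq : ∀ t, u₀ (q t) = 0 := fun t =>
    Function.extend_apply' _ _ _ (by rintro ⟨s, hs⟩; exact h.ne s t hs)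
  have hw : ∀ t, (w t : ℂ) ≠ 0 := fun t => Complex.ofReal_ne_zero.2 (h.fst.pos t).ne'
  have hmem : MemLp u₀ 2 μ := by
    refine memLp_two_iff_lintegral.2 ⟨?_, ?_⟩
    · refine Measurable.aestronglyMeasurable (h.fst.emb.measurable_extend ?_ measurable_zero)
      exact (Lp.stronglyMeasurable f).measurable.div
        (Complex.measurable_ofReal.comp h.fst.cont.measurable)
    · rw [h.eq_add, lintegral_add_measure, h.fst.lintegral_enorm_sq, h.snd.lintegral_enorm_sq]
      simp only [hup, huq, mul_zero, enorm_zero, mul_div_cancel₀ _ (hw _)]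
      simpa using (memLp_two_iff_lintegral.1 (Lp.memLp f)).2
  have hae := h.ae_iff.1 hmem.coeFn_toLp
  refine ⟨hmem.toLp _, Lp.ext ?_, Lp.ext ?_⟩
  · filter_upwards [h.coeFn_coord (hmem.toLp _), hae.1] with t h1 h2
    rw [h1, h2, hup, mul_div_cancel₀ _ (hw _)]
  · filter_upwards [h.swap.coeFn_coord (hmem.toLp _), hae.2, Lp.coeFn_zero ℂ 2 volume]
      with t h1 h2 h3
    rw [h1, h2, huq, h3, mul_zero, Pi.zero_apply]

/-- The adjoint of the coordinate map is division by $w$ followed by extension by zero off the arc: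
the function from `exists_coord_eq` satisfies its defining identity by `inner_eq`. -/
theorem coord_adjoint_coord (h : IsArcPair μ p w q w') (f : Lp ℂ 2 (volume : Measure ℝ)) :
    h.coord (ContinuousLinearMap.adjoint h.coord f) = f ∧
      h.swap.coord (ContinuousLinearMap.adjoint h.coord f) = 0 := by
  obtain ⟨u, hu, hu'⟩ := h.exists_coord_eq f
  have : ContinuousLinearMap.adjoint h.coord f = u := by
    refine ext_inner_right ℂ fun v => ?_
    rw [ContinuousLinearMap.adjoint_inner_left, h.inner_eq, hu, hu', inner_zero_left, add_zero]
  rw [this]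
  exact ⟨hu, hu'⟩

theorem norm_sq_eq (h : IsArcPair μ p w q w') (u : Lp ℂ 2 μ) :
    ‖u‖ ^ 2 = ‖h.coord u‖ ^ 2 + ‖h.swap.coord u‖ ^ 2 := by
  have := h.inner_eq u u
  simp only [inner_self_eq_norm_sq_to_K] at this
  refine Complex.ofReal_injective ?_
  push_cast
  exact this

theorem integral_eq (h : IsArcPair μ p w q w') {E : Type*} [NormedAddCommGroup E]
    [NormedSpace ℝ E] (g : X → E) (hp : Integrable fun t => w t ^ 2 • g (p t))
    (hq : Integrable fun t => w' t ^ 2 • g (q t)) :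
    ∫ x, g x ∂μ = (∫ t, w t ^ 2 • g (p t)) + ∫ t, w' t ^ 2 • g (q t) := by
  rw [h.eq_add, integral_add_measure ((h.fst.integrable_iff g).2 hp)
    ((h.snd.integrable_iff g).2 hq), h.fst.integral_eq, h.snd.integral_eq]

/-- The coordinates along both arcs, as a linear bijection. -/
noncomputable def coordEquiv (h : IsArcPair μ p w q w') :
    Lp ℂ 2 μ ≃ₗ[ℂ] Lp ℂ 2 (volume : Measure ℝ) × Lp ℂ 2 (volume : Measure ℝ) :=
  LinearEquiv.ofBijective (h.coord.toLinearMap.prod h.swap.coord.toLinearMap) (by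
    refine ⟨(injective_iff_map_eq_zero _).2 fun u hu => ?_, fun f => ?_⟩
    · have h1 : h.coord u = 0 := congrArg Prod.fst hu
      have h2 : h.swap.coord u = 0 := congrArg Prod.snd hu
      have := h.norm_sq_eq u
      rw [h1, h2] at this
      simpa using this
    · have h1 := h.coord_adjoint_coord f.1
      have h2 := h.swap.coord_adjoint_coord f.2
      refine ⟨ContinuousLinearMap.adjoint h.coord f.1 +
        ContinuousLinearMap.adjoint h.swap.coord f.2, Prod.ext ?_ ?_⟩
      · change h.coord _ = f.1
        rw [map_add, h1.1, h2.2, add_zero]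
      · change h.swap.coord _ = f.2
        rw [map_add, h1.2, h2.1, zero_add])

end IsArcPair

end

/-! ### Dirichlet-to-Dirichlet maps in arc coordinates. -/

/-- The square root of the metric speed `a / (cosh t - cos σ)` of a bipolar arc. -/
noncomputable def arcWeight (a σ t : ℝ) : ℝ := √a * (bipolarWeight σ t)⁻¹

theorem arcWeight_sq {a σ : ℝ} (ha : 0 < a) (hσ : Real.sin σ ≠ 0) (t : ℝ) :
    arcWeight a σ t ^ 2 = a / (Real.cosh t - Real.cos σ) := by
  rw [arcWeight, mul_pow, Real.sq_sqrt ha.le, inv_pow, bipolarWeight_sq hσ, div_eq_mul_inv]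

theorem ExpKernel.adjoint_op {k : ℝ → ℝ → ℝ} (hk : ExpKernel k) :
    ContinuousLinearMap.adjoint hk.op = hk.swap.op := by
  refine ContinuousLinearMap.ext fun f => ext_inner_right ℂ fun g => ?_
  rw [ContinuousLinearMap.adjoint_inner_left]
  exact (hk.swap.inner_op f g).symm

/-- The source weight cancels, as $w_\sigma(s)$ times the arc weight is $\sqrt a$, and $\sqrt
a/w_\alpha(t)$ is the arc weight of the target. So the kernel acts as the strip Poisson integral
written in target coordinates. -/
theorem bipolarKernel_op_eq {X : Type*} [MeasurableSpace X] {p : ℝ → X} {a σ α φ : ℝ}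
    (hσ : Real.sin σ ≠ 0) {f : Lp ℂ 2 (volume : Measure ℝ)}
    {g : X → ℂ} (hf : f =ᵐ[volume] fun s => (arcWeight a σ s : ℂ) * g (p s)) (t : ℝ) :
    (fun s => (bipolarKernel φ α σ t s : ℂ) * f s) =ᵐ[volume]
      fun s => (arcWeight a α t : ℂ) * ((stripPoisson φ (t - s) : ℂ) * g (p s)) := by
  filter_upwards [hf] with s hs
  have h1 : (bipolarWeight σ s : ℂ) ≠ 0 := Complex.ofReal_ne_zero.2 (bipolarWeight_pos hσ s).ne'
  rw [hs]
  simp only [bipolarKernel, arcWeight]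
  push_cast
  field_simp

/-- The Dirichlet-to-Dirichlet map between two circles made of bipolar arcs. -/
theorem exists_isDtD {c d : Plane} {r ρ a σ τ α φ ψ : ℝ} {p q p' q' : ℝ → Plane} {w : ℝ → ℝ}
    (hσ : Real.sin σ ≠ 0) (hτ : Real.sin τ ≠ 0) (hα : Real.sin α ≠ 0)
    (hφ : φ ∈ Ioo 0 Real.pi) (hψ : ψ ∈ Ioo 0 Real.pi)
    (h : IsArcPair (circleMeasure c r) p (arcWeight a σ) q (arcWeight a τ))
    (h' : IsArcPair (circleMeasure d ρ) p' (arcWeight a α) q' w)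
    (hin : ∀ t, p' t ∈ Metric.ball c r) (hout : ∀ t, q' t ∉ Metric.ball c r)
    (hp : ∀ t s, arcWeight a σ s ^ 2 * ((r ^ 2 - ‖p' t - c‖ ^ 2) / (r * ‖p' t - p s‖ ^ 2)) =
      2 * Real.pi * stripPoisson φ (t - s))
    (hq : ∀ t s, arcWeight a τ s ^ 2 * ((r ^ 2 - ‖p' t - c‖ ^ 2) / (r * ‖p' t - q s‖ ^ 2)) =
      2 * Real.pi * stripPoisson ψ (t - s)) :
    ∃ γ : L2Circle c r →L[ℂ] L2Circle d ρ, IsDtD c r d ρ γ ∧ ∀ u,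
      h.coord (ContinuousLinearMap.adjoint γ u) =
        (expKernel_bipolarKernel hφ hα hσ).swap.op (h'.coord u) ∧
      h.swap.coord (ContinuousLinearMap.adjoint γ u) =
        (expKernel_bipolarKernel hψ hα hτ).swap.op (h'.coord u) := by
  set K := expKernel_bipolarKernel hφ hα hσ
  set L := expKernel_bipolarKernel hψ hα hτ
  -- The adjoint of the target coordinate performs the extension by zero to the arc outside the
  -- disk; the two operators are the Poisson contributions of the two source arcs.
  refine ⟨ContinuousLinearMap.adjoint h'.coord ∘L (K.op ∘L h.coord + L.op ∘L h.swap.coord),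
    fun g => h'.ae_iff.2 ⟨?_, ?_⟩, fun u => ?_⟩
  · have hF := h'.coord_adjoint_coord (K.op (h.coord g) + L.op (h.swap.coord g))
    have e := h'.coeFn_coord (ContinuousLinearMap.adjoint h'.coord
      (K.op (h.coord g) + L.op (h.swap.coord g)))
    rw [hF.1] at e
    filter_upwards [e, Lp.coeFn_add (K.op (h.coord g)) (L.op (h.swap.coord g)),
      K.coeFn_op (h.coord g), L.coeFn_op (h.swap.coord g)] with t h1 h2 h3 h4
    have hw : (arcWeight a α t : ℂ) ≠ 0 := Complex.ofReal_ne_zero.2 (h'.fst.pos t).ne'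
    have eK := bipolarKernel_op_eq (a := a) (α := α) (φ := φ) hσ (h.coeFn_coord g) t
    have eL := bipolarKernel_op_eq (a := a) (α := α) (φ := ψ) hτ (h.swap.coeFn_coord g) t
    have iK : Integrable fun s => (stripPoisson φ (t - s) : ℂ) * g (p s) := by
      have := ((K.integrable (Lp.memLp (h.coord g)) t).congr eK).const_mul
        (arcWeight a α t : ℂ)⁻¹
      simpa only [inv_mul_cancel_left₀ hw] using this
    have iL : Integrable fun s => (stripPoisson ψ (t - s) : ℂ) * g (q s) := by
      have := ((L.integrable (Lp.memLp (h.swap.coord g)) t).congr eL).const_mul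
        (arcWeight a α t : ℂ)⁻¹
      simpa only [inv_mul_cancel_left₀ hw] using this
    rw [h1, Pi.add_apply, h3, h4, integral_congr_ae eK, integral_congr_ae eL, integral_const_mul,
      integral_const_mul, ← mul_add] at h2
    have h5 := mul_left_cancel₀ hw h2
    rw [indicator_of_mem (hin t)]
    refine Eq.trans h5 ?_
    have hsm : ∀ (x y : ℝ) (z : ℂ), x • y • z = ((x * y : ℝ) : ℂ) * z := fun x y z => by
      rw [smul_smul, Complex.real_smul]
    have e1 : (fun s => arcWeight a σ s ^ 2 • ((r ^ 2 - ‖p' t - c‖ ^ 2) /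
        (r * ‖p' t - p s‖ ^ 2)) • g (p s)) =
        fun s => ((2 * Real.pi : ℝ) : ℂ) * ((stripPoisson φ (t - s) : ℂ) * g (p s)) := by
      funext s
      rw [hsm, hp, Complex.ofReal_mul, mul_assoc]
    have e2 : (fun s => arcWeight a τ s ^ 2 • ((r ^ 2 - ‖p' t - c‖ ^ 2) /
        (r * ‖p' t - q s‖ ^ 2)) • g (q s)) =
        fun s => ((2 * Real.pi : ℝ) : ℂ) * ((stripPoisson ψ (t - s) : ℂ) * g (q s)) := by
      funext s
      rw [hsm, hq, Complex.ofReal_mul, mul_assoc]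
    rw [diskPoisson, h.integral_eq _ (by rw [e1]; exact iK.const_mul _)
      (by rw [e2]; exact iL.const_mul _), e1, e2, integral_const_mul, integral_const_mul,
      ← mul_add, Complex.real_smul, ← mul_assoc, ← Complex.ofReal_mul, one_div,
      inv_mul_cancel₀ (by positivity), Complex.ofReal_one, one_mul]
  · have hF := h'.coord_adjoint_coord (K.op (h.coord g) + L.op (h.swap.coord g))
    have e := h'.swap.coeFn_coord (ContinuousLinearMap.adjoint h'.coord
      (K.op (h.coord g) + L.op (h.swap.coord g)))
    rw [hF.2] at e
    filter_upwards [e, Lp.coeFn_zero ℂ 2 volume] with t h1 h2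
    rw [indicator_of_notMem (hout t)]
    rw [h2, Pi.zero_apply] at h1
    exact (mul_eq_zero.1 h1.symm).resolve_left
      (Complex.ofReal_ne_zero.2 (h'.snd.pos t).ne')
  · have e : ContinuousLinearMap.adjoint (ContinuousLinearMap.adjoint h'.coord ∘L
        (K.op ∘L h.coord + L.op ∘L h.swap.coord)) u =
        ContinuousLinearMap.adjoint h.coord (K.swap.op (h'.coord u)) +
        ContinuousLinearMap.adjoint h.swap.coord (L.swap.op (h'.coord u)) := by
      rw [ContinuousLinearMap.adjoint_comp, ContinuousLinearMap.adjoint_adjoint, map_add,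
        ContinuousLinearMap.adjoint_comp, ContinuousLinearMap.adjoint_comp, K.adjoint_op,
        L.adjoint_op]
      rfl
    have h1 := h.coord_adjoint_coord (K.swap.op (h'.coord u))
    have h2 := h.swap.coord_adjoint_coord (L.swap.op (h'.coord u))
    rw [e, map_add, map_add, h1.1, h1.2, h2.1]
    exact ⟨by rw [show h.coord _ = 0 from h2.2, add_zero], zero_add _⟩

/-! ### Bipolar coordinates in the plane. -/

/-- The point with coordinates `(x, y)` in the orthonormal frame at `o` whose second vector
is `v`. -/
noncomputable def framePoint (o v : Plane) (x y : ℝ) : Plane := o + x • !₂[-v 1, v 0] + y • v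

theorem norm_framePoint_sub_sq {v : Plane} (hv : ‖v‖ = 1) (o : Plane) (x y x' y' : ℝ) :
    ‖framePoint o v x y - framePoint o v x' y'‖ ^ 2 = (x - x') ^ 2 + (y - y') ^ 2 := by
  have hv' : v 0 ^ 2 + v 1 ^ 2 = 1 := by
    have := EuclideanSpace.real_norm_sq_eq v
    rw [hv, Fin.sum_univ_two] at this
    linarith
  rw [EuclideanSpace.real_norm_sq_eq, Fin.sum_univ_two]
  simp only [framePoint, PiLp.sub_apply, PiLp.add_apply, PiLp.smul_apply, smul_eq_mul,
    Matrix.cons_val_zero, Matrix.cons_val_one]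
  linear_combination ((x - x') ^ 2 + (y - y') ^ 2) * hv'

theorem exists_eq_framePoint {v : Plane} (hv : ‖v‖ = 1) (o z : Plane) :
    ∃ x y, z = framePoint o v x y := by
  have hv' : v 0 ^ 2 + v 1 ^ 2 = 1 := by
    have := EuclideanSpace.real_norm_sq_eq v
    rw [hv, Fin.sum_univ_two] at this
    linarith
  refine ⟨(z 1 - o 1) * v 0 - (z 0 - o 0) * v 1, (z 0 - o 0) * v 0 + (z 1 - o 1) * v 1, ?_⟩
  ext i
  fin_cases i
  · simp [framePoint]
    linear_combination -(z 0 - o 0) * hv'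
  · simp [framePoint]
    linear_combination -(z 1 - o 1) * hv'

/-- Bipolar coordinates with foci at distance `a` from the centre `o` of the frame. -/
noncomputable def bipolarPoint (o v : Plane) (a σ t : ℝ) : Plane :=
  framePoint o v (a * Real.sinh t / (Real.cosh t - Real.cos σ))
    (a * Real.sin σ / (Real.cosh t - Real.cos σ))

/-- The centre of the circle made of the bipolar arcs with angles `σ` and `σ + π`. -/
noncomputable def bipolarCenter (o v : Plane) (a σ : ℝ) : Plane :=
  framePoint o v 0 (a * Real.cos σ / Real.sin σ)

section

variable {o v : Plane} {a σ : ℝ}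

theorem continuous_bipolarPoint (o v : Plane) (a : ℝ) (hσ : Real.sin σ ≠ 0) :
    Continuous (bipolarPoint o v a σ) := by
  have h : ∀ t, Real.cosh t - Real.cos σ ≠ 0 := fun t => (cosh_sub_cos_pos hσ t).ne'
  have h1 : Continuous fun t => a * Real.sinh t / (Real.cosh t - Real.cos σ) :=
    Continuous.div (by fun_prop) (by fun_prop) h
  have h2 : Continuous fun t => a * Real.sin σ / (Real.cosh t - Real.cos σ) :=
    Continuous.div (by fun_prop) (by fun_prop) h
  exact (continuous_const.add (h1.smul continuous_const)).add (h2.smul continuous_const)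

/-- A polynomial identity modulo $\cosh^2-\sinh^2=1$ and $\sin^2+\cos^2=1$. For equal angles it
yields injectivity and the metric speed; for different angles it is the denominator of the Poisson
kernel. -/
theorem norm_bipolarPoint_sub_sq (hv : ‖v‖ = 1) {τ : ℝ} (hσ : Real.sin σ ≠ 0)
    (hτ : Real.sin τ ≠ 0) (t s : ℝ) :
    ‖bipolarPoint o v a σ t - bipolarPoint o v a τ s‖ ^ 2 =
      2 * a ^ 2 * (Real.cosh (t - s) - Real.cos (σ - τ)) /
        ((Real.cosh t - Real.cos σ) * (Real.cosh s - Real.cos τ)) := by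
  have h1 := (cosh_sub_cos_pos hσ t).ne'
  have h2 := (cosh_sub_cos_pos hτ s).ne'
  rw [bipolarPoint, bipolarPoint, norm_framePoint_sub_sq hv, Real.cosh_sub, Real.cos_sub]
  have e1 := Real.cosh_sq_sub_sinh_sq t
  have e2 := Real.cosh_sq_sub_sinh_sq s
  have e3 := Real.sin_sq_add_cos_sq σ
  have e4 := Real.sin_sq_add_cos_sq τ
  generalize Real.cosh t = C at *
  generalize Real.cosh s = C' at *
  generalize Real.sinh t = S at *
  generalize Real.sinh s = S' at *
  generalize Real.cos σ = c at *
  generalize Real.cos τ = c' at *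
  generalize Real.sin σ = d at *
  generalize Real.sin τ = d' at *
  field_simp
  linear_combination a ^ 2 * (-(C' - c') ^ 2 * e1 - (C - c) ^ 2 * e2 + (C' - c') ^ 2 * e3 +
    (C - c) ^ 2 * e4)

/-- The power of a bipolar point with respect to a bipolar circle. -/
theorem sq_sub_norm_bipolarPoint_sub_center_sq (hv : ‖v‖ = 1) {α : ℝ} (hσ : Real.sin σ ≠ 0)
    (hα : Real.sin α ≠ 0) (t : ℝ) :
    (a / Real.sin σ) ^ 2 - ‖bipolarPoint o v a α t - bipolarCenter o v a σ‖ ^ 2 =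
      2 * a ^ 2 * Real.sin (α - σ) / (Real.sin σ * (Real.cosh t - Real.cos α)) := by
  have h1 := (cosh_sub_cos_pos hα t).ne'
  rw [bipolarPoint, bipolarCenter, norm_framePoint_sub_sq hv, Real.sin_sub]
  have e1 := Real.cosh_sq_sub_sinh_sq t
  have e3 := Real.sin_sq_add_cos_sq σ
  have e4 := Real.sin_sq_add_cos_sq α
  generalize Real.cosh t = C at *
  generalize Real.sinh t = S at *
  generalize Real.cos σ = c at *
  generalize Real.cos α = c' at *
  generalize Real.sin σ = d at *
  generalize Real.sin α = d' at *
  field_simp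
  linear_combination a ^ 2 * (-(C - c') ^ 2 * e3 + d ^ 2 * e1 - d ^ 2 * e4)

theorem bipolarPoint_mem_ball_iff (hv : ‖v‖ = 1) {α : ℝ} (ha : 0 < a) (hσ : 0 < Real.sin σ)
    (hα : Real.sin α ≠ 0) (t : ℝ) :
    bipolarPoint o v a α t ∈ Metric.ball (bipolarCenter o v a σ) (a / Real.sin σ) ↔
      0 < Real.sin (α - σ) := by
  have h := sq_sub_norm_bipolarPoint_sub_center_sq (o := o) (a := a) hv hσ.ne' hα t
  have h1 := mul_pos hσ (cosh_sub_cos_pos hα t)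
  rw [mem_ball_iff_norm, ← sq_lt_sq₀ (norm_nonneg _) (by positivity), ← sub_pos, h,
    div_pos_iff_of_pos_right h1, mul_pos_iff_of_pos_left (by positivity)]

theorem bipolarPoint_mem_sphere_iff (hv : ‖v‖ = 1) {α : ℝ} (ha : 0 < a) (hσ : 0 < Real.sin σ)
    (hα : Real.sin α ≠ 0) (t : ℝ) :
    bipolarPoint o v a α t ∈ Metric.sphere (bipolarCenter o v a σ) (a / Real.sin σ) ↔
      Real.sin (α - σ) = 0 := by
  have h := sq_sub_norm_bipolarPoint_sub_center_sq (o := o) (a := a) hv hσ.ne' hα t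
  have h1 := (mul_pos hσ (cosh_sub_cos_pos hα t)).ne'
  rw [mem_sphere_iff_norm, ← sq_eq_sq₀ (norm_nonneg _) (by positivity), eq_comm, ← sub_eq_zero, h]
  simp [h1, ha.ne']

/-- The bipolar parametrization covers the part of a circle on one side of the axis. -/
theorem exists_framePoint_eq_bipolarPoint (ha : 0 < a) (hσ : Real.sin σ ≠ 0) {x y : ℝ}
    (hy : 0 < y * Real.sin σ)
    (h : x ^ 2 + (y - a * Real.cos σ / Real.sin σ) ^ 2 = (a / Real.sin σ) ^ 2) :
    ∃ t, framePoint o v x y = bipolarPoint o v a σ t := by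
  have hy0 : y ≠ 0 := by rintro rfl; simp at hy
  have hk : 0 < a * Real.sin σ / y := by
    rw [show a * Real.sin σ / y = a * (y * Real.sin σ) / y ^ 2 by field_simp]
    positivity
  -- A bipolar point satisfies $\sinh t=x\sin\sigma/y$ and $\cosh t=\cos\sigma+a\sin\sigma/y$. The
  -- equation of the circle is precisely $\cosh^2=1+\sinh^2$ for these quantities, so
  -- $t=\mathrm{arsinh}(x\sin\sigma/y)$ works.
  have hsq : (Real.cos σ + a * Real.sin σ / y) ^ 2 = 1 + (x * Real.sin σ / y) ^ 2 := by
    field_simp at h ⊢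
    linear_combination (-1) * h + (a ^ 2 + y ^ 2) * Real.sin_sq_add_cos_sq σ
  have hpos : 0 ≤ Real.cos σ + a * Real.sin σ / y := by
    by_contra! hneg
    have h1 := Real.neg_one_le_cos σ
    nlinarith [sq_nonneg (x * Real.sin σ / y)]
  have hcosh : Real.cosh (Real.arsinh (x * Real.sin σ / y)) =
      Real.cos σ + a * Real.sin σ / y := by
    rw [Real.cosh_arsinh, ← hsq, Real.sqrt_sq hpos]
  refine ⟨Real.arsinh (x * Real.sin σ / y), ?_⟩
  rw [bipolarPoint, hcosh, Real.sinh_arsinh, add_sub_cancel_left]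
  congr 1 <;> field_simp

/-- The sign of $y$ decides which arc a point belongs to. Only the two foci, where $y=0$, are
missed, and points are null for one-dimensional Hausdorff measure. -/
theorem sphere_ae_eq_union_range (hv : ‖v‖ = 1) (ha : 0 < a) (hσ : 0 < Real.sin σ) :
    Metric.sphere (bipolarCenter o v a σ) (a / Real.sin σ) =ᵐ[(μH[1] : Measure Plane)]
      (range (bipolarPoint o v a σ) ∪ range (bipolarPoint o v a (σ + Real.pi)) : Set Plane) := by
  have hσ' : Real.sin (σ + Real.pi) ≠ 0 := by
    rw [Real.sin_add_pi]
    exact neg_ne_zero.2 hσ.ne'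
  have := Measure.nullSingletonClass_hausdorff Plane one_pos
  refine ae_eq_set.2 ⟨measure_mono_null (t := {framePoint o v a 0, framePoint o v (-a) 0}) ?_
    (Set.Finite.measure_zero (by simp) _), measure_mono_null (t := ∅) ?_ measure_empty⟩
  · rintro z ⟨hz, hz'⟩
    obtain ⟨x, y, rfl⟩ := exists_eq_framePoint hv o z
    rw [mem_sphere_iff_norm, ← sq_eq_sq₀ (norm_nonneg _) (by positivity), bipolarCenter,
      norm_framePoint_sub_sq hv, sub_zero] at hz
    rw [mem_union, not_or] at hz'
    rcases lt_trichotomy y 0 with hy | hy | hy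
    · refine absurd ?_ hz'.2
      obtain ⟨t, ht⟩ := exists_framePoint_eq_bipolarPoint (o := o) (v := v) (x := x) (y := y) ha hσ'
        (by rw [Real.sin_add_pi]; nlinarith)
        (by rw [Real.sin_add_pi, Real.cos_add_pi, mul_neg, neg_div_neg_eq, div_neg, neg_sq]
            exact hz)
      exact ⟨t, ht.symm⟩
    · subst hy
      have h1 : x ^ 2 = a ^ 2 := by
        field_simp at hz
        have h2 : Real.sin σ ^ 2 * (x ^ 2 - a ^ 2) = 0 := by
          linear_combination hz - a ^ 2 * Real.sin_sq_add_cos_sq σ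
        linarith [(mul_eq_zero.1 h2).resolve_left (pow_pos hσ 2).ne']
      rcases sq_eq_sq_iff_eq_or_eq_neg.1 h1 with rfl | rfl <;> simp
    · refine absurd ?_ hz'.1
      obtain ⟨t, ht⟩ := exists_framePoint_eq_bipolarPoint (o := o) (v := v) ha hσ.ne'
        (mul_pos hy hσ) hz
      exact ⟨t, ht.symm⟩
  · rintro z ⟨⟨t, rfl⟩ | ⟨t, rfl⟩, hz⟩
    · exact hz ((bipolarPoint_mem_sphere_iff hv ha hσ hσ.ne' t).2 (by simp))
    · exact hz ((bipolarPoint_mem_sphere_iff hv ha hσ hσ' t).2 (by simp))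

theorem injective_bipolarPoint (hv : ‖v‖ = 1) (ha : 0 < a) (hσ : Real.sin σ ≠ 0) :
    Function.Injective (bipolarPoint o v a σ) := by
  intro t s hts
  have h := norm_bipolarPoint_sub_sq (o := o) (a := a) hv hσ hσ t s
  have h1 := (mul_pos (cosh_sub_cos_pos hσ t) (cosh_sub_cos_pos hσ s)).ne'
  rw [hts, sub_self, norm_zero, sub_self, Real.cos_zero, zero_pow two_ne_zero, eq_comm,
    div_eq_zero_iff, or_iff_left h1, mul_eq_zero, or_iff_right (by positivity), sub_eq_zero] at h
  by_contra hne
  exact absurd h (Real.one_lt_cosh.2 (sub_ne_zero.2 hne)).ne'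

theorem isArc_bipolarPoint (hv : ‖v‖ = 1) (ha : 0 < a) (hσ : Real.sin σ ≠ 0) :
    IsArc (bipolarPoint o v a σ) (arcWeight a σ) where
  emb := (continuous_bipolarPoint o v a hσ).measurableEmbedding (injective_bipolarPoint hv ha hσ)
  cont := continuous_const.mul (continuous_inv_bipolarWeight hσ)
  pos t := mul_pos (Real.sqrt_pos.2 ha) (inv_pos.2 (bipolarWeight_pos hσ t))

/-- For equal angles $\cosh r-1=2\sinh^2(r/2)$ puts the distance formula in the form required by
`chord_bounds_of_dist_eq`, with speed $a/(\cosh t-\cos\sigma)$. -/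
theorem restrict_range_bipolarPoint (hv : ‖v‖ = 1) (ha : 0 < a) (hσ : Real.sin σ ≠ 0) :
    (μH[1] : Measure Plane).restrict (range (bipolarPoint o v a σ)) =
      arcMeasure (bipolarPoint o v a σ) (arcWeight a σ) := by
  have hA := isArc_bipolarPoint (o := o) hv ha hσ
  have hc : Continuous fun t => arcWeight a σ t ^ 2 := hA.cont.pow 2
  have hp : ∀ t, 0 < arcWeight a σ t ^ 2 := fun t => pow_pos (hA.pos t) 2
  refine restrict_hausdorffMeasure_range_eq_map hA.emb hc hp
    (chord_bounds_of_dist_eq hc hp fun t s => ?_)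
  rw [dist_eq_norm, norm_bipolarPoint_sub_sq hv hσ hσ, arcWeight_sq ha hσ, arcWeight_sq ha hσ,
    sub_self, Real.cos_zero, ← Real.cosh_abs, ← mul_div_cancel₀ |t - s| two_ne_zero,
    Real.cosh_two_mul, Real.cosh_sq, mul_div_cancel₀ _ two_ne_zero]
  have h1 := (cosh_sub_cos_pos hσ t).ne'
  have h2 := (cosh_sub_cos_pos hσ s).ne'
  field_simp
  ring

/-- A circle through the foci consists of two bipolar arcs. -/
theorem isArcPair_bipolarPoint (hv : ‖v‖ = 1) (ha : 0 < a) (hσ : 0 < Real.sin σ) :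
    IsArcPair (circleMeasure (bipolarCenter o v a σ) (a / Real.sin σ)) (bipolarPoint o v a σ)
      (arcWeight a σ) (bipolarPoint o v a (σ + Real.pi)) (arcWeight a (σ + Real.pi)) := by
  have hσ' : Real.sin (σ + Real.pi) ≠ 0 := by
    rw [Real.sin_add_pi]
    exact neg_ne_zero.2 hσ.ne'
  have hne : ∀ t s, bipolarPoint o v a σ t ≠ bipolarPoint o v a (σ + Real.pi) s := by
    intro t s hts
    have h := norm_bipolarPoint_sub_sq (o := o) (a := a) hv hσ.ne' hσ' t s
    have h1 := mul_pos (cosh_sub_cos_pos hσ.ne' t) (cosh_sub_cos_pos hσ' s)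
    rw [hts, sub_self, norm_zero, sub_add_cancel_left, Real.cos_neg, Real.cos_pi] at h
    have h2 := Real.cosh_pos (t - s)
    have : 0 < 2 * a ^ 2 * (Real.cosh (t - s) - -1) /
      ((Real.cosh t - Real.cos σ) * (Real.cosh s - Real.cos (σ + Real.pi))) :=
      div_pos (mul_pos (by positivity) (by linarith)) h1
    linarith
  have hB := isArc_bipolarPoint (o := o) hv ha hσ'
  refine ⟨isArc_bipolarPoint hv ha hσ.ne', hB, ?_, hne⟩
  rw [circleMeasure, Measure.restrict_congr_set (sphere_ae_eq_union_range hv ha hσ),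
    Measure.restrict_union (disjoint_range_iff.2 hne) hB.emb.measurableSet_range,
    restrict_range_bipolarPoint hv ha hσ.ne', restrict_range_bipolarPoint hv ha hσ']

/-- In bipolar coordinates the Poisson kernel of a disk is the one of a strip. -/
theorem arcWeight_sq_mul_poisson (hv : ‖v‖ = 1) (ha : 0 < a) {α β φ : ℝ} (hσ : Real.sin σ ≠ 0)
    (hα : Real.sin α ≠ 0) (hβ : Real.sin β ≠ 0) (hs : Real.sin (α - σ) = Real.sin φ)
    (hc : Real.cos (α - β) = Real.cos φ) (t s : ℝ) :
    arcWeight a β s ^ 2 *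
      (((a / Real.sin σ) ^ 2 - ‖bipolarPoint o v a α t - bipolarCenter o v a σ‖ ^ 2) /
        (a / Real.sin σ * ‖bipolarPoint o v a α t - bipolarPoint o v a β s‖ ^ 2)) =
      2 * Real.pi * stripPoisson φ (t - s) := by
  have h1 := (cosh_sub_cos_pos hα t).ne'
  have h2 := (cosh_sub_cos_pos hβ s).ne'
  rw [sq_sub_norm_bipolarPoint_sub_center_sq hv hσ hα, norm_bipolarPoint_sub_sq hv hα hβ,
    arcWeight_sq ha hβ, hs, hc, stripPoisson]
  have := Real.pi_pos.ne'
  -- Nothing excludes a vanishing denominator here; both sides are then $0$ by the convention for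
  -- division by zero.
  by_cases h3 : Real.cosh (t - s) - Real.cos φ = 0
  · simp [h3]
  · field_simp

end

/-- Two intersecting circles are bipolar circles in a common system of bipolar coordinates. -/
theorem exists_bipolar_coordinates {x₁ x₂ : Plane} {r₁ r₂ : ℝ}
    (hinter : (Metric.ball x₁ r₁ ∩ Metric.ball x₂ r₂).Nonempty)
    (h₁₂ : ¬ Metric.ball x₁ r₁ ⊆ Metric.ball x₂ r₂)
    (h₂₁ : ¬ Metric.ball x₂ r₂ ⊆ Metric.ball x₁ r₁) :
    ∃ (o v : Plane) (a : ℝ), ‖v‖ = 1 ∧ 0 < a ∧ ∃ σ₁ ∈ Ioo 0 Real.pi, ∃ σ₂ ∈ Ioo 0 Real.pi,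
      σ₁ < σ₂ ∧ x₁ = bipolarCenter o v a σ₁ ∧ r₁ = a / Real.sin σ₁ ∧
        x₂ = bipolarCenter o v a σ₂ ∧ r₂ = a / Real.sin σ₂ := by
  obtain ⟨z, hz₁, hz₂⟩ := hinter
  have hr₁ : 0 < r₁ := Metric.pos_of_mem_ball hz₁
  have hr₂ : 0 < r₂ := Metric.pos_of_mem_ball hz₂
  have hd : dist x₁ x₂ < r₁ + r₂ := by
    have := dist_triangle_left x₁ x₂ z
    rw [Metric.mem_ball] at hz₁ hz₂
    linarith
  have hd₁ : r₂ < r₁ + dist x₁ x₂ := not_le.1 fun h => h₁₂ (Metric.ball_subset_ball' h)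
  have hd₂ : r₁ < r₂ + dist x₁ x₂ :=
    not_le.1 fun h => h₂₁ (Metric.ball_subset_ball' (by rwa [dist_comm]))
  set d := dist x₁ x₂ with hd_def
  have hd0 : 0 < d := by linarith
  set v : Plane := d⁻¹ • (x₁ - x₂) with hv_def
  have hv : ‖v‖ = 1 := by
    rw [hv_def, norm_smul, Real.norm_of_nonneg (by positivity), ← dist_eq_norm, ← hd_def,
      inv_mul_cancel₀ hd0.ne']
  -- These are the signed positions of the centres along $v$, measured from the radical axis. The
  -- common value of $r_j^2-p_j^2$ is the square of half the common chord, that is, $a^2$.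
  set p₁ := (d + (r₁ ^ 2 - r₂ ^ 2) / d) / 2 with hp₁
  set p₂ := (-d + (r₁ ^ 2 - r₂ ^ 2) / d) / 2 with hp₂
  have hpp : p₁ - p₂ = d := by rw [hp₁, hp₂]; ring
  have hpow : r₁ ^ 2 - p₁ ^ 2 = r₂ ^ 2 - p₂ ^ 2 := by rw [hp₁, hp₂]; field_simp; ring
  have hA : 0 < r₁ ^ 2 - p₁ ^ 2 := by
    -- This is Heron's factorization; it is positive because the three strict triangle inequalities
    -- hold for $d,r_1,r_2$, which is what the hypotheses on the disks provide.
    have : r₁ ^ 2 - p₁ ^ 2 =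
        (r₂ ^ 2 - (d - r₁) ^ 2) * ((d + r₁) ^ 2 - r₂ ^ 2) / (4 * d ^ 2) := by
      rw [hp₁]; field_simp; ring
    rw [this]
    refine div_pos (mul_pos ?_ ?_) (by positivity)
    · nlinarith
    · nlinarith
  set a := √(r₁ ^ 2 - p₁ ^ 2) with ha_def
  have ha : 0 < a := Real.sqrt_pos.2 hA
  have ha₁ : a ^ 2 = r₁ ^ 2 - p₁ ^ 2 := Real.sq_sqrt hA.le
  have key : ∀ {r p : ℝ}, 0 < r → a ^ 2 = r ^ 2 - p ^ 2 →
      ∃ σ ∈ Ioo 0 Real.pi, Real.cos σ = p / r ∧ Real.sin σ = a / r := by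
    intro r p hr hp
    have hlt : |p| < r := abs_lt_of_sq_lt_sq (by nlinarith) hr.le
    have h1 : -1 < p / r := by rw [lt_div_iff₀ hr]; linarith [neg_lt_of_abs_lt hlt]
    have h2 : p / r < 1 := by rw [div_lt_one hr]; exact lt_of_abs_lt hlt
    refine ⟨Real.arccos (p / r), ⟨Real.arccos_pos.2 h2, ?_⟩, Real.cos_arccos h1.le h2.le, ?_⟩
    · refine lt_of_le_of_ne (Real.arccos_le_pi _) fun h => ?_
      exact absurd (Real.arccos_eq_pi.1 h) (not_le.2 h1)
    · have h3 : 1 - (p / r) ^ 2 = (a / r) ^ 2 := by rw [div_pow, div_pow, hp]; field_simp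
      rw [Real.sin_arccos, h3, Real.sqrt_sq (by positivity)]
  obtain ⟨σ₁, hσ₁, hc₁, hs₁⟩ := key hr₁ ha₁
  obtain ⟨σ₂, hσ₂, hc₂, hs₂⟩ := key hr₂ (ha₁.trans hpow)
  have hcen : ∀ {r p σ : ℝ}, 0 < r → Real.cos σ = p / r → Real.sin σ = a / r →
      a * Real.cos σ / Real.sin σ = p := by
    intro r p σ hr hc hs
    rw [hc, hs]
    field_simp
  refine ⟨x₁ - p₁ • v, v, a, hv, ha, σ₁, hσ₁, σ₂, hσ₂, ?_, ?_, ?_, ?_, ?_⟩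
  -- The order of the angles follows from $\sin(\sigma_2-\sigma_1)=a\,d/(r_1r_2)>0$, the direction
  -- of $v$ having been chosen from $x_2$ to $x_1$.
  · by_contra! hle
    have h1 := Real.sin_nonpos_of_nonpos_of_neg_pi_le (x := σ₂ - σ₁) (by linarith)
      (by linarith [hσ₁.2, hσ₂.1])
    rw [Real.sin_sub, hc₁, hc₂, hs₁, hs₂, show a / r₂ * (p₁ / r₁) - p₂ / r₂ * (a / r₁) =
      a * (p₁ - p₂) / (r₁ * r₂) by field_simp, hpp] at h1
    exact absurd h1 (not_le.2 (by positivity))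
  · rw [bipolarCenter, hcen hr₁ hc₁ hs₁, framePoint, zero_smul, add_zero, sub_add_cancel]
  · rw [hs₁, div_div_cancel₀ ha.ne']
  · rw [bipolarCenter, hcen hr₂ hc₂ hs₂, framePoint, zero_smul, add_zero, sub_add, ← sub_smul, hpp,
      hv_def, smul_inv_smul₀ hd0.ne', sub_sub_cancel]
  · rw [hs₂, div_div_cancel₀ ha.ne']

/-! ### Assembly of the unitary maps and the multiplier formulas. -/

theorem IsArcPair.isUnitaryOntoHardy {c : Plane} {r σ : ℝ} {p q : ℝ → Plane}
    {w w' : ℝ → ℝ} (h : IsArcPair (circleMeasure c r) p w q w')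
    (hσ : Real.sin σ ≠ 0) (hσ' : Real.sin (σ + Real.pi) ≠ 0) :
    IsUnitaryOntoHardy σ
      (h.coordEquiv ≪≫ₗ (hardyEquiv hσ).prodCongr (hardyEquiv hσ')) := fun u =>
  ⟨_, _, hasHardyNormSq_hardyMap hσ (h.coord u), hasHardyNormSq_hardyMap hσ' (h.swap.coord u),
    h.norm_sq_eq u⟩

theorem multT2_multT1 (θ : ℝ) (p : (ℂ → ℂ) × (ℂ → ℂ)) :
    multT2 θ (multT1 θ p) = multT21 θ p := by
  simp only [multT1, multT2, multT21, Prod.mk.injEq]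
  constructor <;> ring

theorem theorem4p5 (x₁ x₂ : Plane) (r₁ r₂ : ℝ)
    (hinter : (Metric.ball x₁ r₁ ∩ Metric.ball x₂ r₂).Nonempty)
    (h₁₂ : ¬ Metric.ball x₁ r₁ ⊆ Metric.ball x₂ r₂)
    (h₂₁ : ¬ Metric.ball x₂ r₂ ⊆ Metric.ball x₁ r₁) :
    ∃ (γ₁ : L2Circle x₂ r₂ →L[ℂ] L2Circle x₁ r₁) (γ₂ : L2Circle x₁ r₁ →L[ℂ] L2Circle x₂ r₂),
      IsDtD x₂ r₂ x₁ r₁ γ₁ ∧ IsDtD x₁ r₁ x₂ r₂ γ₂ ∧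
      ∃ σ₁ ∈ Ioo 0 Real.pi, ∃ σ₂ ∈ Ioo 0 Real.pi, σ₁ < σ₂ ∧
        (∀ φ : ℝ, φ = σ₂ - σ₁ ∨ φ = Real.pi - (σ₂ - σ₁) → ∀ z ∈ dualStrip, z ≠ 0 →
          stripPoissonHat φ z =
            Complex.sinh (((Real.pi - φ : ℝ) : ℂ) * z) / Complex.sinh ((Real.pi : ℂ) * z)) ∧
        ∃ (U₁ : L2Circle x₁ r₁ ≃ₗ[ℂ] (hardySpace × hardySpace))
          (U₂ : L2Circle x₂ r₂ ≃ₗ[ℂ] (hardySpace × hardySpace)),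
          IsUnitaryOntoHardy σ₁ U₁ ∧ IsUnitaryOntoHardy σ₂ U₂ ∧
          (∀ u, hardyPair (U₂ (ContinuousLinearMap.adjoint γ₁ u)) =
            multT1 (σ₂ - σ₁) (hardyPair (U₁ u))) ∧
          (∀ v, hardyPair (U₁ (ContinuousLinearMap.adjoint γ₂ v)) =
            multT2 (σ₂ - σ₁) (hardyPair (U₂ v))) ∧
          (∀ u, hardyPair (U₁ (ContinuousLinearMap.adjoint (γ₁ ∘L γ₂) u)) =
            multT21 (σ₂ - σ₁) (hardyPair (U₁ u))) := by
  obtain ⟨o, v, a, hv, ha, σ₁, hσ₁, σ₂, hσ₂, hlt, rfl, rfl, rfl, rfl⟩ :=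
    exists_bipolar_coordinates hinter h₁₂ h₂₁
  have hs₁ := Real.sin_pos_of_mem_Ioo hσ₁
  have hs₂ := Real.sin_pos_of_mem_Ioo hσ₂
  have hs₁' : Real.sin (σ₁ + Real.pi) ≠ 0 := by
    rw [Real.sin_add_pi]
    exact neg_ne_zero.2 hs₁.ne'
  have hs₂' : Real.sin (σ₂ + Real.pi) ≠ 0 := by
    rw [Real.sin_add_pi]
    exact neg_ne_zero.2 hs₂.ne'
  have hθ : σ₂ - σ₁ ∈ Ioo 0 Real.pi := ⟨sub_pos.2 hlt, by linarith [hσ₁.1, hσ₂.2]⟩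
  have hθ' : Real.pi - (σ₂ - σ₁) ∈ Ioo 0 Real.pi := ⟨sub_pos.2 hθ.2, sub_lt_self _ hθ.1⟩
  have hsθ := Real.sin_pos_of_mem_Ioo hθ
  have hA := isArcPair_bipolarPoint (o := o) hv ha hs₁
  have hB := isArcPair_bipolarPoint (o := o) hv ha hs₂
  have e₁ : σ₁ + Real.pi - σ₂ = Real.pi - (σ₂ - σ₁) := by ring
  have e₂ : σ₂ + Real.pi - σ₁ = σ₂ - σ₁ + Real.pi := by ring
  -- The part of the second circle inside the first disk is the arc of angle $\sigma_2$. It makes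
  -- the angle $\theta$ with the arc $\sigma_1$ and $\pi-\theta$ with the arc $\sigma_1+\pi$.
  obtain ⟨γ₂, hγ₂, hγ₂'⟩ := exists_isDtD hs₁.ne' hs₁' hs₂.ne' hθ hθ' hA hB
    (fun t => (bipolarPoint_mem_ball_iff hv ha hs₁ hs₂.ne' t).2 hsθ)
    (fun t => by
      rw [bipolarPoint_mem_ball_iff hv ha hs₁ hs₂', e₂, Real.sin_add_pi]
      linarith)
    (arcWeight_sq_mul_poisson hv ha hs₁.ne' hs₂.ne' hs₁.ne' rfl rfl)
    (arcWeight_sq_mul_poisson hv ha hs₁.ne' hs₂.ne' hs₁' (Real.sin_pi_sub _).symm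
      (by rw [← sub_sub, Real.cos_sub_pi, Real.cos_pi_sub]))
  -- Here the inner arc of the first circle is the one of angle $\sigma_1+\pi$, so its two arcs are
  -- swapped and only the component $g$ enters $T_1$. The angles to the arcs $\sigma_2$ and
  -- $\sigma_2+\pi$ are $\pi-\theta$ and $\theta$.
  obtain ⟨γ₁, hγ₁, hγ₁'⟩ := exists_isDtD hs₂.ne' hs₂' hs₁' hθ' hθ hB hA.swap
    (fun t => (bipolarPoint_mem_ball_iff hv ha hs₂ hs₁' t).2 (by rwa [e₁, Real.sin_pi_sub]))
    (fun t => by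
      rw [bipolarPoint_mem_ball_iff hv ha hs₂ hs₁.ne', ← neg_sub, Real.sin_neg]
      linarith)
    (arcWeight_sq_mul_poisson hv ha hs₂.ne' hs₁' hs₂.ne' (by rw [e₁]) (by rw [e₁]))
    (arcWeight_sq_mul_poisson hv ha hs₂.ne' hs₁' hs₂' (by rw [e₁, Real.sin_pi_sub])
      (by rw [add_sub_add_right_eq_sub, ← neg_sub, Real.cos_neg]))
  have hT₁ : ∀ u, hardyPair ((hB.coordEquiv ≪≫ₗ
      (hardyEquiv hs₂.ne').prodCongr (hardyEquiv hs₂')) (ContinuousLinearMap.adjoint γ₁ u)) =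
      multT1 (σ₂ - σ₁) (hardyPair ((hA.coordEquiv ≪≫ₗ
        (hardyEquiv hs₁.ne').prodCongr (hardyEquiv hs₁')) u)) := fun u => by
    refine Prod.ext ?_ ?_
    · change (hardyMap hs₂.ne' (hB.coord (ContinuousLinearMap.adjoint γ₁ u)) : ℂ → ℂ) = _
      rw [(hγ₁' u).1, hardyMap_op_bipolarKernel hθ' hs₁' hs₂.ne']
      rfl
    · change (hardyMap hs₂' (hB.swap.coord (ContinuousLinearMap.adjoint γ₁ u)) : ℂ → ℂ) = _
      rw [(hγ₁' u).2, hardyMap_op_bipolarKernel hθ hs₁' hs₂']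
      rfl
  have hT₂ : ∀ u, hardyPair ((hA.coordEquiv ≪≫ₗ
      (hardyEquiv hs₁.ne').prodCongr (hardyEquiv hs₁')) (ContinuousLinearMap.adjoint γ₂ u)) =
      multT2 (σ₂ - σ₁) (hardyPair ((hB.coordEquiv ≪≫ₗ
        (hardyEquiv hs₂.ne').prodCongr (hardyEquiv hs₂')) u)) := fun u => by
    refine Prod.ext ?_ ?_
    · change (hardyMap hs₁.ne' (hA.coord (ContinuousLinearMap.adjoint γ₂ u)) : ℂ → ℂ) = _
      rw [(hγ₂' u).1, hardyMap_op_bipolarKernel hθ hs₂.ne' hs₁.ne']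
      rfl
    · change (hardyMap hs₁' (hA.swap.coord (ContinuousLinearMap.adjoint γ₂ u)) : ℂ → ℂ) = _
      rw [(hγ₂' u).2, hardyMap_op_bipolarKernel hθ' hs₂.ne' hs₁']
      rfl
  refine ⟨γ₁, γ₂, hγ₁, hγ₂, σ₁, hσ₁, σ₂, hσ₂, hlt, ?_, _, _, hA.isUnitaryOntoHardy hs₁.ne' hs₁',
    hB.isUnitaryOntoHardy hs₂.ne' hs₂', hT₁, hT₂, fun u => ?_⟩
  · rintro φ (rfl | rfl) z hz hz0
    · exact stripPoissonHat_formula hθ hz hz0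
    · exact stripPoissonHat_formula hθ' hz hz0
  · rw [ContinuousLinearMap.adjoint_comp, ContinuousLinearMap.comp_apply, hT₂, hT₁, multT2_multT1]
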